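/- Let $n\ge 2$, let $2<p_1<\dots<p_n$ be integers, $\lambda_i\ge 0$ with $\sum_i\lambda_i=1$, and $\xi(x)=\sum_{i=1}^n\lambda_i x^{p_i}$. Let $\mathcal K$ be the set of measures $\nu(dx)=\gamma(x)\mathbf 1_{[0,1)}(x)\,dx+\Delta\,\delta_1(dx)$ with $\gamma\ge0$ nondecreasing and right-continuous on $[0,1)$ and $\Delta>0$, and let the Parisi measure at zero temperature $\nu_P$ be the minimizer over $\mathcal K$ of $\mathcal Q(\nu)=\frac12\big(\int_0^1\xi'\,d\nu+\int_0^1\frac{dx}{\nu((x,1])}\big)$. A *block system* with $k$ steps consists of $t\ge2$, integers $s_1,\dots,s_t\ge 0$ with $\sum_j s_j=k$ and $s_j\ge1$ for $1<j<t$, and points $q^j_{w_{j-1}}<q^j_{w_{j-1}+1}<\dots<q^j_{w_j}$ ($1\le j\le t$, $w_j=s_1+\dots+s_j$) with $q^1_0=0$, $q^t_{w_t}=1$ and $q^j_{w_j}<q^{j+1}_{w_j}$ for $j<t$. A measure $\nu$ has the $k$-FRSB form with this block system if there are $0<m_1<\dots<m_k$, a nonnegative strictly increasing function $\omega$ on $\bigcup_{j<t}[q^j_{w_j},q^{j+1}_{w_j}]$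 and $\Delta>0$ with $$\nu(dx)=\sum_{j=1}^t\sum_{l=w_{j-1}+1}^{w_j}m_l\mathbf 1_{[q^j_{l-1},q^j_l]}(x)\,dx+\sum_{j=1}^{t-1}\omega(x)\mathbf 1_{[q^j_{w_j},q^{j+1}_{w_j}]}(x)\,dx+\Delta\,\delta_1(dx),$$ and $\nu$ is $k$-FRSB if it has this form for some block system. Put $h(x,y,z)=\xi(y)-\xi(x)-\xi'(x)(y-x)+[\xi'(y)-\xi'(x)](y-x)\big(\frac1{z-1}-\frac{z\log z}{(z-1)^2}\big)$, $r_1(x,y,z)=\frac{[\xi'(z)-\xi'(y)](z-x)}{(z-y)[\xi'(z)-\xi'(x)]}$, $r_2(x,y)=\frac{\xi''(y)(y-x)}{\xi'(y)-\xi'(x)}$. For $x_0<\dots<x_s$, $s\ge1$, put $\mathbf r_l=r_1(x_{l-1},x_{l+1},x_l)$, let $N_l=\lfloor (s-l)/2\rfloor$ and $\epsilon_l=(-1)^{s-l}$, and $$\mathcal F_l=r_2(x_{l-\epsilon_l},x_l)\prod_{i=1}^{N_l}\Big(\frac{\mathbf r_{s+1-2i}}{\mathbf r_{s-2i}}\Big)^{\epsilon_l}\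 (0\le l\le s),\qquad \mathcal A_l=r_1(x_l,x_{l-\epsilon_l},x_{l+\epsilon_l})\prod_{i=1}^{N_l}\Big(\frac{\mathbf r_{s-2i}}{\mathbf r_{s+1-2i}}\Big)^{\epsilon_l}\ (1\le l\le s-1),$$ where for $l=0$ and $s$ even the quotient $r_2(x_{-1},x_0)/\mathbf r_0$ means $r_2(x_1,x_0)$. Let $\mathcal Z$ be the maximum of the $\mathcal F_l$ with $s-l$ odd and the $\mathcal A_l$ with $s-l$ even, and $\mathcal Y$ the maximum of the $\mathcal F_l$ with $s-l$ even and the $\mathcal A_l$ with $s-l$ odd. For a block system with all $s_j\ge1$ write $F^j_l,A^j_l,Z^j,Y^j$ for $\mathcal F_{l-w_{j-1}},\mathcal A_{l-w_{j-1}},\mathcal Z,\mathcal Y$ taken with $s=s_j$ at $(q^j_{w_{j-1}},\dots,q^j_{w_j})$, and let $*_j=F^j_{w_j}$ for $j<t$, $*_t=(F^t_{w_{t-1}})^{(-1)^{s_t}}$. **Theorem.** The Parisi measure $\nu_P$ is $n$-FRSB if and only if there is a block system with $n$ steps and all $s_j\ge1$ such that (1) $h\big(q^j_{l-1},q^j_l,\,z^j_l\big)=0$,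 where $z^j_l:=r_2(q^j_{l-1},q^j_l)(F^j_l)^{-1}(*_j)^{(-1)^{w_j-l}}$, for all $1\le j\le t$ and $w_{j-1}<l\le w_j$, and $F^j_{w_{j-1}}=(F^j_{w_j})^{(-1)^{s_j}}$ for $1<j<t$; (2) $Y^j\le *_j\le (Z^j)^{-1}$ for $1\le j\le t$ (with $0^{-1}=\infty$), where moreover $A^j_l\neq *_j$ if $w_j-l$ is odd and $A^j_l\ne (*_j)^{-1}$ if $w_j-l$ is even, for all $w_{j-1}<l<w_j$. More precisely, for every block system with $n$ steps and all $s_j\ge1$, conditions (1) and (2) hold if and only if there is a minimizer of $\mathcal Q$ over $\mathcal K$ which has the $n$-FRSB form with this block system. Moreover, (1) and (2) imply (3) for all $j$, all $w_{j-1}<l\le w_j$ and every $y\in(q^j_{l-1},q^j_l)$ with $r_1(q^j_{l-1},q^j_l,y)=z^j_l$, one has $h\big(y,q^j_l,r_1(y,q^j_l,q^j_{l-1})\big)\ge0$; (4) $\frac{d^2}{dx^2}\{\xi''(x)^{-1/2}\}\le0$ for $x\in[q^j_{w_j},q^{j+1}_{w_j}]$, $1\le j<t$. -/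

import Mathlib

open MeasureTheory

noncomputable section

namespace SphericalSpinGlass

/-- The mixture `ξ(x) = ∑ i, lam i * x ^ p i` of the spherical mixed `p`-spin model. -/
def mixture {n : ℕ} (p : Fin n → ℕ) (lam : Fin n → ℝ) (x : ℝ) : ℝ :=
  ∑ i, lam i * x ^ p i

/-! ### The zero temperature Parisi measure -/

/-- The class of measures `γ(x) 1_{[0,1)}(x) dx + Δ δ_1` on `[0,1]` with `γ` nonnegative,
right-continuous and nondecreasing on `[0,1)` and `Δ > 0`. -/
def measureClass : Set (Measure ℝ) :=
  {ν | ∃ (γ : ℝ → ℝ) (Δ : ℝ),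
    (∀ x ∈ Set.Ico (0 : ℝ) 1, 0 ≤ γ x) ∧
    MonotoneOn γ (Set.Ico (0 : ℝ) 1) ∧
    (∀ x ∈ Set.Ico (0 : ℝ) 1, ContinuousWithinAt γ (Set.Ici x) x) ∧
    0 < Δ ∧
    ν = (volume.restrict (Set.Ico (0 : ℝ) 1)).withDensity (fun x => ENNReal.ofReal (γ x)) +
      ENNReal.ofReal Δ • Measure.dirac (1 : ℝ)}

/-- The Crisanti-Sommers functional
`Q(ν) = (1/2) (∫_0^1 ξ'(x) ν(dx) + ∫_0^1 dx / ν((x,1]))`, with values in `[0,∞]`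
(all integrands are nonnegative; a measure of infinite mass gets the value `∞`). -/
def crisantiSommers (ξ : ℝ → ℝ) (ν : Measure ℝ) : ENNReal :=
  2⁻¹ * ((∫⁻ x in Set.Icc (0 : ℝ) 1, ENNReal.ofReal (deriv ξ x) ∂ν) +
    ∫⁻ x in Set.Icc (0 : ℝ) 1, (ν (Set.Ioc x 1))⁻¹)

/-- `ν` is the Parisi measure at zero temperature: it minimizes the Crisanti-Sommers functional
over `measureClass`. -/
def IsParisiMeasure (ξ : ℝ → ℝ) (ν : Measure ℝ) : Prop :=
  ν ∈ measureClass ∧ ∀ ν' ∈ measureClass, crisantiSommers ξ ν ≤ crisantiSommers ξ ν'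

/-! ### `k`-FRSB measures

The breakpoints come in blocks `j = 1, …, t`; block `j` consists of the points
`q j 0 < q j 1 < ⋯ < q j (s j)`, so that `q j i` is the point with global index `w_{j-1} + i`
of the `j`-th block. -/

/-- The partial sums `w_j = s_1 + ⋯ + s_j`. -/
def blockEnd (s : ℕ → ℕ) (j : ℕ) : ℕ := ∑ i ∈ Finset.Icc 1 j, s i

/-- `t ≥ 2` blocks with `s_1 + ⋯ + s_t = k` steps, increasing breakpoints from `0` to `1`, and an
interval of positive length between any two consecutive blocks. Only the first and the last block
may be reduced to a single point (a smooth density that starts at `0`, or that ends at `1`); a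
single point between two smooth densities would not be a block. -/
def IsBlockSystem (k t : ℕ) (s : ℕ → ℕ) (q : ℕ → ℕ → ℝ) : Prop :=
  2 ≤ t ∧
  ∑ j ∈ Finset.Icc 1 t, s j = k ∧
  (∀ j, 1 < j → j < t → 1 ≤ s j) ∧
  q 1 0 = 0 ∧ q t (s t) = 1 ∧
  (∀ j ∈ Finset.Icc 1 t, ∀ i < s j, q j i < q j (i + 1)) ∧
  (∀ j, 1 ≤ j → j < t → q j (s j) < q (j + 1) 0)

/-- The union of the intervals `[q^j_{w_j}, q^{j+1}_{w_j}]`, `1 ≤ j < t`, between the blocks. -/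
def gapSet (t : ℕ) (s : ℕ → ℕ) (q : ℕ → ℕ → ℝ) : Set ℝ :=
  {x | ∃ j, 1 ≤ j ∧ j < t ∧ x ∈ Set.Icc (q j (s j)) (q (j + 1) 0)}

/-- The density `∑_j ∑_l m_l 1_{[q^j_{l-1}, q^j_l]} + ∑_{j<t} ω 1_{[q^j_{w_j}, q^{j+1}_{w_j}]}`. -/
def frsbDensity (t : ℕ) (s : ℕ → ℕ) (q : ℕ → ℕ → ℝ) (m : ℕ → ℝ) (ω : ℝ → ℝ) (x : ℝ) : ℝ :=
  (∑ j ∈ Finset.Icc 1 t, ∑ i ∈ Finset.Icc 1 (s j),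
      (Set.Icc (q j (i - 1)) (q j i)).indicator (fun _ => m (blockEnd s (j - 1) + i)) x) +
    ∑ j ∈ Finset.Icc 1 (t - 1), (Set.Icc (q j (s j)) (q (j + 1) 0)).indicator ω x

/-- `ν` has the `k`-FRSB form with the breakpoints `q`, for some levels
`0 < m_1 < ⋯ < m_k`, some strictly increasing `ω` and some `Δ > 0`. -/
def HasFRSBForm (k t : ℕ) (s : ℕ → ℕ) (q : ℕ → ℕ → ℝ) (ν : Measure ℝ) : Prop :=
  IsBlockSystem k t s q ∧
  ∃ (m : ℕ → ℝ) (ω : ℝ → ℝ) (Δ : ℝ),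
    (∀ l ∈ Finset.Icc 1 k, 0 < m l) ∧
    StrictMonoOn m (Set.Icc 1 k) ∧
    StrictMonoOn ω (gapSet t s q) ∧
    (∀ x ∈ gapSet t s q, 0 ≤ ω x) ∧
    0 < Δ ∧
    ν = volume.withDensity (fun x => ENNReal.ofReal (frsbDensity t s q m ω x)) +
      ENNReal.ofReal Δ • Measure.dirac (1 : ℝ)

/-- `ν` is `k`-FRSB. -/
def IsFRSB (k : ℕ) (ν : Measure ℝ) : Prop :=
  ∃ (t : ℕ) (s : ℕ → ℕ) (q : ℕ → ℕ → ℝ), HasFRSBForm k t s q ν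

/-! ### The functions of the criterion -/

/-- The function `h(x,y,z)`. -/
def hFun (ξ : ℝ → ℝ) (x y z : ℝ) : ℝ :=
  ξ y - ξ x - deriv ξ x * (y - x) +
    (deriv ξ y - deriv ξ x) * (y - x) * (1 / (z - 1) - z / (z - 1) ^ 2 * Real.log z)

/-- The function `r_1(x,y,z)`. -/
def r₁ (ξ : ℝ → ℝ) (x y z : ℝ) : ℝ :=
  ((deriv ξ z - deriv ξ y) * (z - x)) / ((z - y) * (deriv ξ z - deriv ξ x))

/-- The function `r_2(x,y)`. -/
def r₂ (ξ : ℝ → ℝ) (x y : ℝ) : ℝ :=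
  (deriv (deriv ξ) y * (y - x)) / (deriv ξ y - deriv ξ x)

/-- `𝐫_l(x) = r_1(x_{l-1}, x_{l+1}, x_l)`, for `l ≥ 1`. -/
def rBlock (ξ : ℝ → ℝ) (x : ℕ → ℝ) (l : ℕ) : ℝ :=
  r₁ ξ (x (l - 1)) (x (l + 1)) (x l)

/-- `𝓕_l^s(x_0, …, x_s)` for `0 ≤ l ≤ s`, `1 ≤ s`. For `s` even and `l = 0` the general formula
reads `r_2(x_{-1}, x_0) ∏_{i=1}^{s/2} 𝐫_{s+1-2i} / 𝐫_{s-2i}`, in which the fictitious point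
`x_{-1}` cancels, since `r_2(x_{-1}, x_0) / 𝐫_0 = r_2(x_1, x_0)`; it is written here in the
cancelled form. -/
def FBlock (ξ : ℝ → ℝ) (s : ℕ) (x : ℕ → ℝ) (l : ℕ) : ℝ :=
  if Odd (s - l) then
    r₂ ξ (x (l + 1)) (x l) *
      ∏ i ∈ Finset.Icc 1 ((s - l) / 2), rBlock ξ x (s - 2 * i) / rBlock ξ x (s + 1 - 2 * i)
  else if l = 0 then
    r₂ ξ (x 1) (x 0) * rBlock ξ x 1 *
      ∏ i ∈ Finset.Icc 1 (s / 2 - 1), rBlock ξ x (s + 1 - 2 * i) / rBlock ξ x (s - 2 * i)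
  else
    r₂ ξ (x (l - 1)) (x l) *
      ∏ i ∈ Finset.Icc 1 ((s - l) / 2), rBlock ξ x (s + 1 - 2 * i) / rBlock ξ x (s - 2 * i)

/-- `𝓐_l^s(x_0, …, x_s)` for `1 ≤ l ≤ s - 1`. -/
def ABlock (ξ : ℝ → ℝ) (s : ℕ) (x : ℕ → ℝ) (l : ℕ) : ℝ :=
  if Odd (s - l) then
    r₁ ξ (x l) (x (l + 1)) (x (l - 1)) *
      ∏ i ∈ Finset.Icc 1 ((s - l) / 2), rBlock ξ x (s + 1 - 2 * i) / rBlock ξ x (s - 2 * i)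
  else
    r₁ ξ (x l) (x (l - 1)) (x (l + 1)) *
      ∏ i ∈ Finset.Icc 1 ((s - l) / 2), rBlock ξ x (s - 2 * i) / rBlock ξ x (s + 1 - 2 * i)

/-- `𝓩^s(x_0, …, x_s)`: the maximum of a finite set, nonempty for `s ≥ 1`. -/
def ZBlock (ξ : ℝ → ℝ) (s : ℕ) (x : ℕ → ℝ) : ℝ :=
  sSup ({a | ∃ l, l ≤ s ∧ Odd (s - l) ∧ a = FBlock ξ s x l} ∪
    {a | ∃ l, 1 ≤ l ∧ l < s ∧ Even (s - l) ∧ a = ABlock ξ s x l})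

/-- `𝓨^s(x_0, …, x_s)`: the maximum of a finite set, nonempty for `s ≥ 1`. -/
def YBlock (ξ : ℝ → ℝ) (s : ℕ) (x : ℕ → ℝ) : ℝ :=
  sSup ({a | ∃ l, l ≤ s ∧ Even (s - l) ∧ a = FBlock ξ s x l} ∪
    {a | ∃ l, 1 ≤ l ∧ l < s ∧ Odd (s - l) ∧ a = ABlock ξ s x l})

/-- The third argument of `h` on the `l`-th step of a block:
`r_2(x_{l-1}, x_l) (F_l)⁻¹ y^{(-1)^{s-l}}`. -/
def stepRatio (ξ : ℝ → ℝ) (s : ℕ) (x : ℕ → ℝ) (y : ℝ) (l : ℕ) : ℝ :=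
  r₂ ξ (x (l - 1)) (x l) * (FBlock ξ s x l)⁻¹ * y ^ ((-1 : ℤ) ^ (s - l))

/-- `h_l(x, y) = h(x_{l-1}, x_l, r_2(x_{l-1}, x_l) (F_l)⁻¹ y^{(-1)^{s-l}})`, `1 ≤ l ≤ s`. -/
def hBlock (ξ : ℝ → ℝ) (s : ℕ) (x : ℕ → ℝ) (y : ℝ) (l : ℕ) : ℝ :=
  hFun ξ (x (l - 1)) (x l) (stepRatio ξ s x y l)

/-- `*_j = F^j_{w_j}` for `j < t`, and `*_t = (F^t_{w_{t-1}})^{(-1)^{s_t}}`. -/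
def star (ξ : ℝ → ℝ) (t : ℕ) (s : ℕ → ℕ) (q : ℕ → ℕ → ℝ) (j : ℕ) : ℝ :=
  if j < t then FBlock ξ (s j) (q j) (s j)
  else FBlock ξ (s j) (q j) 0 ^ ((-1 : ℤ) ^ s j)

/-! ### The conditions -/

/-- Condition (1): the block systems of `h`-equations and the matching conditions. -/
def BlockEquations (ξ : ℝ → ℝ) (t : ℕ) (s : ℕ → ℕ) (q : ℕ → ℕ → ℝ) : Prop :=
  (∀ j ∈ Finset.Icc 1 t, ∀ l ∈ Finset.Icc 1 (s j),
    hBlock ξ (s j) (q j) (star ξ t s q j) l = 0) ∧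
  (∀ j, 1 < j → j < t →
    FBlock ξ (s j) (q j) 0 = FBlock ξ (s j) (q j) (s j) ^ ((-1 : ℤ) ^ s j))

/-- Condition (2): `Y^j ≤ *_j ≤ (Z^j)⁻¹`. The upper bound is written `*_j Z^j ≤ 1`, because
`Z^1 = 0` (so that `(Z^1)⁻¹ = ∞`) when the first block has one step. The last clause says that the
bounds by the terms `A_l` are not attained: they express `m_l < m_{l+1}` inside the block. -/
def BlockBounds (ξ : ℝ → ℝ) (t : ℕ) (s : ℕ → ℕ) (q : ℕ → ℕ → ℝ) : Prop :=
  ∀ j ∈ Finset.Icc 1 t,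
    YBlock ξ (s j) (q j) ≤ star ξ t s q j ∧
    star ξ t s q j * ZBlock ξ (s j) (q j) ≤ 1 ∧
    ∀ l, 1 ≤ l → l < s j →
      star ξ t s q j ^ ((-1 : ℤ) ^ (s j - l + 1)) ≠ ABlock ξ (s j) (q j) l

/-- Condition (3): for every critical point `y` in the open step `(q^j_{l-1}, q^j_l)`, i.e. every
solution of `r_1(q^j_{l-1}, q^j_l, y) = r_2(q^j_{l-1}, q^j_l) (F^j_l)⁻¹ (*_j)^{(-1)^{w_j - l}}`,
one has `h(y, q^j_l, r_1(y, q^j_l, q^j_{l-1})) ≥ 0`. -/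
def PositivityCondition (ξ : ℝ → ℝ) (t : ℕ) (s : ℕ → ℕ) (q : ℕ → ℕ → ℝ) : Prop :=
  ∀ j ∈ Finset.Icc 1 t, ∀ l ∈ Finset.Icc 1 (s j),
    ∀ y ∈ Set.Ioo (q j (l - 1)) (q j l),
      r₁ ξ (q j (l - 1)) (q j l) y = stepRatio ξ (s j) (q j) (star ξ t s q j) l →
      0 ≤ hFun ξ y (q j l) (r₁ ξ y (q j l) (q j (l - 1)))

/-- Condition (4): `(ξ''^{-1/2})'' ≤ 0` on the intervals between the blocks. -/
def ConcavityCondition (ξ : ℝ → ℝ) (t : ℕ) (s : ℕ → ℕ) (q : ℕ → ℕ → ℝ) : Prop :=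
  ∀ x ∈ gapSet t s q,
    deriv (deriv (fun u => (deriv (deriv ξ) u) ^ (-(1 / 2) : ℝ))) x ≤ 0

end SphericalSpinGlass

end

/-! Write `a(x) = ν((x,1])`. Expanding `1/a` exactly to second order shows that the functional
exceeds its first order expansion by a nonnegative quadratic term (`csReal_sub`). Hence the
minimizer is unique, and it is characterized by the potential `F(x) = ξ'(x) - ∫_0^x a⁻²`: one needs
`F(1) = 0` and `∫_u^1 F ≥ 0` for all `u`, with equality wherever the density increases
(`isParisiMeasure_of_potential`; the converse uses `IsParisiMeasure.variation_nonneg`).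

For an FRSB measure these conditions become local. Between the blocks `F` vanishes, so `ξ'' a² = 1`.
On a step `a` is affine, `F` and its integral vanish at both ends, and `ξ'' a² ≤ 1` at both ends.
The resulting data, the values of `a` at the breakpoints, form an `IsProfile`. Conditions (1) and
(2) are the same data with `a` eliminated: the equations `a_l a_{l+1} = (x_{l+1} - x_l)/(ξ'(x_{l+1})
- ξ'(x_l))` fix the values in a block up to one parameter, the last quotient, and `FBlock`, `ABlock`
and `star` are expressed through it (`criterion_iff_isProfile`).

It remains to see that a profile with `n` steps satisfies the global conditions: the integral of `F`
has the right sign inside every step, and the density is increasing. Both follow from a count. On a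
step with `a(y) = c - m y`, the derivative of `ξ'' a²` has the sign of `slopeRatio - m/c`. Since `F`
changes sign on the step, `ξ'' a² - 1` shows a bump `-,+,-` or a dip `+,-,+`. A bump makes
`slopeRatio` pass once from above the level `m/c` to below it; a dip does so twice. The levels
increase along a block, so each further step requires a new ascent before its descent, and so does
each gap, because `ξ'' a² = 1` at its ends. Thus `n` steps use `n` descents and `n - 1` ascents,
that is, `2n - 1` alternating signs of `slopeSign = 2 ξ'' ξ'''' - 3 ξ'''²`.

This is all there is room for. `slopeSign` is the Wronskian of `ξ'''` and `x ξ''' + 2 ξ''`, sums of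
at most `n` monomials, and a Rolle argument bounds the number of its alternating signs by `2n - 1`
(`not_altBelow_fewnomialWronskian`). So there is no dip, whence the integral of `F` has the right
sign (`IsStep.stepG_nonpos`); no block is empty (`IsProfile.one_le`); the density jumps upward at
the start of a block (`IsProfile.lt_slope`) and does not drop at its end
(`IsStep.slope_le_of_right_eq`); and `(ξ'')^{-1/2}` is concave between blocks
(`IsProfile.slopeSign_nonneg`). Conditions (3) and (4) are by-products of the same facts. -/

noncomputable section

namespace SphericalSpinGlass

/-! ### Alternating sign sequences and Rolle's theorem -/

/-- There are `k` points in `(0, x)` at which `f` has alternating signs, the sign at the last of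
them being that of `ε`. -/
def AltBelow (f : ℝ → ℝ) : ℕ → ℝ → ℝ → Prop
  | 0, _, _ => True
  | k + 1, ε, x => ∃ y, 0 < y ∧ y < x ∧ 0 < ε * f y ∧ AltBelow f k (-ε) y

lemma AltBelow.mono {f : ℝ → ℝ} {k : ℕ} {ε x x' : ℝ} (h : AltBelow f k ε x) (hx : x ≤ x') :
    AltBelow f k ε x' := by
  cases k with
  | zero => trivial
  | succ k =>
    obtain ⟨y, h0, h1, h2, h3⟩ := h
    exact ⟨y, h0, h1.trans_le hx, h2, h3⟩

lemma AltBelow.pred {f : ℝ → ℝ} {k : ℕ} {ε x : ℝ} (h : AltBelow f (k + 1) ε x) :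
    AltBelow f k (-ε) x := by
  obtain ⟨y, _, h1, _, h3⟩ := h
  exact h3.mono h1.le

lemma AltBelow.congr_sign {f g : ℝ → ℝ} {k : ℕ} {ε x : ℝ} (h : AltBelow f k ε x)
    (hfg : ∀ y, 0 < y → ∃ c, 0 < c ∧ g y = c * f y) : AltBelow g k ε x := by
  induction k generalizing ε x with
  | zero => trivial
  | succ k ih =>
    obtain ⟨y, h0, h1, h2, h3⟩ := h
    obtain ⟨c, hc, hg⟩ := hfg y h0
    refine ⟨y, h0, h1, ?_, ih h3⟩
    rw [hg, mul_left_comm]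
    positivity

/-- Rolle's theorem for alternating sign sequences. -/
lemma AltBelow.deriv {f f' : ℝ → ℝ} (hf : ∀ x, 0 < x → HasDerivAt f (f' x) x) {k : ℕ} {ε x : ℝ}
    (h : AltBelow f (k + 1) ε x) : AltBelow f' k ε x := by
  obtain ⟨y, h0, h1, h2, h3⟩ := h
  -- The points for `f'` are sought below the last point `y` of `f`, so that those given by the
  -- induction lie below `z` and the mean value point lands above them in `(z, y)`.
  suffices H : AltBelow f' k ε y from H.mono h1.le
  clear h1
  induction k generalizing ε y with
  | zero => trivial
  | succ k ih =>
    obtain ⟨z, z0, z1, z2, z3⟩ := h3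
    have hz := ih z z0 z2 z3
    obtain ⟨c, hc, hc'⟩ := exists_hasDerivAt_eq_slope f f' z1
      (fun w hw => (hf w (z0.trans_le hw.1)).continuousAt.continuousWithinAt)
      (fun w hw => hf w (z0.trans hw.1))
    refine ⟨c, z0.trans hc.1, hc.2, ?_, hz.mono hc.1.le⟩
    rw [hc', ← mul_div_assoc]
    apply div_pos _ (by linarith)
    nlinarith

/-- One Rolle step for the ratio `P / R`: the sign changes of the Wronskian of `P` and `R` exceed
those of the Wronskian of `x P' - α P` and `x R' - α R` by at most one. -/
lemma AltBelow.wronskian_step {P P' R R' Pa Pa' Ra Ra' : ℝ → ℝ} (α : ℕ)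
    (hP : ∀ x, 0 < x → HasDerivAt P (P' x) x) (hR : ∀ x, 0 < x → HasDerivAt R (R' x) x)
    (hPa : ∀ x, 0 < x → HasDerivAt Pa (Pa' x) x) (hRa : ∀ x, 0 < x → HasDerivAt Ra (Ra' x) x)
    (ePa : ∀ x, 0 < x → Pa x = x * P' x - α * P x) (eRa : ∀ x, 0 < x → Ra x = x * R' x - α * R x)
    (pR : ∀ x, 0 < x → 0 < R x) (pRa : ∀ x, 0 < x → 0 < Ra x) {k : ℕ} {ε x : ℝ}
    (h : AltBelow (fun x => P' x * R x - P x * R' x) (k + 1) ε x) :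
    AltBelow (fun x => Pa' x * Ra x - Pa x * Ra' x) k ε x := by
  -- Since `x (P' R - P R') = Pa R - P Ra`, this function is a positive multiple of the Wronskian.
  have h1 : AltBelow (fun x => (Pa x / Ra x * R x - P x) / x ^ α) (k + 1) ε x := by
    refine h.congr_sign fun y hy => ⟨y / (Ra y * y ^ α), by have := pRa y hy; positivity, ?_⟩
    have := pRa y hy
    have e1 := ePa y hy
    have e2 := eRa y hy
    field_simp
    rw [e1, e2]; ring
  -- As `(x^{-α} R)' = x^{-α-1} Ra` and likewise for `P`, only the term in which the quotient `Pa /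
  -- Ra` is differentiated survives.
  have h2 := h1.deriv (f' := fun x =>
    (Pa' x * Ra x - Pa x * Ra' x) / Ra x ^ 2 * R x / x ^ α) (by
      intro y hy
      have r := pRa y hy
      have d := ((((hPa y hy).div (hRa y hy) r.ne').mul (hR y hy)).sub (hP y hy)).div
        (hasDerivAt_pow α y) (by positivity)
      refine d.congr_deriv ?_
      have e1 := ePa y hy
      have e2 := eRa y hy
      have hpow : (α : ℝ) * y ^ (α - 1) = α * y ^ α / y := by
        cases α with
        | zero => simp
        | succ n => field_simp; simp [pow_succ]
      rw [hpow]
      simp only [Pi.mul_apply, Pi.sub_apply, Pi.div_apply]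
      have e1' : P' y = (Pa y + α * P y) / y := by field_simp; linarith
      have e2' : R' y = (Ra y + α * R y) / y := by field_simp; linarith
      rw [e1', e2']
      field_simp
      ring)
  refine h2.congr_sign fun y hy => ⟨Ra y ^ 2 * y ^ α / R y, ?_, ?_⟩
  · have := pRa y hy; have := pR y hy; positivity
  · have := pRa y hy; have := pR y hy
    field_simp

/-! ### Wronskians of sums of monomials -/

lemma hasDerivAt_sum_monomial (s : Finset ℕ) (p : ℕ → ℝ) (e : ℕ → ℕ) (x : ℝ) :
    HasDerivAt (fun x => ∑ k ∈ s, p k * x ^ e k) (∑ k ∈ s, p k * (e k * x ^ (e k - 1))) x :=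
  HasDerivAt.fun_sum fun k _ => (hasDerivAt_pow (e k) x).const_mul (p k)

lemma mul_pow_sub_one_mul (x : ℝ) (n : ℕ) : x * (n * x ^ (n - 1)) = n * x ^ n := by
  cases n with
  | zero => simp
  | succ n => simp [pow_succ]; ring

/-- The Wronskian of `∑ p k x ^ k` and `∑ r k x ^ (k + 1)`. -/
def fewnomialWronskian (s : Finset ℕ) (p r : ℕ → ℝ) (x : ℝ) : ℝ :=
  (∑ k ∈ s, p k * (k * x ^ (k - 1))) * (∑ k ∈ s, r k * x ^ (k + 1)) -
    (∑ k ∈ s, p k * x ^ k) * (∑ k ∈ s, r k * (((k + 1 : ℕ) : ℝ) * x ^ (k + 1 - 1)))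

/-- The operator `x d/dx - α` is diagonal on monomials: it only multiplies each coefficient by its
exponent minus `α`. -/
lemma fewnomialWronskian_step (s : Finset ℕ) (p r : ℕ → ℝ) (α : ℕ)
    (pR : ∀ x : ℝ, 0 < x → 0 < ∑ k ∈ s, r k * x ^ (k + 1))
    (pRa : ∀ x : ℝ, 0 < x → 0 < ∑ k ∈ s, r k * (((k + 1 : ℕ) : ℝ) - α) * x ^ (k + 1))
    {k : ℕ} {ε x : ℝ} (h : AltBelow (fewnomialWronskian s p r) (k + 1) ε x) :
    AltBelow (fewnomialWronskian s (fun k => p k * (k - α))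
      (fun k => r k * (((k + 1 : ℕ) : ℝ) - α))) k ε x := by
  refine AltBelow.wronskian_step α (fun x _ => hasDerivAt_sum_monomial s p (fun k => k) x)
    (fun x _ => hasDerivAt_sum_monomial s r (fun k => k + 1) x)
    (fun x _ => hasDerivAt_sum_monomial s _ (fun k => k) x)
    (fun x _ => hasDerivAt_sum_monomial s _ (fun k => k + 1) x) ?_ ?_ pR pRa h
  · intro x _
    rw [Finset.mul_sum, Finset.mul_sum, ← Finset.sum_sub_distrib]
    refine Finset.sum_congr rfl fun k _ => ?_
    rw [mul_left_comm x, mul_pow_sub_one_mul]; ring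
  · intro x _
    rw [Finset.mul_sum, Finset.mul_sum, ← Finset.sum_sub_distrib]
    refine Finset.sum_congr rfl fun k _ => ?_
    rw [mul_left_comm x, mul_pow_sub_one_mul]; ring

lemma fewnomialWronskian_erase (s : Finset ℕ) (p r : ℕ → ℝ) (b : ℕ) (hp : p b = 0)
    (hr : r b = 0) : fewnomialWronskian s p r = fewnomialWronskian (s.erase b) p r := by
  funext x
  unfold fewnomialWronskian
  rw [Finset.sum_erase, Finset.sum_erase, Finset.sum_erase, Finset.sum_erase] <;> simp [hp, hr]

/-- The derivative of `(∑ p k x ^ k) / (∑ r k x ^ (k + 1))`, with `m` terms in the sums and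
positive `r k`, has at most `2 m - 2` sign changes on the positive half-line. -/
theorem not_altBelow_fewnomialWronskian (m : ℕ) : ∀ (s : Finset ℕ) (_ : s.card = m + 1)
    (p r : ℕ → ℝ) (_ : ∀ k ∈ s, 0 < r k) (ε x : ℝ),
    ¬ AltBelow (fewnomialWronskian s p r) (2 * (m + 1)) ε x := by
  induction m with
  | zero =>
    intro s hs p r hr ε x h
    obtain ⟨b, rfl⟩ := Finset.card_eq_one.1 hs
    obtain ⟨y, y0, -, y2, z, z0, -, z2, -⟩ := h
    -- For a single exponent the quotient is a multiple of `1/x`, so its derivative has a constant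
    -- sign.
    have key : ∀ y : ℝ, 0 < y → fewnomialWronskian {b} p r y = -(p b * r b) * (y ^ b * y ^ b) := by
      intro y hy
      simp only [fewnomialWronskian, Finset.sum_singleton]
      have := mul_pow_sub_one_mul y b
      have e : p b * (b * y ^ (b - 1)) * (r b * y ^ (b + 1)) =
        p b * r b * y ^ b * (y * (b * y ^ (b - 1))) := by ring
      rw [e, this]
      simp
      ring
    rw [key y y0] at y2
    rw [key z z0] at z2
    have hy : 0 < y ^ b * y ^ b := by positivity
    have hz : 0 < z ^ b * z ^ b := by positivity
    rw [← mul_assoc] at y2 z2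
    have := (mul_pos_iff_of_pos_right hy).1 y2
    have := (mul_pos_iff_of_pos_right hz).1 z2
    linarith
  | succ m ih =>
    intro s hs p r hr ε x h
    have hne : s.Nonempty := Finset.card_pos.1 (by omega)
    set b := s.min' hne with hb
    have hmin : ∀ k ∈ s, b ≤ k := fun k hk => Finset.min'_le s k hk
    have hcard : (s.erase b).card = m + 1 := by
      rw [Finset.card_erase_of_mem (s.min'_mem hne)]; omega
    have pos1 : ∀ k ∈ s, (0 : ℝ) < ((k + 1 : ℕ) : ℝ) - b := fun k hk => by
      have : (b : ℝ) ≤ k := by exact_mod_cast hmin k hk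
      push_cast; linarith
    -- Two Rolle steps remove the lowest exponent: `α = b` kills its term in the first sum, and `α =
    -- b + 1` kills it in the second, whose exponents are shifted by one. All other coefficients of
    -- the second sum stay positive because `b` is minimal.
    have h1 := fewnomialWronskian_step s p r b
      (fun x hx => Finset.sum_pos (fun k hk => by have := hr k hk; positivity) hne)
      (fun x hx => Finset.sum_pos (fun k hk => by
        have := hr k hk; have := pos1 k hk; positivity) hne) h
    have pos2 : ∀ k ∈ s.erase b, (0 : ℝ) < ((k + 1 : ℕ) : ℝ) - (b + 1 : ℕ) := fun k hk => by
      have hk' := Finset.mem_erase.1 hk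
      have : (b : ℝ) < k := by exact_mod_cast lt_of_le_of_ne (hmin k hk'.2) hk'.1.symm
      push_cast; linarith
    have h2 := fewnomialWronskian_step s _ _ (b + 1)
      (fun x hx => Finset.sum_pos (fun k hk => by
        have := hr k hk; have := pos1 k hk; positivity) hne)
      (fun x hx => by
        rw [← Finset.sum_erase (a := b) s (by simp)]
        refine Finset.sum_pos (fun k hk => ?_) (Finset.card_pos.1 (by omega))
        have := hr k (Finset.mem_of_mem_erase hk)
        have := pos1 k (Finset.mem_of_mem_erase hk)
        have := pos2 k hk
        positivity) h1
    rw [fewnomialWronskian_erase s _ _ b (by simp) (by simp)] at h2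
    refine ih _ hcard _ _ (fun k hk => ?_) _ _ h2
    have := hr k (Finset.mem_of_mem_erase hk)
    have := pos1 k (Finset.mem_of_mem_erase hk)
    have := pos2 k hk
    positivity

/-! ### The properties of the mixture -/

/-- The properties of a mixture of `n` monomials of degrees at least `3` that are used below. -/
structure IsMixture (n : ℕ) (ξ : ℝ → ℝ) : Prop where
  hasDerivAt : ∀ x, HasDerivAt ξ (deriv ξ x) x
  hasDerivAt₁ : ∀ x, HasDerivAt (deriv ξ) (deriv (deriv ξ) x) x
  hasDerivAt₂ : ∀ x, HasDerivAt (deriv (deriv ξ)) (deriv (deriv (deriv ξ)) x) x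
  hasDerivAt₃ : ∀ x,
    HasDerivAt (deriv (deriv (deriv ξ))) (deriv (deriv (deriv (deriv ξ))) x) x
  continuous₄ : Continuous (deriv (deriv (deriv (deriv ξ))))
  deriv_zero : deriv ξ 0 = 0
  deriv₂_zero : deriv (deriv ξ) 0 = 0
  deriv₂_pos : ∀ x, 0 < x → 0 < deriv (deriv ξ) x
  deriv₃_pos : ∀ x, 0 < x → 0 < deriv (deriv (deriv ξ)) x
  not_altBelow : ∀ ε x, ¬ AltBelow (fun x => 2 * deriv (deriv ξ) x *
    deriv (deriv (deriv (deriv ξ))) x - 3 * deriv (deriv (deriv ξ)) x ^ 2) (2 * n) ε x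
  not_line : ∀ c m x y : ℝ, x < y →
    ¬ ∀ z ∈ Set.Ioo x y, deriv (deriv ξ) z * (c - m * z) ^ 2 = 1

lemma isMixture_sum {n : ℕ} (s : Finset ℕ) (hs : s.Nonempty) (hn : s.card ≤ n) (c : ℕ → ℝ)
    (hc : ∀ k ∈ s, 0 < c k) : IsMixture n (fun x => ∑ k ∈ s, c k * x ^ (k + 3)) := by
  have d0 : ∀ x : ℝ, HasDerivAt (fun x => ∑ k ∈ s, c k * x ^ (k + 3))
      (∑ k ∈ s, c k * (k + 3) * x ^ (k + 2)) x := fun x => by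
    refine (hasDerivAt_sum_monomial s c (fun k => k + 3) x).congr_deriv ?_
    refine Finset.sum_congr rfl fun k _ => ?_
    rw [Nat.add_sub_assoc (by norm_num)]; push_cast; ring
  have e1 : deriv (fun x : ℝ => ∑ k ∈ s, c k * x ^ (k + 3)) =
      fun x => ∑ k ∈ s, c k * (k + 3) * x ^ (k + 2) := funext fun x => (d0 x).deriv
  have d1 : ∀ x : ℝ, HasDerivAt (fun x => ∑ k ∈ s, c k * (k + 3) * x ^ (k + 2))
      (∑ k ∈ s, c k * (k + 3) * (k + 2) * x ^ (k + 1)) x := fun x => by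
    refine (hasDerivAt_sum_monomial s _ (fun k => k + 2) x).congr_deriv ?_
    refine Finset.sum_congr rfl fun k _ => ?_
    rw [Nat.add_sub_assoc (by norm_num)]; push_cast; ring
  have e2 : deriv (fun x : ℝ => ∑ k ∈ s, c k * (k + 3) * x ^ (k + 2)) =
      fun x => ∑ k ∈ s, c k * (k + 3) * (k + 2) * x ^ (k + 1) := funext fun x => (d1 x).deriv
  have d2 : ∀ x : ℝ, HasDerivAt (fun x => ∑ k ∈ s, c k * (k + 3) * (k + 2) * x ^ (k + 1))
      (∑ k ∈ s, c k * (k + 3) * (k + 2) * (k + 1) * x ^ k) x := fun x => by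
    refine (hasDerivAt_sum_monomial s _ (fun k => k + 1) x).congr_deriv ?_
    refine Finset.sum_congr rfl fun k _ => ?_
    rw [Nat.add_sub_cancel]; push_cast; ring
  have e3 : deriv (fun x : ℝ => ∑ k ∈ s, c k * (k + 3) * (k + 2) * x ^ (k + 1)) =
      fun x => ∑ k ∈ s, c k * (k + 3) * (k + 2) * (k + 1) * x ^ k := funext fun x => (d2 x).deriv
  have d3 : ∀ x : ℝ, HasDerivAt (fun x => ∑ k ∈ s, c k * (k + 3) * (k + 2) * (k + 1) * x ^ k)
      (∑ k ∈ s, c k * (k + 3) * (k + 2) * (k + 1) * (k * x ^ (k - 1))) x := fun x =>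
    hasDerivAt_sum_monomial s _ (fun k => k) x
  have e4 : deriv (fun x : ℝ => ∑ k ∈ s, c k * (k + 3) * (k + 2) * (k + 1) * x ^ k) =
      fun x => ∑ k ∈ s, c k * (k + 3) * (k + 2) * (k + 1) * (k * x ^ (k - 1)) :=
    funext fun x => (d3 x).deriv
  refine ⟨?_, ?_, ?_, ?_, ?_, ?_, ?_, ?_, ?_, ?_, ?_⟩
  all_goals simp only [e1, e2, e3, e4]
  · exact d0
  · exact d1
  · exact d2
  · exact d3
  · fun_prop
  · simp
  · simp
  · exact fun x hx => Finset.sum_pos (fun k hk => by have := hc k hk; positivity) hs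
  · exact fun x hx => Finset.sum_pos (fun k hk => by have := hc k hk; positivity) hs
  · intro ε x h
    obtain ⟨m, hm⟩ : ∃ m, s.card = m + 1 :=
      ⟨s.card - 1, by have := Finset.card_pos.2 hs; omega⟩
    -- The two sums are `ξ'''` and `x ξ''' + 2 ξ''`. The additional `k` is for mixtures with fewer
    -- than `n` terms: more alternations are excluded a fortiori.
    have key : ∀ k, ∀ ε, ¬ AltBelow (fewnomialWronskian s
        (fun k => c k * (k + 3) * (k + 2) * (k + 1))
        (fun k => c k * (k + 3) * (k + 2) * (k + 3))) (2 * (m + 1) + k) ε x := by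
      intro k
      induction k with
      | zero =>
        exact fun ε => not_altBelow_fewnomialWronskian m s hm _ _
          (fun k hk => by have := hc k hk; positivity) ε x
      | succ k ih => exact fun ε h => ih _ h.pred
    refine key (2 * n - 2 * (m + 1)) ε ?_
    rw [show 2 * (m + 1) + (2 * n - 2 * (m + 1)) = 2 * n by omega]
    refine h.congr_sign fun y hy => ⟨1, one_pos, ?_⟩
    rw [one_mul]
    unfold fewnomialWronskian
    have a1 : ∑ k ∈ s, c k * (k + 3) * (k + 2) * (k + 3) * y ^ (k + 1) =
        y * (∑ k ∈ s, c k * (k + 3) * (k + 2) * (k + 1) * y ^ k) +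
          2 * ∑ k ∈ s, c k * (k + 3) * (k + 2) * y ^ (k + 1) := by
      rw [Finset.mul_sum, Finset.mul_sum, ← Finset.sum_add_distrib]
      exact Finset.sum_congr rfl fun k _ => by ring
    have a2 : ∑ k ∈ s, c k * (k + 3) * (k + 2) * (k + 3) *
        (((k + 1 : ℕ) : ℝ) * y ^ (k + 1 - 1)) =
        y * (∑ k ∈ s, c k * (k + 3) * (k + 2) * (k + 1) * (k * y ^ (k - 1))) +
          3 * ∑ k ∈ s, c k * (k + 3) * (k + 2) * (k + 1) * y ^ k := by
      rw [Finset.mul_sum, Finset.mul_sum, ← Finset.sum_add_distrib]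
      refine Finset.sum_congr rfl fun k _ => ?_
      rw [mul_left_comm y, mul_pow_sub_one_mul, Nat.add_sub_cancel]; push_cast; ring
    rw [a1, a2]
    ring
  · intro a m x y hxy h
    -- The identity on an interval is one of polynomials; at `0` it reads `0 = 1` because `ξ''(0) =
    -- 0`.
    let Q : Polynomial ℝ :=
      ∑ k ∈ s, Polynomial.C (c k * (k + 3) * (k + 2)) * Polynomial.X ^ (k + 1)
    have hQ : Q * (Polynomial.C a - Polynomial.C m * Polynomial.X) ^ 2 = 1 := by
      refine Polynomial.eq_of_infinite_eval_eq _ _ ((Set.Ioo_infinite hxy).mono fun z hz => ?_)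
      simpa [Q, Polynomial.eval_finsetSum] using h z hz
    have := congrArg (Polynomial.eval 0) hQ
    simp [Q, Polynomial.eval_finsetSum] at this

lemma isMixture_mixture {n : ℕ} {p : Fin n → ℕ} (hp : StrictMono p) (hp2 : ∀ i, 2 < p i)
    {lam : Fin n → ℝ} (hlam : ∀ i, 0 ≤ lam i) (hsum : ∑ i, lam i = 1) :
    IsMixture n (mixture p lam) := by
  classical
  -- Zero weights are discarded since the coefficients must be positive. The monomials are then
  -- indexed by `p i - 3`, which loses nothing as `p i ≥ 3`.
  set S := Finset.univ.filter (fun i => lam i ≠ 0) with hS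
  have hinj : Set.InjOn (fun i => p i - 3) (S : Set (Fin n)) := fun i _ j _ h => by
    apply hp.injective
    have := hp2 i; have := hp2 j
    simp only at h; omega
  set c : ℕ → ℝ := fun b => ∑ i, if p i = b + 3 then lam i else 0 with hc
  have hcp : ∀ i, c (p i - 3) = lam i := fun i => by
    simp only [hc]
    rw [Finset.sum_eq_single i]
    · have := hp2 i; rw [if_pos (by omega)]
    · intro j _ hj
      rw [if_neg]
      intro h
      have := hp2 i
      exact hj (hp.injective (by omega))
    · simp
  have hcard : (S.image (fun i => p i - 3)).card ≤ n :=
    Finset.card_image_le.trans ((Finset.card_le_univ S).trans (by simp))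
  have hSne : S.Nonempty := by
    by_contra h
    rw [Finset.not_nonempty_iff_eq_empty, Finset.filter_eq_empty_iff] at h
    have : ∑ i, lam i = 0 := Finset.sum_eq_zero fun i hi => not_not.1 (h hi)
    linarith
  have := isMixture_sum (n := n) (S.image (fun i => p i - 3)) (hSne.image _) hcard c (by
    intro k hk
    obtain ⟨i, hi, rfl⟩ := Finset.mem_image.1 hk
    rw [hcp]
    exact lt_of_le_of_ne (hlam i) (Ne.symm (Finset.mem_filter.1 hi).2))
  convert this using 1
  funext x
  rw [Finset.sum_image hinj]
  simp only [hcp, mixture]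
  rw [hS, Finset.sum_filter]
  refine Finset.sum_congr rfl fun i _ => ?_
  have := hp2 i
  rw [show p i - 3 + 3 = p i by omega]
  by_cases h : lam i = 0 <;> simp [h]

namespace IsMixture

variable {n : ℕ} {ξ : ℝ → ℝ} (hξ : IsMixture n ξ)
include hξ

lemma strictMonoOn_deriv : StrictMonoOn (deriv ξ) (Set.Ici 0) := by
  refine strictMonoOn_of_deriv_pos (convex_Ici 0)
    (fun x _ => (hξ.hasDerivAt₁ x).continuousAt.continuousWithinAt) fun x hx => ?_
  rw [interior_Ici] at hx
  exact hξ.deriv₂_pos x hx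

lemma strictMonoOn_deriv₂ : StrictMonoOn (deriv (deriv ξ)) (Set.Ici 0) := by
  refine strictMonoOn_of_deriv_pos (convex_Ici 0)
    (fun x _ => (hξ.hasDerivAt₂ x).continuousAt.continuousWithinAt) fun x hx => ?_
  rw [interior_Ici] at hx
  exact hξ.deriv₃_pos x hx

lemma deriv_lt {x y : ℝ} (hx : 0 ≤ x) (hxy : x < y) : deriv ξ x < deriv ξ y :=
  hξ.strictMonoOn_deriv hx (hx.trans hxy.le) hxy

lemma deriv_nonneg {x : ℝ} (hx : 0 ≤ x) : 0 ≤ deriv ξ x := by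
  rcases hx.eq_or_lt with rfl | h
  · exact hξ.deriv_zero.ge
  · have := hξ.deriv_lt le_rfl h
    rw [hξ.deriv_zero] at this
    exact this.le

end IsMixture

/-! ### Calculus on a single step -/

/-- The affine function with the values `A` at `x` and `B` at `x'`. -/
def line (x x' A B y : ℝ) : ℝ := B + (A - B) / (x' - x) * (x' - y)

/-- `ξ'''(y) / (y ξ'''(y) + 2 ξ''(y))`: where the tangent line of `(ξ'')^{-1/2}` at `y` is
`u ↦ c - m u`, this is `m / c`. -/
def slopeRatio (ξ : ℝ → ℝ) (y : ℝ) : ℝ :=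
  deriv (deriv (deriv ξ)) y / (y * deriv (deriv (deriv ξ)) y + 2 * deriv (deriv ξ) y)

/-- The slope ratio `m / c` of the line `u ↦ c - m u` with the values `A` at `x`, `B` at `x'`. -/
def stepLevel (x x' A B : ℝ) : ℝ :=
  (A - B) / (x' - x) / (B + (A - B) / (x' - x) * x')

/-- The local optimality conditions on a step `[x, x']` on which `ν((y, 1])` is affine, with the
values `A` and `B` at the ends. -/
structure IsStep (ξ : ℝ → ℝ) (x x' A B : ℝ) : Prop where
  nonneg : 0 ≤ x
  lt : x < x'
  pos : 0 < B
  anti : B < A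
  rel : (deriv ξ x' - deriv ξ x) * (A * B) = x' - x
  hFun_eq : hFun ξ x x' (A / B) = 0
  left_le : deriv (deriv ξ) x * A ^ 2 ≤ 1
  right_le : deriv (deriv ξ) x' * B ^ 2 ≤ 1

/-- The primitive of `ξ'' - line ^ (-2)` that vanishes at `x`. -/
def stepF (ξ : ℝ → ℝ) (x x' A B y : ℝ) : ℝ :=
  deriv ξ y - deriv ξ x - (y - x) / (A * line x x' A B y)

/-- The primitive of `stepF` that vanishes at `x`. -/
def stepG (ξ : ℝ → ℝ) (x x' A B y : ℝ) : ℝ :=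
  ξ y - ξ x - deriv ξ x * (y - x) -
    Real.log (A / line x x' A B y) / ((A - B) / (x' - x)) ^ 2 +
    (y - x) / ((A - B) / (x' - x) * A)

/-- The quotient of `ξ''` and `line ^ (-2)`. -/
def stepE (ξ : ℝ → ℝ) (x x' A B y : ℝ) : ℝ := deriv (deriv ξ) y * line x x' A B y ^ 2

/-- `stepE - 1` has the signs `+, -, +` at three points of the open step. -/
def HasDip (ξ : ℝ → ℝ) (x x' A B : ℝ) : Prop :=
  ∃ y₁ y₂ y₃, x < y₁ ∧ y₁ < y₂ ∧ y₂ < y₃ ∧ y₃ < x' ∧ 1 < stepE ξ x x' A B y₁ ∧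
    stepE ξ x x' A B y₂ < 1 ∧ 1 < stepE ξ x x' A B y₃

/-- `stepE - 1` has the signs `-, +, -` at three points of the open step. -/
def HasBump (ξ : ℝ → ℝ) (x x' A B : ℝ) : Prop :=
  ∃ y₁ y₂ y₃, x < y₁ ∧ y₁ < y₂ ∧ y₂ < y₃ ∧ y₃ < x' ∧ stepE ξ x x' A B y₁ < 1 ∧
    1 < stepE ξ x x' A B y₂ ∧ stepE ξ x x' A B y₃ < 1

/-! ### Affine functions on an interval and the potential they generate -/

section line

variable {x x' A B : ℝ}

lemma line_left (h : x < x') : line x x' A B x = A := by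
  have : x' - x ≠ 0 := by linarith
  unfold line; field_simp; ring

lemma line_right : line x x' A B x' = B := by simp [line]

lemma line_eq (y : ℝ) : line x x' A B y =
    B + (A - B) / (x' - x) * x' - (A - B) / (x' - x) * y := by unfold line; ring

lemma line_eq_left (h : x < x') (y : ℝ) :
    line x x' A B y = A - (A - B) / (x' - x) * (y - x) := by
  have : x' - x ≠ 0 := by linarith
  unfold line; field_simp; ring

lemma hasDerivAt_line (y : ℝ) :
    HasDerivAt (line x x' A B) (-((A - B) / (x' - x))) y := by
  exact ((((hasDerivAt_id y).const_sub x').const_mul ((A - B) / (x' - x))).const_add B).congr_deriv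
    (by simp)

/-- By `rel` the increment of `ξ'` equals the integral of `line ^ (-2)`. With this substitution the
logarithmic term of `hFun` becomes the double integral of `line ^ (-2)`, so `h = 0` says that the
potential has integral zero over the step. -/
lemma hFun_eq_stepG {ξ : ℝ → ℝ} (h : x < x') (hB : 0 < B) (hA : B < A)
    (rel : (deriv ξ x' - deriv ξ x) * (A * B) = x' - x) :
    hFun ξ x x' (A / B) = stepG ξ x x' A B x' := by
  have hA0 : 0 < A := hB.trans hA
  have h1 : x' - x ≠ 0 := by linarith
  have h2 : A - B ≠ 0 := by linarith
  have e : deriv ξ x' - deriv ξ x = (x' - x) / (A * B) := by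
    field_simp; linarith
  unfold hFun stepG
  rw [line_right, e]
  have h3 : A / B - 1 = (A - B) / B := by field_simp
  rw [h3]
  field_simp
  ring

lemma line_pos (h : x < x') (hB : 0 < B) (hA : B < A) {y : ℝ} (hy : y ≤ x') :
    0 < line x x' A B y := by
  have : 0 < (A - B) / (x' - x) := div_pos (by linarith) (by linarith)
  have : 0 ≤ x' - y := by linarith
  unfold line; positivity

lemma hasDerivAt_stepF {n : ℕ} {ξ : ℝ → ℝ} (hξ : IsMixture n ξ) (h : x < x') (hB : 0 < B) (hA : B < A) {y : ℝ} (hy : y ≤ x') :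
    HasDerivAt (stepF ξ x x' A B) (deriv (deriv ξ) y - 1 / line x x' A B y ^ 2) y := by
  have hl := line_pos h hB hA hy
  have hA0 := hB.trans hA
  have hx : x' - x ≠ 0 := by linarith
  refine (((hξ.hasDerivAt₁ y).sub_const (deriv ξ x)).sub
    (((hasDerivAt_id y).sub_const x).div ((hasDerivAt_line y).const_mul A)
      (by positivity))).congr_deriv ?_
  have e : (A - B) / (x' - x) * (y - x) = A - line x x' A B y := by
    rw [line_eq_left h]; ring
  simp only [id]
  rw [show 1 * (A * line x x' A B y) - (y - x) * (A * -((A - B) / (x' - x))) =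
    A * line x x' A B y + A * ((A - B) / (x' - x) * (y - x)) by ring, e]
  field_simp
  ring

lemma hasDerivAt_stepG {n : ℕ} {ξ : ℝ → ℝ} (hξ : IsMixture n ξ) (h : x < x') (hB : 0 < B) (hA : B < A) {y : ℝ} (hy : y ≤ x') :
    HasDerivAt (stepG ξ x x' A B) (stepF ξ x x' A B y) y := by
  have hl := line_pos h hB hA hy
  have hA0 := hB.trans hA
  have hm : 0 < (A - B) / (x' - x) := div_pos (by linarith) (by linarith)
  have hd := hasDerivAt_line (x := x) (x' := x') (A := A) (B := B) y
  have e : y - x = (A - line x x' A B y) / ((A - B) / (x' - x)) := by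
    rw [line_eq_left h, eq_div_iff hm.ne']; ring
  refine (((((hξ.hasDerivAt y).sub_const (ξ x)).sub
    (((hasDerivAt_id y).sub_const x).const_mul (deriv ξ x))).sub
      ((((hasDerivAt_const y A).div hd hl.ne').log (div_pos hA0 hl).ne').div_const _)).add
      (((hasDerivAt_id y).sub_const x).div_const _)).congr_deriv ?_
  unfold stepF
  rw [e]
  simp only [Pi.div_apply]
  generalize (A - B) / (x' - x) = m at *
  field_simp
  ring

end line

/-! ### Bumps and dips on a single step -/

namespace IsStep

variable {n : ℕ} {ξ : ℝ → ℝ} {x x' A B : ℝ}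

lemma slope_pos (h : IsStep ξ x x' A B) : 0 < (A - B) / (x' - x) :=
  div_pos (by linarith [h.anti]) (by linarith [h.lt])

lemma line_pos (h : IsStep ξ x x' A B) {y : ℝ} (hy : y ≤ x') : 0 < line x x' A B y :=
  SphericalSpinGlass.line_pos h.lt h.pos h.anti hy

lemma left_pos (h : IsStep ξ x x' A B) : 0 < A := h.pos.trans h.anti

lemma intercept_pos (h : IsStep ξ x x' A B) : 0 < B + (A - B) / (x' - x) * x' := by
  have := h.slope_pos
  have := h.pos
  have := h.nonneg.trans_lt h.lt
  positivity

lemma hasDerivAt_stepF (hξ : IsMixture n ξ) (h : IsStep ξ x x' A B) {y : ℝ} (hy : y ≤ x') :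
    HasDerivAt (stepF ξ x x' A B) (deriv (deriv ξ) y - 1 / line x x' A B y ^ 2) y :=
  SphericalSpinGlass.hasDerivAt_stepF hξ h.lt h.pos h.anti hy

lemma hasDerivAt_stepG (hξ : IsMixture n ξ) (h : IsStep ξ x x' A B) {y : ℝ} (hy : y ≤ x') :
    HasDerivAt (stepG ξ x x' A B) (stepF ξ x x' A B y) y :=
  SphericalSpinGlass.hasDerivAt_stepG hξ h.lt h.pos h.anti hy

lemma stepF_left (_h : IsStep ξ x x' A B) : stepF ξ x x' A B x = 0 := by simp [stepF]

lemma stepF_right (h : IsStep ξ x x' A B) : stepF ξ x x' A B x' = 0 := by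
  have := h.pos
  have := h.left_pos
  rw [stepF, line_right, ← h.rel]
  field_simp
  ring

lemma stepG_left (h : IsStep ξ x x' A B) : stepG ξ x x' A B x = 0 := by
  simp [stepG, line_left h.lt, h.left_pos.ne']

lemma stepG_right (h : IsStep ξ x x' A B) : stepG ξ x x' A B x' = 0 := by
  rw [← hFun_eq_stepG h.lt h.pos h.anti h.rel, h.hFun_eq]

lemma stepE_left (h : IsStep ξ x x' A B) :
    stepE ξ x x' A B x = deriv (deriv ξ) x * A ^ 2 := by rw [stepE, line_left h.lt]

lemma stepE_right : stepE ξ x x' A B x' = deriv (deriv ξ) x' * B ^ 2 := by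
  rw [stepE, line_right]

/-- The derivative of `stepE`, up to a positive factor, is `slopeRatio - stepLevel`. -/
lemma hasDerivAt_stepE (hξ : IsMixture n ξ) (y : ℝ) :
    HasDerivAt (stepE ξ x x' A B) (line x x' A B y * (deriv (deriv (deriv ξ)) y *
      line x x' A B y - 2 * ((A - B) / (x' - x)) * deriv (deriv ξ) y)) y := by
  refine ((hξ.hasDerivAt₂ y).mul ((hasDerivAt_line y).pow 2)).congr_deriv ?_
  simp; ring

/-- For the line `c - m y` the inner bracket is `c ξ''' - m (y ξ''' + 2 ξ'')`, which is linear in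
`(c, m)`. Hence only the ratio `m / c` matters, and it is compared with a function of `y` that does
not depend on the step. -/
lemma sign_iff (hξ : IsMixture n ξ) (h : IsStep ξ x x' A B) {y : ℝ} (hy0 : 0 < y)
    (hy : y ≤ x') :
    ∃ c, 0 < c ∧ line x x' A B y * (deriv (deriv (deriv ξ)) y *
      line x x' A B y - 2 * ((A - B) / (x' - x)) * deriv (deriv ξ) y) =
        c * (slopeRatio ξ y - stepLevel x x' A B) := by
  have h2 := hξ.deriv₂_pos y hy0
  have h3 := hξ.deriv₃_pos y hy0
  have hl := h.line_pos hy
  have hc := h.intercept_pos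
  refine ⟨line x x' A B y * (y * deriv (deriv (deriv ξ)) y + 2 * deriv (deriv ξ) y) *
    (B + (A - B) / (x' - x) * x'), by positivity, ?_⟩
  unfold slopeRatio stepLevel
  rw [line_eq] at hl ⊢
  generalize (A - B) / (x' - x) = m at *
  field_simp
  ring

lemma exists_high (hξ : IsMixture n ξ) (h : IsStep ξ x x' A B) {a b : ℝ} (ha : x ≤ a)
    (hab : a < b) (hb : b ≤ x') (hE : stepE ξ x x' A B a < stepE ξ x x' A B b) :
    ∃ y, a < y ∧ y < b ∧ stepLevel x x' A B < slopeRatio ξ y := by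
  obtain ⟨y, hy, e⟩ := exists_hasDerivAt_eq_slope (stepE ξ x x' A B) _ hab
    (fun w _ => (hasDerivAt_stepE hξ w).continuousAt.continuousWithinAt)
    (fun w _ => hasDerivAt_stepE hξ w)
  refine ⟨y, hy.1, hy.2, ?_⟩
  obtain ⟨c, hc, e'⟩ := h.sign_iff hξ ((h.nonneg.trans ha).trans_lt hy.1) (hy.2.le.trans hb)
  rw [e'] at e
  have : 0 < c * (slopeRatio ξ y - stepLevel x x' A B) := by
    rw [e]; exact div_pos (by linarith) (by linarith)
  linarith [pos_of_mul_pos_right this hc.le]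

lemma exists_low (hξ : IsMixture n ξ) (h : IsStep ξ x x' A B) {a b : ℝ} (ha : x ≤ a)
    (hab : a < b) (hb : b ≤ x') (hE : stepE ξ x x' A B b < stepE ξ x x' A B a) :
    ∃ y, a < y ∧ y < b ∧ slopeRatio ξ y < stepLevel x x' A B := by
  obtain ⟨y, hy, e⟩ := exists_hasDerivAt_eq_slope (stepE ξ x x' A B) _ hab
    (fun w _ => (hasDerivAt_stepE hξ w).continuousAt.continuousWithinAt)
    (fun w _ => hasDerivAt_stepE hξ w)
  refine ⟨y, hy.1, hy.2, ?_⟩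
  obtain ⟨c, hc, e'⟩ := h.sign_iff hξ ((h.nonneg.trans ha).trans_lt hy.1) (hy.2.le.trans hb)
  rw [e'] at e
  have : 0 < c * (stepLevel x x' A B - slopeRatio ξ y) := by
    rw [show c * (stepLevel x x' A B - slopeRatio ξ y) =
      -(c * (slopeRatio ξ y - stepLevel x x' A B)) by ring, e, ← neg_div]
    exact div_pos (by linarith) (by linarith)
  linarith [pos_of_mul_pos_right this hc.le]

/-- The derivative `ξ'' - line ^ (-2)` of `stepF` has the sign of `stepE - 1`, so the mean value
theorem applies. -/
lemma exists_stepE_gt (hξ : IsMixture n ξ) (h : IsStep ξ x x' A B) {a b : ℝ}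
    (hab : a < b) (hb : b ≤ x') (hF : stepF ξ x x' A B a < stepF ξ x x' A B b) :
    ∃ y, a < y ∧ y < b ∧ 1 < stepE ξ x x' A B y := by
  obtain ⟨y, hy, e⟩ := exists_hasDerivAt_eq_slope (stepF ξ x x' A B) _ hab
    (fun w hw => (h.hasDerivAt_stepF hξ (hw.2.trans hb)).continuousAt.continuousWithinAt)
    (fun w hw => h.hasDerivAt_stepF hξ (hw.2.le.trans hb))
  refine ⟨y, hy.1, hy.2, ?_⟩
  have hl := h.line_pos (hy.2.le.trans hb)
  have : 0 < deriv (deriv ξ) y - 1 / line x x' A B y ^ 2 := by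
    rw [e]; exact div_pos (by linarith) (by linarith)
  unfold stepE
  have h2 : 1 / line x x' A B y ^ 2 < deriv (deriv ξ) y := by linarith
  rwa [div_lt_iff₀ (by positivity)] at h2

lemma exists_stepE_lt (hξ : IsMixture n ξ) (h : IsStep ξ x x' A B) {a b : ℝ}
    (hab : a < b) (hb : b ≤ x') (hF : stepF ξ x x' A B b < stepF ξ x x' A B a) :
    ∃ y, a < y ∧ y < b ∧ stepE ξ x x' A B y < 1 := by
  obtain ⟨y, hy, e⟩ := exists_hasDerivAt_eq_slope (stepF ξ x x' A B) _ hab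
    (fun w hw => (h.hasDerivAt_stepF hξ (hw.2.trans hb)).continuousAt.continuousWithinAt)
    (fun w hw => h.hasDerivAt_stepF hξ (hw.2.le.trans hb))
  refine ⟨y, hy.1, hy.2, ?_⟩
  have hl := h.line_pos (hy.2.le.trans hb)
  have : deriv (deriv ξ) y - 1 / line x x' A B y ^ 2 < 0 := by
    rw [e]; exact div_neg_of_neg_of_pos (by linarith) (by linarith)
  unfold stepE
  have h2 : deriv (deriv ξ) y < 1 / line x x' A B y ^ 2 := by linarith
  rwa [lt_div_iff₀ (by positivity)] at h2

/-- Otherwise `ξ'' · line ^ 2` would be `1` on an interval, which `not_line` forbids. -/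
lemma stepF_ne_zero (hξ : IsMixture n ξ) (h : IsStep ξ x x' A B) :
    ¬ ∀ y ∈ Set.Ioo x x', stepF ξ x x' A B y = 0 := by
  intro H
  refine hξ.not_line (B + (A - B) / (x' - x) * x') ((A - B) / (x' - x)) x x' h.lt
    fun z hz => ?_
  rw [← line_eq]
  have hl := h.line_pos hz.2.le
  have h1 : HasDerivAt (stepF ξ x x' A B) 0 z :=
    (hasDerivAt_const z (0 : ℝ)).congr_of_eventuallyEq (by
      filter_upwards [Ioo_mem_nhds hz.1 hz.2] with y hy using H y hy)
  have := h1.unique (h.hasDerivAt_stepF hξ hz.2.le)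
  have h2 : deriv (deriv ξ) z = 1 / line x x' A B z ^ 2 := by linarith
  rw [h2]; field_simp

/-- If `stepF ≥ 0`, its primitive `stepG` is monotone and vanishes at both ends, hence is constant,
and `stepF` vanishes identically. -/
lemma exists_stepF_neg (hξ : IsMixture n ξ) (h : IsStep ξ x x' A B) :
    ∃ y ∈ Set.Ioo x x', stepF ξ x x' A B y < 0 := by
  by_contra! H
  have hm : MonotoneOn (stepG ξ x x' A B) (Set.Icc x x') := by
    refine monotoneOn_of_deriv_nonneg (convex_Icc x x')
      (fun y hy => (h.hasDerivAt_stepG hξ hy.2).continuousAt.continuousWithinAt)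
      (fun y hy => ?_) fun y hy => ?_
    all_goals rw [interior_Icc] at hy
    · exact (h.hasDerivAt_stepG hξ hy.2.le).differentiableAt.differentiableWithinAt
    · rw [(h.hasDerivAt_stepG hξ hy.2.le).deriv]; exact H y hy
  refine h.stepF_ne_zero hξ fun y hy => ?_
  have h1 : HasDerivAt (stepG ξ x x' A B) 0 y :=
    (hasDerivAt_const y (0 : ℝ)).congr_of_eventuallyEq (by
      filter_upwards [Ioo_mem_nhds hy.1 hy.2] with z hz
      have a := hm ⟨le_rfl, h.lt.le⟩ ⟨hz.1.le, hz.2.le⟩ hz.1.le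
      have b := hm ⟨hz.1.le, hz.2.le⟩ ⟨h.lt.le, le_rfl⟩ hz.2.le
      rw [h.stepG_left] at a
      rw [h.stepG_right] at b
      exact le_antisymm b a)
  exact (h.hasDerivAt_stepG hξ hy.2.le).unique h1

lemma exists_stepF_pos (hξ : IsMixture n ξ) (h : IsStep ξ x x' A B) :
    ∃ y ∈ Set.Ioo x x', 0 < stepF ξ x x' A B y := by
  by_contra! H
  have hm : AntitoneOn (stepG ξ x x' A B) (Set.Icc x x') := by
    refine antitoneOn_of_deriv_nonpos (convex_Icc x x')
      (fun y hy => (h.hasDerivAt_stepG hξ hy.2).continuousAt.continuousWithinAt)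
      (fun y hy => ?_) fun y hy => ?_
    all_goals rw [interior_Icc] at hy
    · exact (h.hasDerivAt_stepG hξ hy.2.le).differentiableAt.differentiableWithinAt
    · rw [(h.hasDerivAt_stepG hξ hy.2.le).deriv]; exact H y hy
  refine h.stepF_ne_zero hξ fun y hy => ?_
  have h1 : HasDerivAt (stepG ξ x x' A B) 0 y :=
    (hasDerivAt_const y (0 : ℝ)).congr_of_eventuallyEq (by
      filter_upwards [Ioo_mem_nhds hy.1 hy.2] with z hz
      have a := hm ⟨le_rfl, h.lt.le⟩ ⟨hz.1.le, hz.2.le⟩ hz.1.le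
      have b := hm ⟨hz.1.le, hz.2.le⟩ ⟨h.lt.le, le_rfl⟩ hz.2.le
      rw [h.stepG_left] at a
      rw [h.stepG_right] at b
      exact le_antisymm a b)
  exact (h.hasDerivAt_stepG hξ hy.2.le).unique h1

/-- `stepF` vanishes at both ends and takes both signs inside. The order of a negative and a
positive value decides between the two sign patterns of its derivative. -/
lemma hasBump_or_hasDip (hξ : IsMixture n ξ) (h : IsStep ξ x x' A B) :
    HasBump ξ x x' A B ∨ HasDip ξ x x' A B := by
  obtain ⟨c, hc, hc'⟩ := h.exists_stepF_neg hξ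
  obtain ⟨d, hd, hd'⟩ := h.exists_stepF_pos hξ
  have hcd : c ≠ d := by rintro rfl; linarith
  rcases lt_or_gt_of_ne hcd with hlt | hlt
  · left
    obtain ⟨y₁, a1, a2, a3⟩ := h.exists_stepE_lt hξ hc.1 hc.2.le (by rwa [h.stepF_left])
    obtain ⟨y₂, b1, b2, b3⟩ := h.exists_stepE_gt hξ hlt hd.2.le (by linarith)
    obtain ⟨y₃, c1, c2, c3⟩ := h.exists_stepE_lt hξ hd.2 le_rfl (by rwa [h.stepF_right])
    exact ⟨y₁, y₂, y₃, a1, by linarith, by linarith, c2, a3, b3, c3⟩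
  · right
    obtain ⟨y₁, a1, a2, a3⟩ := h.exists_stepE_gt hξ hd.1 hd.2.le (by rwa [h.stepF_left])
    obtain ⟨y₂, b1, b2, b3⟩ := h.exists_stepE_lt hξ hlt hc.2.le (by linarith)
    obtain ⟨y₃, c1, c2, c3⟩ := h.exists_stepE_gt hξ hc.2 le_rfl (by rwa [h.stepF_right])
    exact ⟨y₁, y₂, y₃, a1, by linarith, by linarith, c2, a3, b3, c3⟩

/-- Including the ends, where `stepE ≤ 1`, a dip makes `stepE` rise, fall, rise and fall; each
passage puts the slope ratio on one side of the level. -/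
lemma levels_of_hasDip (hξ : IsMixture n ξ) (h : IsStep ξ x x' A B) (hd : HasDip ξ x x' A B) :
    ∃ y₁ y₂ y₃ y₄, x < y₁ ∧ y₁ < y₂ ∧ y₂ < y₃ ∧ y₃ < y₄ ∧ y₄ < x' ∧
      stepLevel x x' A B < slopeRatio ξ y₁ ∧ slopeRatio ξ y₂ < stepLevel x x' A B ∧
      stepLevel x x' A B < slopeRatio ξ y₃ ∧ slopeRatio ξ y₄ < stepLevel x x' A B := by
  obtain ⟨y₁, y₂, y₃, h1, h2, h3, h4, e1, e2, e3⟩ := hd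
  have l := h.left_le
  have r := h.right_le
  rw [← h.stepE_left] at l
  rw [← stepE_right (x := x) (A := A)] at r
  obtain ⟨z₁, a1, a2, a3⟩ := h.exists_high hξ le_rfl h1 (by linarith) (by linarith)
  obtain ⟨z₂, b1, b2, b3⟩ := h.exists_low hξ h1.le h2 (by linarith) (by linarith)
  obtain ⟨z₃, c1, c2, c3⟩ := h.exists_high hξ (by linarith) h3 (by linarith) (e2.trans e3)
  obtain ⟨z₄, d1, d2, d3⟩ := h.exists_low hξ (by linarith) h4 le_rfl (by linarith)
  exact ⟨z₁, z₂, z₃, z₄, a1, by linarith, by linarith, by linarith, d2, a3, b3, c3, d3⟩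

/-- A bump yields one rise and one fall. The ends contribute only if `stepE` equals `1` there, since
otherwise it may already be below its neighbouring values. -/
lemma levels_of_hasBump (hξ : IsMixture n ξ) (h : IsStep ξ x x' A B)
    (hd : HasBump ξ x x' A B) :
    ∃ y₁ y₂, x < y₁ ∧ y₁ < y₂ ∧ y₂ < x' ∧
      stepLevel x x' A B < slopeRatio ξ y₁ ∧ slopeRatio ξ y₂ < stepLevel x x' A B ∧
      (deriv (deriv ξ) x * A ^ 2 = 1 →
        ∃ y₀, x < y₀ ∧ y₀ < y₁ ∧ slopeRatio ξ y₀ < stepLevel x x' A B) ∧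
      (deriv (deriv ξ) x' * B ^ 2 = 1 →
        ∃ y₃, y₂ < y₃ ∧ y₃ < x' ∧ stepLevel x x' A B < slopeRatio ξ y₃) := by
  obtain ⟨y₁, y₂, y₃, h1, h2, h3, h4, e1, e2, e3⟩ := hd
  obtain ⟨z₁, a1, a2, a3⟩ := h.exists_high hξ h1.le h2 (by linarith) (e1.trans e2)
  obtain ⟨z₂, b1, b2, b3⟩ := h.exists_low hξ (by linarith) h3 h4.le (e3.trans e2)
  refine ⟨z₁, z₂, by linarith, by linarith, by linarith, a3, b3, fun hl => ?_, fun hr => ?_⟩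
  · rw [← h.stepE_left] at hl
    obtain ⟨z, c1, c2, c3⟩ := h.exists_low hξ le_rfl h1 (by linarith) (by linarith)
    exact ⟨z, c1, by linarith, c3⟩
  · rw [← stepE_right (x := x) (A := A)] at hr
    obtain ⟨z, c1, c2, c3⟩ := h.exists_high hξ (by linarith) h4 le_rfl (by linarith)
    exact ⟨z, by linarith, c2, c3⟩

/-- Without a dip, the integral of `ξ' - ∫ line ^ (-2)` up to any point of the step is
nonpositive. -/
lemma stepG_nonpos (hξ : IsMixture n ξ) (h : IsStep ξ x x' A B) (hd : ¬ HasDip ξ x x' A B)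
    {y : ℝ} (hy : y ∈ Set.Icc x x') : stepG ξ x x' A B y ≤ 0 := by
  by_contra! H
  have hxy : x < y := lt_of_le_of_ne hy.1 (by rintro rfl; rw [h.stepG_left] at H; linarith)
  have hyx : y < x' := lt_of_le_of_ne hy.2 (by rintro rfl; rw [h.stepG_right] at H; linarith)
  -- A positive value of `stepG` makes `stepF` positive before and negative after `y`; as `stepF`
  -- vanishes at both ends, its derivative has the signs `+,-,+`, a dip.
  obtain ⟨c, hc, e1⟩ := exists_hasDerivAt_eq_slope (stepG ξ x x' A B) _ hxy
    (fun w hw => (h.hasDerivAt_stepG hξ (hw.2.trans hy.2)).continuousAt.continuousWithinAt)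
    (fun w hw => h.hasDerivAt_stepG hξ (hw.2.le.trans hy.2))
  obtain ⟨d, hd', e2⟩ := exists_hasDerivAt_eq_slope (stepG ξ x x' A B) _ hyx
    (fun w hw => (h.hasDerivAt_stepG hξ hw.2).continuousAt.continuousWithinAt)
    (fun w hw => h.hasDerivAt_stepG hξ hw.2.le)
  have hFc : 0 < stepF ξ x x' A B c := by
    rw [e1, h.stepG_left]; exact div_pos (by linarith) (by linarith)
  have hFd : stepF ξ x x' A B d < 0 := by
    rw [e2, h.stepG_right]; exact div_neg_of_neg_of_pos (by linarith) (by linarith)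
  obtain ⟨y₁, a1, a2, a3⟩ := h.exists_stepE_gt hξ hc.1 (hc.2.le.trans hy.2)
    (by rwa [h.stepF_left])
  obtain ⟨y₂, b1, b2, b3⟩ := h.exists_stepE_lt hξ (hc.2.trans hd'.1) hd'.2.le (by linarith)
  obtain ⟨y₃, c1, c2, c3⟩ := h.exists_stepE_gt hξ hd'.2 le_rfl (by rwa [h.stepF_right])
  exact hd ⟨y₁, y₂, y₃, a1, by linarith, by linarith, c2, a3, b3, c3⟩

/-- If the slope were larger, `stepE` would have a negative derivative at `x'`, where it equals `1`,
and so would exceed `1` just before `x'`. Together with the last two points of the bump this gives a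
dip. The right-hand side is `-((ξ'')^{-1/2})'` at `x'`, the density of the adjacent gap. -/
lemma slope_le_of_right_eq (hξ : IsMixture n ξ) (h : IsStep ξ x x' A B)
    (hd : ¬ HasDip ξ x x' A B) (hr : deriv (deriv ξ) x' * B ^ 2 = 1) :
    (A - B) / (x' - x) ≤ deriv (deriv (deriv ξ)) x' * B ^ 3 / 2 := by
  by_contra! H
  obtain ⟨y₁, y₂, y₃, h1, h2, h3, h4, e1, e2, e3⟩ :=
    (h.hasBump_or_hasDip hξ).resolve_right hd
  have hB := h.pos
  have hder := hasDerivAt_stepE (A := A) (B := B) (x := x) (x' := x') hξ x'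
  rw [line_right] at hder
  have hneg : B * (deriv (deriv (deriv ξ)) x' * B -
      2 * ((A - B) / (x' - x)) * deriv (deriv ξ) x') < 0 := by
    apply mul_neg_of_pos_of_neg hB
    have e : deriv (deriv ξ) x' = 1 / B ^ 2 := by field_simp; linarith
    rw [e]
    have : deriv (deriv (deriv ξ)) x' * B - 2 * ((A - B) / (x' - x)) * (1 / B ^ 2) =
      2 / B ^ 2 * (deriv (deriv (deriv ξ)) x' * B ^ 3 / 2 - (A - B) / (x' - x)) := by
      field_simp
    rw [this]
    exact mul_neg_of_pos_of_neg (by positivity) (by linarith)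
  have hev := (hasDerivAt_iff_tendsto_slope_left_right.1 hder).1.eventually_lt_const hneg
  obtain ⟨y, hy, hy'⟩ := (hev.and (Ioo_mem_nhdsLT h4)).exists
  rw [slope_def_field, stepE_right, hr, div_neg_iff] at hy
  have h5 : 1 < stepE ξ x x' A B y := by
    rcases hy with ⟨a, b⟩ | ⟨a, b⟩ <;> linarith [hy'.2]
  exact hd ⟨y₂, y₃, y, by linarith, h3, hy'.1, hy'.2, e2, e3, h5⟩

/-- At a critical point `y` of the step, the value of `h` is `- stepG y`. -/
lemma hFun_nonneg_of_critical (hξ : IsMixture n ξ) (h : IsStep ξ x x' A B)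
    (hd : ¬ HasDip ξ x x' A B) {y : ℝ} (hy : y ∈ Set.Ioo x x') (hr : r₁ ξ x x' y = A / B) :
    0 ≤ hFun ξ y x' (r₁ ξ y x' x) := by
  have hG := h.stepG_nonpos hξ hd ⟨hy.1.le, hy.2.le⟩
  have hB := h.pos
  have hA := h.left_pos
  have hl := h.line_pos hy.2.le
  have hm := h.slope_pos
  have p1 : 0 < y - x := by linarith [hy.1]
  have p2 : 0 < x' - y := by linarith [hy.2]
  have p3 : 0 < x' - x := by linarith
  have d1 : 0 < deriv ξ y - deriv ξ x := by linarith [hξ.deriv_lt h.nonneg hy.1]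
  have d2 : 0 < deriv ξ x' - deriv ξ y := by
    linarith [hξ.deriv_lt (h.nonneg.trans hy.1.le) hy.2]
  have rel := h.rel
  set ℓ := line x x' A B y with hℓ
  have eℓ : ℓ * (x' - x) = B * (y - x) + A * (x' - y) := by
    rw [hℓ, line]; field_simp; ring
  have hr' : (deriv ξ x' - deriv ξ y) * (y - x) * B =
      A * ((x' - y) * (deriv ξ y - deriv ξ x)) := by
    unfold r₁ at hr
    rw [div_eq_div_iff (mul_ne_zero (by linarith) d1.ne') hB.ne'] at hr
    linarith
  -- The critical equation means `stepF y = 0`, so the `ξ'`-equation holds on both parts of the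
  -- step.
  have rel' : (deriv ξ y - deriv ξ x) * (A * ℓ) = y - x := by
    apply mul_right_cancel₀ p3.ne'
    rw [show (deriv ξ y - deriv ξ x) * (A * ℓ) * (x' - x) =
      (deriv ξ y - deriv ξ x) * A * (ℓ * (x' - x)) by ring, eℓ]
    linear_combination (y - x) * rel - A * hr'
  have rel2 : (deriv ξ x' - deriv ξ y) * (ℓ * B) = x' - y := by
    apply mul_right_cancel₀ p3.ne'
    rw [show (deriv ξ x' - deriv ξ y) * (ℓ * B) * (x' - x) =
      (deriv ξ x' - deriv ξ y) * B * (ℓ * (x' - x)) by ring, eℓ]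
    linear_combination (x' - y) * rel + B * hr'
  have hratio : r₁ ξ y x' x = ℓ / B := by
    unfold r₁
    have d3 : 0 < deriv ξ x' - deriv ξ x := by linarith
    rw [div_eq_div_iff (mul_ne_zero (by linarith) (by linarith)) hB.ne']
    apply mul_right_cancel₀ hA.ne'
    linear_combination (x - y) * (-1) * rel - (x - x') * (-1) * rel'
  have hslope : (ℓ - B) / (x' - y) = (A - B) / (x' - x) := by
    rw [hℓ, line]; field_simp; ring
  have hBℓ : B < ℓ := by
    have : 0 < (A - B) / (x' - x) * (x' - y) := by positivity
    rw [hℓ, line]; linarith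
  rw [hratio, hFun_eq_stepG hy.2 hB hBℓ rel2]
  -- Both sides integrate the same function over `[y, x']`: the line is the same, and `stepF`
  -- vanishes at `y`.
  have e1 : stepG ξ y x' ℓ B x' = stepG ξ x x' A B x' - stepG ξ x x' A B y := by
    unfold stepG
    rw [line_right, line_right, hslope, ← hℓ, Real.log_div hl.ne' hB.ne',
      Real.log_div hA.ne' hB.ne', Real.log_div hA.ne' hl.ne']
    have e2 : deriv ξ y = deriv ξ x + (y - x) / (A * ℓ) := by field_simp; linarith
    have e3 : (A - B) / (x' - x) * (x' - y) = ℓ - B := by rw [hℓ, line]; ring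
    have e4 : (A - B) / (x' - x) * (y - x) = A - ℓ := by
      rw [hℓ, line_eq_left h.lt]; ring
    rw [e2]
    generalize (A - B) / (x' - x) = m at *
    have e5 : x' - y = (ℓ - B) / m := by field_simp; linarith
    have e6 : y - x = (A - ℓ) / m := by field_simp; linarith
    have e7 : x' - x = (A - B) / m := by
      rw [show x' - x = x' - y + (y - x) by ring, e5, e6]; ring
    rw [show ξ x' - ξ y - (deriv ξ x + (y - x) / (A * ℓ)) * (x' - y) =
      ξ x' - ξ y - deriv ξ x * (x' - y) - (y - x) / (A * ℓ) * (x' - y) by ring,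
      show ξ x' - ξ x - deriv ξ x * (x' - x) = ξ x' - ξ x - deriv ξ x * (x' - y) -
      deriv ξ x * (y - x) by ring, e7, e5, e6]
    field_simp
    ring
  rw [e1, h.stepG_right]
  linarith

end IsStep

/-! ### The breakpoints of a block system -/

/-- Upward induction through the breakpoints. -/
lemma blockSweep {t : ℕ} {s : ℕ → ℕ} {P : ℕ → ℕ → Prop} (h0 : P 1 0)
    (hstep : ∀ j, 1 ≤ j → j ≤ t → ∀ i, i < s j → P j i → P j (i + 1))
    (hgap : ∀ j, 1 ≤ j → j < t → P j (s j) → P (j + 1) 0) :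
    ∀ j, 1 ≤ j → j ≤ t → ∀ i, i ≤ s j → P j i := by
  have hblock : ∀ j, 1 ≤ j → j ≤ t → P j 0 → ∀ i, i ≤ s j → P j i := by
    intro j h1 h2 h i
    induction i with
    | zero => exact fun _ => h
    | succ i ih => exact fun hi => hstep j h1 h2 i hi (ih (by omega))
  intro j h1
  induction j, h1 using Nat.le_induction with
  | base => exact fun h2 => hblock 1 le_rfl h2 h0
  | succ j h1 ih =>
    exact fun h2 => hblock (j + 1) (by omega) h2
      (hgap j h1 h2 (ih (by omega) (s j) le_rfl))

/-- Downward induction through the breakpoints. -/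
lemma blockSweep_down {t : ℕ} {s : ℕ → ℕ} {P : ℕ → ℕ → Prop} (h0 : P t (s t))
    (hstep : ∀ j, 1 ≤ j → j ≤ t → ∀ i, i < s j → P j (i + 1) → P j i)
    (hgap : ∀ j, 1 ≤ j → j < t → P (j + 1) 0 → P j (s j)) :
    ∀ j, 1 ≤ j → j ≤ t → ∀ i, i ≤ s j → P j i := by
  have hblock : ∀ j, 1 ≤ j → j ≤ t → P j (s j) → ∀ i, i ≤ s j → P j i := by
    intro j h1 h2 h i hi
    induction hi using Nat.decreasingInduction with
    | self => exact h
    | of_succ i hi ih => exact hstep j h1 h2 i hi ih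
  intro j h1 h2
  induction h2 using Nat.decreasingInduction with
  | self => exact hblock t h1 le_rfl h0
  | of_succ j h2 ih =>
    exact hblock j h1 h2.le (hgap j h1 h2 (ih (by omega) 0 (Nat.zero_le _)))

namespace IsBlockSystem

variable {k t : ℕ} {s : ℕ → ℕ} {q : ℕ → ℕ → ℝ} (hq : IsBlockSystem k t s q)
include hq

lemma two_le : 2 ≤ t := hq.1

lemma sum_eq : blockEnd s t = k := hq.2.1

lemma one_le_of_mid {j : ℕ} (h1 : 1 < j) (h2 : j < t) : 1 ≤ s j := hq.2.2.1 j h1 h2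

lemma q_zero : q 1 0 = 0 := hq.2.2.2.1

lemma q_one : q t (s t) = 1 := hq.2.2.2.2.1

lemma step_lt {j i : ℕ} (h1 : 1 ≤ j) (h2 : j ≤ t) (hi : i < s j) : q j i < q j (i + 1) :=
  hq.2.2.2.2.2.1 j (Finset.mem_Icc.2 ⟨h1, h2⟩) i hi

lemma gap_lt {j : ℕ} (h1 : 1 ≤ j) (h2 : j < t) : q j (s j) < q (j + 1) 0 :=
  hq.2.2.2.2.2.2 j h1 h2

lemma block_le {j i i' : ℕ} (h1 : 1 ≤ j) (h2 : j ≤ t) (hi : i ≤ i') (hi' : i' ≤ s j) :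
    q j i ≤ q j i' := by
  induction i', hi using Nat.le_induction with
  | base => exact le_rfl
  | succ m hm ih => exact (ih (by omega)).trans (hq.step_lt h1 h2 (by omega)).le

lemma block_lt {j i i' : ℕ} (h1 : 1 ≤ j) (h2 : j ≤ t) (hi : i < i') (hi' : i' ≤ s j) :
    q j i < q j i' :=
  (hq.step_lt h1 h2 (by omega)).trans_le (hq.block_le h1 h2 (by omega) hi')

lemma lt_of_block_lt {j j' : ℕ} (h1 : 1 ≤ j) (h : j < j') (h2 : j' ≤ t) :
    q j (s j) < q j' 0 := by
  induction j', h using Nat.le_induction with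
  | base => exact hq.gap_lt h1 (by omega)
  | succ m hm ih =>
    exact (ih (by omega)).trans_le ((hq.block_le (by omega) (by omega) (Nat.zero_le _)
      le_rfl).trans (hq.gap_lt (by omega) (by omega)).le)

lemma nonneg {j i : ℕ} (h1 : 1 ≤ j) (h2 : j ≤ t) (hi : i ≤ s j) : 0 ≤ q j i := by
  rw [← hq.q_zero]
  rcases h1.eq_or_lt with rfl | h
  · exact hq.block_le le_rfl h2 (Nat.zero_le _) hi
  · exact (hq.block_le le_rfl (by omega) (Nat.zero_le _) le_rfl).trans
      ((hq.lt_of_block_lt le_rfl h h2).le.trans (hq.block_le h1 h2 (Nat.zero_le _) hi))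

lemma le_one {j i : ℕ} (h1 : 1 ≤ j) (h2 : j ≤ t) (hi : i ≤ s j) : q j i ≤ 1 := by
  rw [← hq.q_one]
  rcases h2.eq_or_lt with rfl | h
  · exact hq.block_le h1 le_rfl hi le_rfl
  · exact (hq.block_le h1 h2 hi le_rfl).trans
      ((hq.lt_of_block_lt h1 h le_rfl).le.trans (hq.block_le (by omega) le_rfl
        (Nat.zero_le _) le_rfl))

lemma pos_of_pos {j i : ℕ} (h1 : 1 ≤ j) (h2 : j ≤ t) (hi : i ≤ s j) (h : 0 < i) :
    0 < q j i :=
  (hq.nonneg h1 h2 (Nat.zero_le _)).trans_lt (hq.block_lt h1 h2 h hi)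

lemma pos_of_one_lt {j i : ℕ} (h1 : 1 < j) (h2 : j ≤ t) (hi : i ≤ s j) : 0 < q j i :=
  (hq.nonneg le_rfl (by omega) le_rfl).trans_lt ((hq.lt_of_block_lt le_rfl h1 h2).trans_le
    (hq.block_le h1.le h2 (Nat.zero_le _) hi))

end IsBlockSystem

lemma blockEnd_succ (s : ℕ → ℕ) (j : ℕ) : blockEnd s (j + 1) = blockEnd s j + s (j + 1) := by
  unfold blockEnd
  rw [Finset.sum_Icc_succ_top (by omega)]

lemma blockEnd_zero (s : ℕ → ℕ) : blockEnd s 0 = 0 := by simp [blockEnd]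

/-! ### Profiles and the number of their steps -/

/-- `av j i` are the values at the breakpoints `q j i` of a function `x ↦ ν((x, 1])` that
satisfies the local optimality conditions. -/
structure IsProfile (ξ : ℝ → ℝ) (t : ℕ) (s : ℕ → ℕ) (q av : ℕ → ℕ → ℝ) : Prop where
  pos : ∀ j, 1 ≤ j → j ≤ t → ∀ i, i ≤ s j → 0 < av j i
  step : ∀ j, 1 ≤ j → j ≤ t → ∀ i, i < s j →
    IsStep ξ (q j i) (q j (i + 1)) (av j i) (av j (i + 1))
  right_eq : ∀ j, 1 ≤ j → j < t → deriv (deriv ξ) (q j (s j)) * av j (s j) ^ 2 = 1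
  left_eq : ∀ j, 1 < j → j ≤ t → deriv (deriv ξ) (q j 0) * av j 0 ^ 2 = 1
  slope_lt : ∀ j, 1 ≤ j → j ≤ t → ∀ i, i + 1 < s j →
    (av j i - av j (i + 1)) / (q j (i + 1) - q j i) <
      (av j (i + 1) - av j (i + 2)) / (q j (i + 2) - q j (i + 1))

/-- The sign of the derivative of `slopeRatio`, and the opposite of the sign of the second
derivative of `(ξ'')^{-1/2}`. -/
def slopeSign (ξ : ℝ → ℝ) (x : ℝ) : ℝ :=
  2 * deriv (deriv ξ) x * deriv (deriv (deriv (deriv ξ))) x - 3 * deriv (deriv (deriv ξ)) x ^ 2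

namespace IsMixture

variable {n : ℕ} {ξ : ℝ → ℝ} (hξ : IsMixture n ξ)
include hξ

lemma continuous_slopeSign : Continuous (slopeSign ξ) := by
  have h2 : Continuous (deriv (deriv ξ)) :=
    continuous_iff_continuousAt.2 fun x => (hξ.hasDerivAt₂ x).continuousAt
  have h3 : Continuous (deriv (deriv (deriv ξ))) :=
    continuous_iff_continuousAt.2 fun x => (hξ.hasDerivAt₃ x).continuousAt
  have h4 := hξ.continuous₄
  unfold slopeSign
  fun_prop

lemma hasDerivAt_slopeRatio {x : ℝ} (hx : 0 < x) :
    HasDerivAt (slopeRatio ξ) (slopeSign ξ x /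
      (x * deriv (deriv (deriv ξ)) x + 2 * deriv (deriv ξ) x) ^ 2) x := by
  have h2 := hξ.deriv₂_pos x hx
  have h3 := hξ.deriv₃_pos x hx
  refine ((hξ.hasDerivAt₃ x).div (((hasDerivAt_id x).mul (hξ.hasDerivAt₃ x)).add
    ((hξ.hasDerivAt₂ x).const_mul 2)) ?_).congr_deriv ?_
  · simp only [Pi.add_apply, Pi.mul_apply, id]; positivity
  · simp only [Pi.add_apply, Pi.mul_apply, id, slopeSign]
    ring

lemma exists_slopeSign_pos {a b : ℝ} (ha : 0 < a) (hab : a < b)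
    (h : slopeRatio ξ a < slopeRatio ξ b) : ∃ c, a < c ∧ c < b ∧ 0 < slopeSign ξ c := by
  obtain ⟨c, hc, e⟩ := exists_hasDerivAt_eq_slope (slopeRatio ξ) _ hab
    (fun w hw => (hξ.hasDerivAt_slopeRatio (ha.trans_le hw.1)).continuousAt.continuousWithinAt)
    (fun w hw => hξ.hasDerivAt_slopeRatio (ha.trans hw.1))
  refine ⟨c, hc.1, hc.2, ?_⟩
  have h2 := hξ.deriv₂_pos c (ha.trans hc.1)
  have h3 := hξ.deriv₃_pos c (ha.trans hc.1)
  have hc0 := ha.trans hc.1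
  have : 0 < slopeSign ξ c / (c * deriv (deriv (deriv ξ)) c + 2 * deriv (deriv ξ) c) ^ 2 := by
    rw [e]; exact div_pos (by linarith) (by linarith)
  exact (div_pos_iff_of_pos_right (by positivity)).1 this

lemma exists_slopeSign_neg {a b : ℝ} (ha : 0 < a) (hab : a < b)
    (h : slopeRatio ξ b < slopeRatio ξ a) : ∃ c, a < c ∧ c < b ∧ slopeSign ξ c < 0 := by
  obtain ⟨c, hc, e⟩ := exists_hasDerivAt_eq_slope (slopeRatio ξ) _ hab
    (fun w hw => (hξ.hasDerivAt_slopeRatio (ha.trans_le hw.1)).continuousAt.continuousWithinAt)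
    (fun w hw => hξ.hasDerivAt_slopeRatio (ha.trans hw.1))
  refine ⟨c, hc.1, hc.2, ?_⟩
  have h2 := hξ.deriv₂_pos c (ha.trans hc.1)
  have h3 := hξ.deriv₃_pos c (ha.trans hc.1)
  have hc0 := ha.trans hc.1
  have : slopeSign ξ c / (c * deriv (deriv (deriv ξ)) c + 2 * deriv (deriv ξ) c) ^ 2 < 0 := by
    rw [e]; exact div_neg_of_neg_of_pos (by linarith) (by linarith)
  by_contra! h'
  exact absurd this (not_lt.2 (by positivity))

end IsMixture

/-- Before `x`, the slope ratio has completed `N` descents, and it has later been below `κ`. -/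
def Descended (ξ : ℝ → ℝ) (N : ℕ) (x κ : ℝ) : Prop :=
  ∃ y, 0 < y ∧ y < x ∧ slopeRatio ξ y < κ ∧ AltBelow (slopeSign ξ) (2 * N - 1) (-1) y

/-- When the slope ratio exceeds `κ` after `x`, it has completed `N` descents, each of them
followed by an ascent. -/
def Ready (ξ : ℝ → ℝ) (N : ℕ) (x κ : ℝ) : Prop :=
  ∀ y, x ≤ y → κ < slopeRatio ξ y → AltBelow (slopeSign ξ) (2 * N) 1 y

lemma Ready.of_altBelow {ξ : ℝ → ℝ} {N : ℕ} {x κ : ℝ}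
    (h : AltBelow (slopeSign ξ) (2 * N) 1 x) : Ready ξ N x κ :=
  fun _ hy _ => h.mono hy

lemma Descended.altBelow {ξ : ℝ → ℝ} {N : ℕ} {x κ : ℝ} (h : Descended ξ N x κ) :
    AltBelow (slopeSign ξ) (2 * N - 1) (-1) x := by
  obtain ⟨y, _, h1, _, h3⟩ := h
  exact h3.mono h1.le

/-! ### The descents forced by a single step -/

section steps

variable {n : ℕ} {ξ : ℝ → ℝ} (hξ : IsMixture n ξ)
include hξ

/-- To exceed `κ' ≥ κ` after having been below `κ`, the slope ratio must ascend. The hypothesis `1 ≤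
N` avoids the truncated `2 * 0 - 1`. -/
lemma Descended.ready {N : ℕ} (hN : 1 ≤ N) {x κ κ' : ℝ} (h : Descended ξ N x κ)
    (hκ : κ ≤ κ') : Ready ξ N x κ' := by
  intro z hz hz'
  obtain ⟨y, h0, h1, h2, h3⟩ := h
  obtain ⟨c, c1, c2, c3⟩ := hξ.exists_slopeSign_pos h0 (h1.trans_le hz) (by linarith)
  obtain ⟨M, rfl⟩ : ∃ M, N = M + 1 := ⟨N - 1, by omega⟩
  exact ⟨c, h0.trans c1, c2, by linarith, h3.mono c1.le⟩

/-- Crossing `κ` downward forces a negative value of the derivative of `slopeRatio` in between, one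
more sign in the sequence. -/
lemma AltBelow.descend {N : ℕ} {a b x κ : ℝ} (h : AltBelow (slopeSign ξ) (2 * N) 1 a)
    (ha : 0 < a) (hab : a < b) (hb : b < x) (h1 : κ < slopeRatio ξ a)
    (h2 : slopeRatio ξ b < κ) : Descended ξ (N + 1) x κ := by
  obtain ⟨c, c1, c2, c3⟩ := hξ.exists_slopeSign_neg ha hab (h2.trans h1)
  refine ⟨b, ha.trans hab, hb, h2, c, ha.trans c1, c2, by linarith, ?_⟩
  rw [neg_neg]
  exact h.mono c1.le

lemma AltBelow.ascend {N : ℕ} {a b κ : ℝ} (h : AltBelow (slopeSign ξ) (2 * N + 1) (-1) a)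
    (ha : 0 < a) (hab : a < b) (h1 : slopeRatio ξ a < κ)
    (h2 : κ < slopeRatio ξ b) : AltBelow (slopeSign ξ) (2 * (N + 1)) 1 b := by
  obtain ⟨c, c1, c2, c3⟩ := hξ.exists_slopeSign_pos ha hab (h1.trans h2)
  exact ⟨c, ha.trans c1, c2, by linarith, h.mono c1.le⟩

variable {x x' A B : ℝ} (h : IsStep ξ x x' A B)
include h

/-- The pattern high, low, high, low contains two descents with an ascent between them; one step
accounts for only one descent in the total count. -/
lemma IsStep.descended_of_hasDip {N : ℕ} (hR : Ready ξ N x (stepLevel x x' A B))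
    (hd : HasDip ξ x x' A B) : Descended ξ (N + 2) x' (stepLevel x x' A B) := by
  obtain ⟨y₁, y₂, y₃, y₄, h1, h2, h3, h4, h5, e1, e2, e3, e4⟩ := h.levels_of_hasDip hξ hd
  have p1 := h.nonneg.trans_lt h1
  have a1 := (hR y₁ h1.le e1).descend hξ p1 h2 h3 e1 e2
  exact ((a1.ready hξ (by omega) le_rfl) y₃ le_rfl e3).descend hξ (by linarith) h4 h5 e3 e4

/-- Both a bump and a dip contain a passage from above the level to below it. -/
lemma IsStep.descended {N : ℕ} (hR : Ready ξ N x (stepLevel x x' A B)) :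
    Descended ξ (N + 1) x' (stepLevel x x' A B) := by
  rcases h.hasBump_or_hasDip hξ with hd | hd
  · obtain ⟨y₁, y₂, h1, h2, h3, e1, e2, -⟩ := h.levels_of_hasBump hξ hd
    exact (hR y₁ h1.le e1).descend hξ (h.nonneg.trans_lt h1) h2 h3 e1 e2
  · obtain ⟨y₁, y₂, y₃, y₄, h1, h2, h3, h4, h5, e1, e2, e3, e4⟩ := h.levels_of_hasDip hξ hd
    exact (hR y₁ h1.le e1).descend hξ (h.nonneg.trans_lt h1) h2 (by linarith) e1 e2

/-- A bump on a step that ends at a gap is followed by an ascent. -/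
lemma IsStep.altBelow_of_right_eq {N : ℕ} (hR : Ready ξ N x (stepLevel x x' A B))
    (hd : ¬ HasDip ξ x x' A B) (hr : deriv (deriv ξ) x' * B ^ 2 = 1) :
    AltBelow (slopeSign ξ) (2 * (N + 1)) 1 x' := by
  obtain ⟨y₁, y₂, h1, h2, h3, e1, e2, -, hr'⟩ :=
    h.levels_of_hasBump hξ ((h.hasBump_or_hasDip hξ).resolve_right hd)
  obtain ⟨y₃, h4, h5, e3⟩ := hr' hr
  exact (((hR y₁ h1.le e1).descend hξ (h.nonneg.trans_lt h1) h2 h4 e1 e2).ready hξ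
    (by omega) le_rfl y₃ le_rfl e3).mono h5.le

/-- On a step that starts at a gap, both a bump and a dip contain an ascent and a descent. -/
lemma IsStep.descended_of_left_eq {N : ℕ}
    (hN : AltBelow (slopeSign ξ) (2 * N + 1) (-1) x) (hl : deriv (deriv ξ) x * A ^ 2 = 1) :
    Descended ξ (N + 2) x' (stepLevel x x' A B) := by
  rcases h.hasBump_or_hasDip hξ with hd | hd
  · obtain ⟨y₁, y₂, h1, h2, h3, e1, e2, hl', -⟩ := h.levels_of_hasBump hξ hd
    obtain ⟨y₀, h0, h0', e0⟩ := hl' hl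
    have p0 := h.nonneg.trans_lt h0
    exact ((hN.mono h0.le).ascend hξ p0 h0' e0 e1).descend hξ (p0.trans h0') h2 h3 e1 e2
  · obtain ⟨y₁, y₂, y₃, y₄, h1, h2, h3, h4, h5, e1, e2, e3, e4⟩ := h.levels_of_hasDip hξ hd
    have p2 := (h.nonneg.trans_lt h1).trans h2
    exact ((hN.mono (h1.trans h2).le).ascend hξ p2 h3 e2 e3).descend hξ (p2.trans h3) h4 h5 e3 e4

end steps

/-- The two lines meet at `(x', B)`, so their intercepts are `B + m x'`, and `m / (B + m x')`
increases with `m` because `B > 0`. -/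
lemma stepLevel_lt {x x' x'' A B C : ℝ} (hx : 0 ≤ x) (h1 : x < x') (h2 : x' < x'') (hB : 0 < B)
    (hA : B < A) (hm : (A - B) / (x' - x) < (B - C) / (x'' - x')) :
    stepLevel x x' A B < stepLevel x' x'' B C := by
  have hx' : 0 < x' := hx.trans_lt h1
  have hm0 : 0 < (A - B) / (x' - x) := div_pos (by linarith) (by linarith)
  have e : C + (B - C) / (x'' - x') * x'' = B + (B - C) / (x'' - x') * x' := by
    have : x'' - x' ≠ 0 := by linarith
    field_simp; ring
  unfold stepLevel
  rw [e]
  have hm1 := hm0.trans hm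
  rw [div_lt_div_iff₀ (by positivity) (by positivity)]
  nlinarith

lemma IsProfile.stepLevel_le {t : ℕ} {ξ : ℝ → ℝ} {s : ℕ → ℕ} {q av : ℕ → ℕ → ℝ}
    (h : IsProfile ξ t s q av) {j i : ℕ} (h1 : 1 ≤ j) (h2 : j ≤ t) (hi : i + 1 < s j) :
    stepLevel (q j i) (q j (i + 1)) (av j i) (av j (i + 1)) ≤
      stepLevel (q j (i + 1)) (q j (i + 2)) (av j (i + 1)) (av j (i + 2)) := by
  have a := h.step j h1 h2 i (by omega)
  have b := h.step j h1 h2 (i + 1) hi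
  exact (stepLevel_lt a.nonneg a.lt b.lt a.pos a.anti (h.slope_lt j h1 h2 i hi)).le

/-! ### Counting descents along a profile with `n` steps -/

namespace IsProfile

variable {n t : ℕ} {ξ : ℝ → ℝ} {s : ℕ → ℕ} {q av : ℕ → ℕ → ℝ} (hξ : IsMixture n ξ)
  (hq : IsBlockSystem n t s q) (h : IsProfile ξ t s q av)
include hξ h

/-- An excess of descents propagates to the end of the block. -/
lemma descended_end {j N i : ℕ} (h1 : 1 ≤ j) (h2 : j ≤ t) (hi : i < s j)
    (hN : 1 ≤ N + i + 1)
    (hD : Descended ξ (N + i + 1) (q j (i + 1))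
      (stepLevel (q j i) (q j (i + 1)) (av j i) (av j (i + 1)))) :
    AltBelow (slopeSign ξ) (2 * (N + s j) - 1) (-1) (q j (s j)) := by
  obtain ⟨d, hd⟩ : ∃ d, s j = i + 1 + d := ⟨s j - (i + 1), by omega⟩
  induction d generalizing i with
  | zero =>
    rw [hd]
    exact hD.altBelow
  | succ d ih =>
    refine ih (i := i + 1) (by omega) (by omega) ?_ (by omega)
    exact (h.step j h1 h2 (i + 1) (by omega)).descended hξ
      (hD.ready hξ hN (h.stepLevel_le h1 h2 (by omega)))

/-- Each step of the block adds a descent, and since the levels increase, reaching the next level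
needs an ascent. -/
lemma ready {j i : ℕ} (h1 : 1 ≤ j) (h2 : j ≤ t)
    (hA : AltBelow (slopeSign ξ) (2 * blockEnd s (j - 1)) 1 (q j 0)) (hi : i < s j) :
    Ready ξ (blockEnd s (j - 1) + i) (q j i)
      (stepLevel (q j i) (q j (i + 1)) (av j i) (av j (i + 1))) := by
  induction i with
  | zero => exact Ready.of_altBelow hA
  | succ i ih =>
    exact ((h.step j h1 h2 i (by omega)).descended hξ (ih (by omega))).ready hξ (by omega)
      (h.stepLevel_le h1 h2 hi)

include hq

/-- A gap starting at `0` would need `ξ''(0) a² = 1`, but `ξ''(0) = 0`. -/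
lemma one_le_first : 1 ≤ s 1 := by
  by_contra! h1
  have h2 := h.right_eq 1 le_rfl hq.two_le
  rw [Nat.lt_one_iff.1 h1, hq.q_zero, hξ.deriv₂_zero] at h2
  simp at h2

lemma one_le_of_lt {j : ℕ} (h1 : 1 ≤ j) (h2 : j < t) : 1 ≤ s j := by
  rcases h1.eq_or_lt with rfl | h1
  · exact h.one_le_first hξ hq
  · exact hq.one_le_of_mid h1 h2

/-- At the end of a block, the slope ratio cannot have completed more descents than there are
steps. -/
lemma not_altBelow_end : ∀ j, 1 ≤ j → j ≤ t →
    ¬ AltBelow (slopeSign ξ) (2 * blockEnd s j + 1) (-1) (q j (s j)) := by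
  intro j h1 h2
  induction h2 using Nat.decreasingInduction with
  | self =>
    intro hA
    rw [hq.sum_eq] at hA
    exact hξ.not_altBelow _ _ hA.pred
  | of_succ j h2 ih =>
    -- After the last block the excess would give `2n + 1` alternating signs.
    intro hA
    have hA' := hA.mono (hq.gap_lt h1 h2).le
    refine ih (by omega) ?_
    rw [blockEnd_succ]
    by_cases hs : s (j + 1) = 0
    · rw [hs]; exact hA'
    -- The first step after a gap starts with `stepE = 1`, so whatever its shape it contains an
    -- ascent followed by a descent: an excess at the end of block `j` survives in block `j + 1`.
    · have hD := (h.step (j + 1) (by omega) h2 0 (by omega)).descended_of_left_eq hξ hA'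
        (h.left_eq (j + 1) (by omega) h2)
      have := h.descended_end hξ (N := blockEnd s j + 1) (i := 0) (j := j + 1) (by omega) h2 (by omega)
        (by omega) hD
      rwa [show 2 * (blockEnd s j + 1 + s (j + 1)) - 1 =
        2 * (blockEnd s j + s (j + 1)) + 1 by omega] at this

/-- One descent too many would propagate through the remaining steps to the end of the block. -/
lemma not_descended {j i : ℕ} (h1 : 1 ≤ j) (h2 : j ≤ t) (hi : i < s j) :
    ¬ Descended ξ (blockEnd s (j - 1) + i + 2) (q j (i + 1))
      (stepLevel (q j i) (q j (i + 1)) (av j i) (av j (i + 1))) := by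
  intro hD
  refine h.not_altBelow_end hξ hq j h1 h2 ?_
  have := h.descended_end hξ (N := blockEnd s (j - 1) + 1) h1 h2 hi (by omega)
    (by rwa [show blockEnd s (j - 1) + 1 + i + 1 = blockEnd s (j - 1) + i + 2 by omega])
  obtain ⟨j, rfl⟩ : ∃ j', j = j' + 1 := ⟨j - 1, by omega⟩
  rw [Nat.add_sub_cancel] at this
  rwa [blockEnd_succ, show 2 * (blockEnd s j + s (j + 1)) + 1 =
    2 * (blockEnd s j + 1 + s (j + 1)) - 1 by omega]

/-- At the start of a block, the slope ratio has completed as many descents as there are steps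
before, each of them followed by an ascent. -/
lemma altBelow_start : ∀ j, 1 ≤ j → j ≤ t →
    AltBelow (slopeSign ξ) (2 * blockEnd s (j - 1)) 1 (q j 0) := by
  intro j h1
  induction j, h1 using Nat.le_induction with
  | base => intro _; simp [blockEnd_zero, AltBelow]
  | succ j h1 ih =>
    intro h2
    have hA := ih (by omega)
    have hs := h.one_le_of_lt hξ hq h1 h2
    obtain ⟨i, hi⟩ : ∃ i, s j = i + 1 := ⟨s j - 1, by omega⟩
    have hR := h.ready hξ h1 (by omega) hA (i := i) (by omega)
    have hst := h.step j h1 (by omega) i (by omega)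
    -- A dip on the last step would exceed the count; a bump on a step ending at a gap is followed
    -- by an ascent.
    have := hst.altBelow_of_right_eq hξ hR
      (fun hd => h.not_descended hξ hq h1 (by omega) (by omega)
        (hst.descended_of_hasDip hξ hR hd))
      (by rw [← hi]; exact h.right_eq j h1 h2)
    have e : blockEnd s (j + 1 - 1) = blockEnd s (j - 1) + i + 1 := by
      obtain ⟨j, rfl⟩ : ∃ j', j = j' + 1 := ⟨j - 1, by omega⟩
      rw [Nat.add_sub_cancel, Nat.add_sub_cancel, blockEnd_succ, hi]; omega
    rw [e]
    rw [← hi] at this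
    exact this.mono (hq.gap_lt h1 h2).le

/-- The last block of an `n`-step system has a step. -/
lemma one_le_last : 1 ≤ s t := by
  by_contra! h0
  -- If the last block is a single point, all `n` steps precede it, and each descent is followed by
  -- an ascent: `2n` alternating signs.
  have h1 := h.altBelow_start hξ hq t (by have := hq.two_le; omega) le_rfl
  have h2 := hq.sum_eq
  obtain ⟨t, rfl⟩ : ∃ t', t = t' + 1 := ⟨t - 1, by have := hq.two_le; omega⟩
  rw [blockEnd_succ, Nat.lt_one_iff.1 h0, add_zero] at h2
  rw [Nat.add_sub_cancel, h2] at h1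
  exact hξ.not_altBelow _ _ h1

lemma one_le {j : ℕ} (h1 : 1 ≤ j) (h2 : j ≤ t) : 1 ≤ s j := by
  rcases h2.eq_or_lt with rfl | h2
  · exact h.one_le_last hξ hq
  · exact h.one_le_of_lt hξ hq h1 h2

/-- A dip adds two descents where the count has room for one. -/
lemma not_hasDip {j i : ℕ} (h1 : 1 ≤ j) (h2 : j ≤ t) (hi : i < s j) :
    ¬ HasDip ξ (q j i) (q j (i + 1)) (av j i) (av j (i + 1)) := fun hd =>
  h.not_descended hξ hq h1 h2 hi ((h.step j h1 h2 i hi).descended_of_hasDip hξ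
    (h.ready hξ h1 h2 (h.altBelow_start hξ hq j h1 h2) hi) hd)

/-- The density jumps at the start of a block. -/
lemma lt_slope {j : ℕ} (h1 : 1 < j) (h2 : j ≤ t) :
    deriv (deriv (deriv ξ)) (q j 0) * av j 0 ^ 3 / 2 <
      (av j 0 - av j 1) / (q j 1 - q j 0) := by
  by_contra! H
  have hs := h.one_le hξ hq h1.le h2
  have hst := h.step j h1.le h2 0 hs
  have hl := h.left_eq j h1 h2
  have hx := hq.pos_of_one_lt h1 h2 (Nat.zero_le _)
  have hA := hst.left_pos
  obtain ⟨y₁, y₂, a1, a2, a3, e1, e2, hl', -⟩ := hst.levels_of_hasBump hξ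
    ((hst.hasBump_or_hasDip hξ).resolve_right (h.not_hasDip hξ hq h1.le h2 hs))
  obtain ⟨y₀, a0, a0', e0⟩ := hl' hl
  -- If the density did not jump, `stepE` would have a nonnegative derivative at the start of the
  -- block.
  have hlevel : stepLevel (q j 0) (q j 1) (av j 0) (av j 1) ≤ slopeRatio ξ (q j 0) := by
    obtain ⟨c, hc, e⟩ := hst.sign_iff hξ hx hst.lt.le
    rw [line_left hst.lt] at e
    have hnn : 0 ≤ av j 0 * (deriv (deriv (deriv ξ)) (q j 0) * av j 0 -
        2 * ((av j 0 - av j 1) / (q j 1 - q j 0)) * deriv (deriv ξ) (q j 0)) := by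
      refine mul_nonneg hA.le ?_
      have e' : deriv (deriv ξ) (q j 0) = 1 / av j 0 ^ 2 := by field_simp; linarith
      rw [e']
      have : deriv (deriv (deriv ξ)) (q j 0) * av j 0 -
          2 * ((av j 0 - av j 1) / (q j 1 - q j 0)) * (1 / av j 0 ^ 2) = 2 / av j 0 ^ 2 *
            (deriv (deriv (deriv ξ)) (q j 0) * av j 0 ^ 3 / 2 -
              (av j 0 - av j 1) / (q j 1 - q j 0)) := by
        field_simp
      rw [this]
      exact mul_nonneg (by positivity) (by linarith)
    rw [e] at hnn
    linarith [nonneg_of_mul_nonneg_right hnn hc]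
  -- The slope ratio would then have to descend to reach `y₀`, before the ascent and descent of the
  -- bump: one descent too many.
  obtain ⟨c, c1, c2, c3⟩ := hξ.exists_slopeSign_neg hx a0 (e0.trans_le hlevel)
  have hN : AltBelow (slopeSign ξ) (2 * blockEnd s (j - 1) + 1) (-1) y₀ :=
    ⟨c, hx.trans c1, c2, by linarith, by
      rw [neg_neg]; exact (h.altBelow_start hξ hq j h1.le h2).mono c1.le⟩
  have p0 := hx.trans a0
  exact h.not_descended hξ hq h1.le h2 hs
    ((hN.ascend hξ p0 a0' e0 e1).descend hξ (p0.trans a0') a2 a3 e1 e2)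

/-- Between the blocks, `(ξ'')^{-1/2}` is concave. -/
lemma slopeSign_nonneg {j : ℕ} (h1 : 1 ≤ j) (h2 : j < t) {x : ℝ}
    (hx : x ∈ Set.Icc (q j (s j)) (q (j + 1) 0)) : 0 ≤ slopeSign ξ x := by
  have hgap := hq.gap_lt h1 h2
  have hs := h.one_le_of_lt hξ hq h1 h2
  have hIoo : ∀ y ∈ Set.Ioo (q j (s j)) (q (j + 1) 0), 0 ≤ slopeSign ξ y := by
    intro y hy
    by_contra! hneg
    obtain ⟨i, hi⟩ : ∃ i, s j = i + 1 := ⟨s j - 1, by omega⟩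
    have hst := h.step j h1 h2.le i (by omega)
    have hA := hst.altBelow_of_right_eq hξ
      (h.ready hξ h1 h2.le (h.altBelow_start hξ hq j h1 h2.le) (by omega))
      (h.not_hasDip hξ hq h1 h2.le (by omega)) (by rw [← hi]; exact h.right_eq j h1 h2)
    have e : blockEnd s (j - 1) + i + 1 = blockEnd s j := by
      obtain ⟨j, rfl⟩ : ∃ j', j = j' + 1 := ⟨j - 1, by omega⟩
      rw [Nat.add_sub_cancel, blockEnd_succ, hi]; omega
    rw [e, ← hi] at hA
    have h0 : 0 < y := (hq.nonneg h1 h2.le le_rfl).trans_lt hy.1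
    -- A negative sign inside the gap comes after the ascent closing the previous block, so it is an
    -- excess descent.
    have hA' : AltBelow (slopeSign ξ) (2 * blockEnd s j + 1) (-1) (q (j + 1) 0) :=
      ⟨y, h0, hy.2, by linarith, by rw [neg_neg]; exact hA.mono hy.1.le⟩
    by_cases hs' : s (j + 1) = 0
    · refine h.not_altBelow_end hξ hq (j + 1) (by omega) h2 ?_
      rwa [blockEnd_succ, hs', add_zero]
    · exact h.not_descended hξ hq (j := j + 1) (i := 0) (by omega) h2 (by omega)
        ((h.step (j + 1) (by omega) h2 0 (by omega)).descended_of_left_eq hξ hA'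
          (h.left_eq (j + 1) (by omega) h2))
  have hcl : x ∈ closure (Set.Ioo (q j (s j)) (q (j + 1) 0)) := by
    rwa [closure_Ioo hgap.ne]
  exact closure_minimal hIoo (isClosed_le continuous_const hξ.continuous_slopeSign) hcl

end IsProfile

/-! ### The functions of a block in terms of the values at its breakpoints -/

/-- The values `a l` at the breakpoints `x l` of a block satisfy the `ξ'`-equations. -/
structure IsBlockChain (ξ : ℝ → ℝ) (s : ℕ) (x a : ℕ → ℝ) : Prop where
  nonneg : 0 ≤ x 0
  lt : ∀ i, i < s → x i < x (i + 1)
  pos : ∀ i, i ≤ s → 0 < a i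
  rel : ∀ i, i < s → (deriv ξ (x (i + 1)) - deriv ξ (x i)) * (a i * a (i + 1)) = x (i + 1) - x i

namespace IsBlockChain

variable {n s : ℕ} {ξ : ℝ → ℝ} {x a : ℕ → ℝ} (h : IsBlockChain ξ s x a)
include h

lemma point_nonneg {i : ℕ} (hi : i ≤ s) : 0 ≤ x i := by
  induction i with
  | zero => exact h.nonneg
  | succ i ih => exact (ih (by omega)).trans (h.lt i hi).le

lemma point_pos {i : ℕ} (hi : i ≤ s) (h0 : 0 < i) : 0 < x i := by
  obtain ⟨i, rfl⟩ : ∃ i', i = i' + 1 := ⟨i - 1, by omega⟩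
  exact (h.point_nonneg (by omega)).trans_lt (h.lt i hi)

lemma deriv_sub {i : ℕ} (hi : i < s) :
    deriv ξ (x (i + 1)) - deriv ξ (x i) = (x (i + 1) - x i) / (a i * a (i + 1)) := by
  have h1 := h.pos i hi.le
  have h2 := h.pos (i + 1) hi
  rw [← h.rel i hi]; field_simp

lemma r₂_right {i : ℕ} (hi : i < s) :
    r₂ ξ (x i) (x (i + 1)) = deriv (deriv ξ) (x (i + 1)) * (a i * a (i + 1)) := by
  have h1 := h.pos i hi.le
  have h2 := h.pos (i + 1) hi
  have h3 := h.lt i hi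
  have h4 : x (i + 1) - x i ≠ 0 := by linarith
  rw [r₂, h.deriv_sub hi]; field_simp

lemma r₂_left {i : ℕ} (hi : i < s) :
    r₂ ξ (x (i + 1)) (x i) = deriv (deriv ξ) (x i) * (a i * a (i + 1)) := by
  have h1 := h.pos i hi.le
  have h2 := h.pos (i + 1) hi
  have h3 := h.lt i hi
  have h4 : x (i + 1) - x i ≠ 0 := by linarith
  have e : deriv ξ (x i) - deriv ξ (x (i + 1)) = -((x (i + 1) - x i) / (a i * a (i + 1))) := by
    rw [← h.deriv_sub hi]; ring
  rw [r₂, e, ← neg_sub (x (i + 1)) (x i)]; field_simp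

lemma rBlock_eq {i : ℕ} (hi : i + 2 ≤ s) : rBlock ξ x (i + 1) = a i / a (i + 2) := by
  have p0 := h.pos i (by omega)
  have p1 := h.pos (i + 1) (by omega)
  have p2 := h.pos (i + 2) hi
  have l0 : x (i + 1) - x i ≠ 0 := by linarith [h.lt i (by omega)]
  have l1 : x (i + 2) - x (i + 1) ≠ 0 := by linarith [h.lt (i + 1) (by omega)]
  have d0 := h.deriv_sub (i := i) (by omega)
  have d1 : deriv ξ (x (i + 1)) - deriv ξ (x (i + 2)) =
      -((x (i + 2) - x (i + 1)) / (a (i + 1) * a (i + 2))) := by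
    rw [← h.deriv_sub (i := i + 1) (by omega)]; ring
  rw [rBlock, r₁, Nat.add_sub_cancel, d0, show i + 1 + 1 = i + 2 by rfl, d1,
    ← neg_sub (x (i + 2)) (x (i + 1))]
  field_simp

/-- The factor with index `i` is the quotient of `a (l - 1) / a l` at `l = s - 2i` and at `l = s -
2i + 2`, so the product telescopes. -/
lemma prod_eq {N : ℕ} (hN : 2 * N + 1 ≤ s) :
    ∏ i ∈ Finset.Icc 1 N, rBlock ξ x (s - 2 * i) / rBlock ξ x (s + 1 - 2 * i) =
      (a (s - 2 * N - 1) / a (s - 2 * N)) / (a (s - 1) / a s) := by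
  have ps := h.pos s le_rfl
  have ps' := h.pos (s - 1) (by omega)
  induction N with
  | zero => simp; field_simp
  | succ N ih =>
    rw [Finset.prod_Icc_succ_top (by omega), ih (by omega)]
    obtain ⟨d, rfl⟩ : ∃ d, s = d + 2 * N + 3 := ⟨s - 2 * N - 3, by omega⟩
    have e1 := h.rBlock_eq (i := d) (by omega)
    have e2 := h.rBlock_eq (i := d + 1) (by omega)
    have p0 := h.pos d (by omega)
    have p1 := h.pos (d + 1) (by omega)
    have p2 := h.pos (d + 2) (by omega)
    have p3 := h.pos (d + 3) (by omega)
    rw [show d + 2 * N + 3 - 2 * (N + 1) = d + 1 by omega,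
      show d + 2 * N + 3 + 1 - 2 * (N + 1) = d + 1 + 1 by omega, e1, e2,
      show d + 2 * N + 3 - 2 * N = d + 3 by omega, show d + 3 - 1 = d + 2 by omega,
      show d + 1 - 1 = d by omega, show d + 1 + 2 = d + 3 by omega]
    field_simp

lemma prod_inv_eq {N : ℕ} (hN : 2 * N + 1 ≤ s) :
    ∏ i ∈ Finset.Icc 1 N, rBlock ξ x (s + 1 - 2 * i) / rBlock ξ x (s - 2 * i) =
      (a (s - 1) / a s) / (a (s - 2 * N - 1) / a (s - 2 * N)) := by
  rw [← inv_div (a (s - 2 * N - 1) / a (s - 2 * N)), ← h.prod_eq hN, ← Finset.prod_inv_distrib]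
  exact Finset.prod_congr rfl fun i _ => (inv_div _ _).symm

lemma FBlock_odd {l : ℕ} (hl : l ≤ s) (ho : Odd (s - l)) :
    FBlock ξ s x l = deriv (deriv ξ) (x l) * a l ^ 2 / (a (s - 1) / a s) := by
  have hlt : l < s := by
    rcases hl.eq_or_lt with rfl | h'
    · simp at ho
    · exact h'
  obtain ⟨N, hN⟩ := ho
  have p0 := h.pos l hl
  have p1 := h.pos (l + 1) hlt
  have ps := h.pos s le_rfl
  have ps' := h.pos (s - 1) (by omega)
  rw [FBlock, if_pos ⟨N, hN⟩, h.r₂_left hlt, h.prod_eq (by omega),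
    show s - 2 * ((s - l) / 2) = l + 1 by omega, Nat.add_sub_cancel]
  field_simp

lemma FBlock_even {l : ℕ} (hs : 1 ≤ s) (hl : l ≤ s) (he : Even (s - l)) :
    FBlock ξ s x l = deriv (deriv ξ) (x l) * a l ^ 2 * (a (s - 1) / a s) := by
  have ho := Nat.not_odd_iff_even.2 he
  have ps := h.pos s le_rfl
  have ps' := h.pos (s - 1) (by omega)
  have p0 := h.pos l hl
  rw [FBlock, if_neg ho]
  obtain ⟨N, hN⟩ := he
  split_ifs with h0
  · subst h0
    have p1 := h.pos 1 (by omega)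
    have p2 := h.pos 2 (by omega)
    rw [h.r₂_left (i := 0) (by omega), h.rBlock_eq (i := 0) (by omega), h.prod_inv_eq (by omega),
      show s - 2 * (s / 2 - 1) = 2 by omega]
    norm_num
    field_simp
  · obtain ⟨l, rfl⟩ : ∃ l', l = l' + 1 := ⟨l - 1, by omega⟩
    have p1 := h.pos l (by omega)
    rw [Nat.add_sub_cancel, h.r₂_right (i := l) (by omega), h.prod_inv_eq (by omega),
      show s - 2 * ((s - (l + 1)) / 2) = l + 1 by omega, Nat.add_sub_cancel]
    field_simp

/-- The chain equations only fix the products of neighbours, so `a` may be rescaled by `c` and `c⁻¹`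
alternately. `FBlock` depends on the breakpoints alone; this is `ξ'' a²`, corrected by the power of
the last quotient that makes it invariant. -/
lemma FBlock_eq {l : ℕ} (hs : 1 ≤ s) (hl : l ≤ s) :
    FBlock ξ s x l =
      deriv (deriv ξ) (x l) * a l ^ 2 * (a (s - 1) / a s) ^ ((-1 : ℤ) ^ (s - l)) := by
  rcases Nat.even_or_odd (s - l) with he | ho
  · rw [h.FBlock_even hs hl he, he.neg_one_pow, zpow_one]
  · rw [h.FBlock_odd hl ho, ho.neg_one_pow, zpow_neg_one, div_eq_mul_inv _ (a (s - 1) / a s)]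

/-- When `y` is the last quotient of the chain, the third argument of `h` is the quotient `A / B` of
the step. -/
lemma stepRatio_eq (hξ : IsMixture n ξ) {l : ℕ} (hl : l < s) :
    stepRatio ξ s x (a (s - 1) / a s) (l + 1) = a l / a (l + 1) := by
  have p0 := h.pos l hl.le
  have p1 := h.pos (l + 1) hl
  have ps := h.pos s le_rfl
  have ps' := h.pos (s - 1) (by omega)
  have hd := hξ.deriv₂_pos _ (h.point_pos (i := l + 1) hl (by omega))
  rw [stepRatio, h.FBlock_eq (by omega) hl, Nat.add_sub_cancel, h.r₂_right hl]
  have hy : 0 < (a (s - 1) / a s) ^ ((-1 : ℤ) ^ (s - (l + 1))) := by positivity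
  generalize (a (s - 1) / a s) ^ ((-1 : ℤ) ^ (s - (l + 1))) = y at hy ⊢
  field_simp

/-- The quotient in terms of which `ABlock` compares two consecutive slopes. -/
lemma ABlock_eq {l : ℕ} (hl : l + 1 < s) :
    ABlock ξ s x (l + 1) = ((x (l + 1) - x l) * a (l + 2) + (x (l + 2) - x (l + 1)) * a l) /
      (a (l + 1) * (x (l + 2) - x l)) *
        (a (s - 1) / a s) ^ ((-1 : ℤ) ^ (s - (l + 1) + 1)) := by
  have p0 := h.pos l (by omega)
  have p1 := h.pos (l + 1) (by omega)
  have p2 := h.pos (l + 2) (by omega)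
  have ps := h.pos s le_rfl
  have ps' := h.pos (s - 1) (by omega)
  have l0 := h.lt l (by omega)
  have l1 := h.lt (l + 1) (by omega)
  have l0' : 0 < x (l + 1) - x l := by linarith
  have l1' : 0 < x (l + 2) - x (l + 1) := by linarith
  have l2' : 0 < x (l + 2) - x l := by linarith
  have d0 := h.deriv_sub (i := l) (by omega)
  have d1 : deriv ξ (x (l + 2)) - deriv ξ (x (l + 1)) =
    (x (l + 2) - x (l + 1)) / (a (l + 1) * a (l + 2)) := h.deriv_sub (i := l + 1) hl
  have d2 : deriv ξ (x (l + 2)) - deriv ξ (x l) =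
      ((x (l + 1) - x l) * a (l + 2) + (x (l + 2) - x (l + 1)) * a l) /
        (a l * a (l + 1) * a (l + 2)) := by
    rw [show deriv ξ (x (l + 2)) - deriv ξ (x l) = (deriv ξ (x (l + 2)) - deriv ξ (x (l + 1))) +
      (deriv ξ (x (l + 1)) - deriv ξ (x l)) by ring, d0, d1]
    field_simp
    ring
  rw [ABlock, show l + 1 + 1 = l + 2 by rfl, Nat.add_sub_cancel]
  split_ifs with ho
  · have e : Even (s - (l + 1) + 1) := ho.add_one
    rw [e.neg_one_pow, zpow_one]
    obtain ⟨N, hN⟩ := ho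
    have r : r₁ ξ (x (l + 1)) (x (l + 2)) (x l) =
        ((x (l + 1) - x l) * a (l + 2) + (x (l + 2) - x (l + 1)) * a l) /
        (a (l + 2) * (x (l + 2) - x l)) := by
      rw [r₁, ← neg_sub (deriv ξ (x (l + 2))), ← neg_sub (x (l + 1)), ← neg_sub (x (l + 2)) (x l),
        ← neg_sub (deriv ξ (x (l + 1))), d2, d0]
      field_simp
    rw [r, h.prod_inv_eq (by omega), show s - 2 * ((s - (l + 1)) / 2) = l + 2 by omega,
      show l + 2 - 1 = l + 1 by omega]
    field_simp
  · have e : Odd (s - (l + 1) + 1) := (Nat.not_odd_iff_even.1 ho).add_one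
    rw [e.neg_one_pow, zpow_neg_one]
    obtain ⟨N, hN⟩ := Nat.not_odd_iff_even.1 ho
    have r : r₁ ξ (x (l + 1)) (x l) (x (l + 2)) =
        ((x (l + 1) - x l) * a (l + 2) + (x (l + 2) - x (l + 1)) * a l) /
        (a l * (x (l + 2) - x l)) := by
      rw [r₁, d2, d1]
      field_simp
    rw [r, h.prod_eq (by omega), show s - 2 * ((s - (l + 1)) / 2) = l + 1 by omega,
      Nat.add_sub_cancel]
    field_simp

/-- The quotient compares, at the middle point, the chord between the outer points with the value `a
(l + 1)`; the chord lies below exactly when the rate of decrease grows. -/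
lemma quotient_lt_one_iff {l : ℕ} (hl : l + 1 < s) :
    ((x (l + 1) - x l) * a (l + 2) + (x (l + 2) - x (l + 1)) * a l) /
      (a (l + 1) * (x (l + 2) - x l)) < 1 ↔
    (a l - a (l + 1)) / (x (l + 1) - x l) <
      (a (l + 1) - a (l + 2)) / (x (l + 2) - x (l + 1)) := by
  have p1 := h.pos (l + 1) (by omega)
  have l0 := h.lt l (by omega)
  have l1 : x (l + 1) < x (l + 2) := h.lt (l + 1) (by omega)
  have l0' : 0 < x (l + 1) - x l := by linarith
  have l1' : 0 < x (l + 2) - x (l + 1) := by linarith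
  have l2' : 0 < x (l + 2) - x l := by linarith
  rw [div_lt_one (by positivity), div_lt_div_iff₀ l0' l1']
  constructor <;> intro h <;> nlinarith

/-- The bounds of the criterion, expressed by the values `a`. -/
lemma bounds_iff (hs : 1 ≤ s) :
    (YBlock ξ s x ≤ a (s - 1) / a s ∧ a (s - 1) / a s * ZBlock ξ s x ≤ 1 ∧
      ∀ l, 1 ≤ l → l < s →
        (a (s - 1) / a s) ^ ((-1 : ℤ) ^ (s - l + 1)) ≠ ABlock ξ s x l) ↔
    ((∀ l, l ≤ s → deriv (deriv ξ) (x l) * a l ^ 2 ≤ 1) ∧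
      ∀ l, l + 1 < s → (a l - a (l + 1)) / (x (l + 1) - x l) <
        (a (l + 1) - a (l + 2)) / (x (l + 2) - x (l + 1))) := by
  have ps := h.pos s le_rfl
  have ps' := h.pos (s - 1) (by omega)
  have hF := fun l (hl : l ≤ s) => h.FBlock_eq hs hl
  have hA := fun l (hl : l + 1 < s) => h.ABlock_eq hl
  have hQ := fun l (hl : l + 1 < s) => h.quotient_lt_one_iff hl
  have hy : 0 < a (s - 1) / a s := by positivity
  generalize a (s - 1) / a s = y at *
  -- Finiteness makes the suprema genuine maxima, so that bounding them means bounding each member.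
  have fin : ∀ (P Q : ℕ → Prop), ({b | ∃ l, l ≤ s ∧ P l ∧ b = FBlock ξ s x l} ∪
      {b | ∃ l, 1 ≤ l ∧ l < s ∧ Q l ∧ b = ABlock ξ s x l}).Finite := fun P Q => by
    refine Set.Finite.union (((Set.finite_Iic s).image (FBlock ξ s x)).subset ?_)
      (((Set.finite_Iic s).image (ABlock ξ s x)).subset ?_)
    · rintro b ⟨l, hl, -, rfl⟩; exact ⟨l, hl, rfl⟩
    · rintro b ⟨l, -, hl, -, rfl⟩; exact ⟨l, hl.le, rfl⟩
  have hY : YBlock ξ s x ≤ y ↔ (∀ l, l ≤ s → Even (s - l) → FBlock ξ s x l ≤ y) ∧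
      ∀ l, 1 ≤ l → l < s → Odd (s - l) → ABlock ξ s x l ≤ y := by
    rw [YBlock, csSup_le_iff (fin _ _).bddAbove ⟨_, Or.inl ⟨s, le_rfl, by simp, rfl⟩⟩]
    constructor
    · exact fun H => ⟨fun l h1 h2 => H _ (Or.inl ⟨l, h1, h2, rfl⟩),
        fun l h1 h2 h3 => H _ (Or.inr ⟨l, h1, h2, h3, rfl⟩)⟩
    · rintro ⟨H1, H2⟩ b (⟨l, h1, h2, rfl⟩ | ⟨l, h1, h2, h3, rfl⟩)
      · exact H1 l h1 h2
      · exact H2 l h1 h2 h3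
  have hZ : y * ZBlock ξ s x ≤ 1 ↔ (∀ l, l ≤ s → Odd (s - l) → FBlock ξ s x l ≤ y⁻¹) ∧
      ∀ l, 1 ≤ l → l < s → Even (s - l) → ABlock ξ s x l ≤ y⁻¹ := by
    rw [← le_inv_mul_iff₀ hy, mul_one, ZBlock, csSup_le_iff (fin _ _).bddAbove
      ⟨_, Or.inl ⟨s - 1, by omega, by rw [show s - (s - 1) = 1 by omega]; exact odd_one, rfl⟩⟩]
    constructor
    · exact fun H => ⟨fun l h1 h2 => H _ (Or.inl ⟨l, h1, h2, rfl⟩),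
        fun l h1 h2 h3 => H _ (Or.inr ⟨l, h1, h2, h3, rfl⟩)⟩
    · rintro ⟨H1, H2⟩ b (⟨l, h1, h2, rfl⟩ | ⟨l, h1, h2, h3, rfl⟩)
      · exact H1 l h1 h2
      · exact H2 l h1 h2 h3
  -- After cancelling the power of `y`, the bounds on `Y` and `Z` merge: the parity of `s - l` only
  -- decides which of them contains index `l`.
  have hF' : ∀ l, l ≤ s → (FBlock ξ s x l ≤ y ^ ((-1 : ℤ) ^ (s - l)) ↔
      deriv (deriv ξ) (x l) * a l ^ 2 ≤ 1) := fun l hl => by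
    rw [hF l hl]; exact mul_le_iff_le_one_left (by positivity)
  have hA' : ∀ l, l + 1 < s → (ABlock ξ s x (l + 1) < y ^ ((-1 : ℤ) ^ (s - (l + 1) + 1)) ↔
      (a l - a (l + 1)) / (x (l + 1) - x l) <
        (a (l + 1) - a (l + 2)) / (x (l + 2) - x (l + 1))) := fun l hl => by
    rw [hA l hl, ← hQ l hl]; exact mul_lt_iff_lt_one_left (by positivity)
  rw [hY, hZ]
  constructor
  · rintro ⟨⟨f1, a1⟩, ⟨f2, a2⟩, ne⟩
    refine ⟨fun l hl => (hF' l hl).1 ?_, fun l hl => (hA' l hl).1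
      (lt_of_le_of_ne ?_ (ne (l + 1) (by omega) hl).symm)⟩
    · rcases Nat.even_or_odd (s - l) with he | ho
      · rw [he.neg_one_pow, zpow_one]; exact f1 l hl he
      · rw [ho.neg_one_pow, zpow_neg_one]; exact f2 l hl ho
    · rcases Nat.even_or_odd (s - (l + 1)) with he | ho
      · rw [he.add_one.neg_one_pow, zpow_neg_one]; exact a2 _ (by omega) hl he
      · rw [ho.add_one.neg_one_pow, zpow_one]; exact a1 _ (by omega) hl ho
  · rintro ⟨f, sl⟩
    refine ⟨⟨fun l hl he => ?_, fun l h1 hl ho => ?_⟩, ⟨fun l hl ho => ?_, fun l h1 hl he => ?_⟩,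
      fun l h1 hl => ?_⟩
    · have := (hF' l hl).2 (f l hl)
      rwa [he.neg_one_pow, zpow_one] at this
    · obtain ⟨l, rfl⟩ : ∃ l', l = l' + 1 := ⟨l - 1, by omega⟩
      have := (hA' l hl).2 (sl l hl)
      rw [ho.add_one.neg_one_pow, zpow_one] at this
      exact this.le
    · have := (hF' l hl).2 (f l hl)
      rwa [ho.neg_one_pow, zpow_neg_one] at this
    · obtain ⟨l, rfl⟩ : ∃ l', l = l' + 1 := ⟨l - 1, by omega⟩
      have := (hA' l hl).2 (sl l hl)
      rw [he.add_one.neg_one_pow, zpow_neg_one] at this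
      exact this.le
    · obtain ⟨l, rfl⟩ : ∃ l', l = l' + 1 := ⟨l - 1, by omega⟩
      exact ((hA' l hl).2 (sl l hl)).ne'

end IsBlockChain

/-- The `ξ'`-equations of a block have a solution with any given last quotient. -/
lemma exists_isBlockChain {n s : ℕ} {ξ : ℝ → ℝ} (hξ : IsMixture n ξ) {x : ℕ → ℝ} (hs : 1 ≤ s)
    (h0 : 0 ≤ x 0) (hx : ∀ i, i < s → x i < x (i + 1)) {y : ℝ} (hy : 0 < y) :
    ∃ a, IsBlockChain ξ s x a ∧ a (s - 1) / a s = y := by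
  have hx0 : ∀ i, i ≤ s → 0 ≤ x i := by
    intro i
    induction i with
    | zero => exact fun _ => h0
    | succ i ih => exact fun hi => (ih (by omega)).trans (hx i hi).le
  set K : ℕ → ℝ := fun i => (x (i + 1) - x i) / (deriv ξ (x (i + 1)) - deriv ξ (x i)) with hK
  have hd : ∀ i, i < s → 0 < deriv ξ (x (i + 1)) - deriv ξ (x i) := fun i hi =>
    sub_pos.2 (hξ.deriv_lt (hx0 i hi.le) (hx i hi))
  have hKpos : ∀ i, i < s → 0 < K i := fun i hi => div_pos (sub_pos.2 (hx i hi)) (hd i hi)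
  -- The chain is built backward, `b i = a (s - i)`. The square root solves `a_{s-1} a_s = K (s -
  -- 1)` together with `a_{s-1} / a_s = y`.
  set b : ℕ → ℝ := fun i =>
    Nat.rec (Real.sqrt (K (s - 1) / y)) (fun i b => K (s - 1 - i) / b) i with hb
  have hb0 : b 0 = Real.sqrt (K (s - 1) / y) := rfl
  have hb1 : ∀ i, b (i + 1) = K (s - 1 - i) / b i := fun i => rfl
  have hbpos : ∀ i, i ≤ s → 0 < b i := by
    intro i
    induction i with
    | zero => intro _; rw [hb0]; exact Real.sqrt_pos.2 (div_pos (hKpos _ (by omega)) hy)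
    | succ i ih =>
      intro hi
      rw [hb1]; exact div_pos (hKpos _ (by omega)) (ih (by omega))
  have hba : ∀ i, i < s → b (s - i) * b (s - (i + 1)) = K i := fun i hi => by
    have := hbpos (s - (i + 1)) (by omega)
    rw [show s - i = s - (i + 1) + 1 by omega, hb1, show s - 1 - (s - (i + 1)) = i by omega]
    field_simp
  refine ⟨fun i => b (s - i), ⟨h0, hx, fun i _ => hbpos _ (by omega), fun i hi => ?_⟩, ?_⟩
  · rw [hba i hi, hK]
    have := (hd i hi).ne'
    field_simp
  · simp only
    have h1 := hba (s - 1) (by omega)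
    rw [show s - (s - 1 + 1) = 0 by omega] at h1
    have hp := hbpos 0 (by omega)
    have h2 : b 0 ^ 2 = K (s - 1) / y := by
      rw [hb0]; exact Real.sq_sqrt (div_pos (hKpos _ (by omega)) hy).le
    rw [Nat.sub_self, div_eq_iff hp.ne']
    rw [eq_div_iff hy.ne'] at h2
    apply mul_right_cancel₀ hp.ne'
    rw [h1]; linarith

/-! ### Solutions of the equations of the steps -/

/-- The expression vanishes at `1`, and its derivative `z - 1 - log z` is positive before. -/
lemma log_ineq {z : ℝ} (h0 : 0 < z) (h1 : z < 1) :
    z - 1 - z * Real.log z + (z - 1) ^ 2 / 2 < 0 := by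
  have hd : ∀ w ∈ Set.Icc z 1, HasDerivAt (fun z => z - 1 - z * Real.log z + (z - 1) ^ 2 / 2)
      (w - 1 - Real.log w) w := fun w hw => by
    have hw0 : w ≠ 0 := (h0.trans_le hw.1).ne'
    refine ((((hasDerivAt_id w).sub_const 1).sub
      ((hasDerivAt_id w).mul (Real.hasDerivAt_log hw0))).add
      ((((hasDerivAt_id w).sub_const 1).pow 2).div_const 2)).congr_deriv ?_
    simp [hw0]; ring
  obtain ⟨c, hc, e⟩ := exists_hasDerivAt_eq_slope _ _ h1
    (fun w hw => (hd w hw).continuousAt.continuousWithinAt) (fun w hw => hd w ⟨hw.1.le, hw.2.le⟩)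
  have hlog := Real.log_lt_sub_one_of_pos (h0.trans hc.1) hc.2.ne
  have : 0 < c - 1 - Real.log c := by linarith
  rw [e] at this
  have h3 := (div_pos_iff_of_pos_right (by linarith)).1 this
  norm_num at h3
  linarith

/-- `ξ'` is strictly convex, so the area below its graph is less than that of the trapezoid. -/
lemma integral_deriv_lt {n : ℕ} {ξ : ℝ → ℝ} (hξ : IsMixture n ξ) {x y : ℝ} (hx : 0 ≤ x)
    (hxy : x < y) : ξ y - ξ x - deriv ξ x * (y - x) < (deriv ξ y - deriv ξ x) * (y - x) / 2 := by
  have hd : ∀ w, HasDerivAt (fun y => (deriv ξ y - deriv ξ x) * (y - x) / 2 -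
      (ξ y - ξ x - deriv ξ x * (y - x)))
      ((deriv (deriv ξ) w * (w - x) - (deriv ξ w - deriv ξ x)) / 2) w := fun w => by
    refine (((((hξ.hasDerivAt₁ w).sub_const _).mul ((hasDerivAt_id w).sub_const x)).div_const 2).sub
      (((hξ.hasDerivAt w).sub_const _).sub
        (((hasDerivAt_id w).sub_const x).const_mul _))).congr_deriv ?_
    simp; ring
  obtain ⟨c, hc, e⟩ := exists_hasDerivAt_eq_slope _ _ hxy
    (fun w _ => (hd w).continuousAt.continuousWithinAt) (fun w _ => hd w)
  obtain ⟨d, hd, e'⟩ := exists_hasDerivAt_eq_slope _ _ hc.1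
    (fun w _ => (hξ.hasDerivAt₁ w).continuousAt.continuousWithinAt) (fun w _ => hξ.hasDerivAt₁ w)
  have hlt := hξ.strictMonoOn_deriv₂ (hx.trans hd.1.le) (hx.trans hc.1.le) hd.2
  have hcx : 0 < c - x := by linarith [hc.1]
  have e2 : deriv ξ c - deriv ξ x = deriv (deriv ξ) d * (c - x) := by rw [e']; field_simp
  have h1 : 0 < (deriv (deriv ξ) c * (c - x) - (deriv ξ c - deriv ξ x)) / 2 := by
    rw [e2]; nlinarith
  rw [e] at h1
  have h3 := (div_pos_iff_of_pos_right (by linarith)).1 h1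
  norm_num at h3
  linarith

lemma deriv_mul_lt {n : ℕ} {ξ : ℝ → ℝ} (hξ : IsMixture n ξ) {x y : ℝ} (hx : 0 ≤ x)
    (hxy : x < y) : 0 < ξ y - ξ x - deriv ξ x * (y - x) := by
  obtain ⟨c, hc, e⟩ := exists_hasDerivAt_eq_slope _ _ hxy
    (fun w _ => (hξ.hasDerivAt w).continuousAt.continuousWithinAt) (fun w _ => hξ.hasDerivAt w)
  have h1 := hξ.deriv_lt hx hc.1
  have h2 : 0 < y - x := by linarith
  rw [eq_div_iff h2.ne'] at e
  rw [← e]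
  nlinarith

/-- A positive zero of `h(x, y, ·)` is larger than `1`. -/
lemma one_lt_of_hFun_eq_zero {n : ℕ} {ξ : ℝ → ℝ} (hξ : IsMixture n ξ) {x y z : ℝ} (hx : 0 ≤ x)
    (hxy : x < y) (hz : 0 < z) (h : hFun ξ x y z = 0) : 1 < z := by
  by_contra! hz1
  unfold hFun at h
  rcases hz1.eq_or_lt with rfl | hz1
  -- At `z = 1` division by zero makes the bracket of `hFun` equal to `0`; what remains is positive
  -- by convexity of `ξ`.
  · have := deriv_mul_lt hξ hx hxy
    simp at h
    linarith
  · have h1 := log_ineq hz hz1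
    have h2 := integral_deriv_lt hξ hx hxy
    have h3 : 0 < (deriv ξ y - deriv ξ x) * (y - x) :=
      mul_pos (sub_pos.2 (hξ.deriv_lt hx hxy)) (sub_pos.2 hxy)
    have hz2 : 0 < (z - 1) ^ 2 := by nlinarith
    -- The first part of `h` is below half of `(ξ'(y) - ξ'(x)) (y - x)`, so this bound makes `h`
    -- negative for `z < 1`.
    have h4 : 1 / (z - 1) - z / (z - 1) ^ 2 * Real.log z < -(1 / 2) := by
      have hne : z - 1 ≠ 0 := by linarith
      have e : 1 / (z - 1) - z / (z - 1) ^ 2 * Real.log z + 1 / 2 =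
          (z - 1 - z * Real.log z + (z - 1) ^ 2 / 2) / (z - 1) ^ 2 := by field_simp
      have := div_neg_of_neg_of_pos h1 hz2
      linarith
    nlinarith

/-! ### The conditions are equivalent to the existence of a profile -/

section criterion

variable {n t : ℕ} {ξ : ℝ → ℝ} {s : ℕ → ℕ} {q : ℕ → ℕ → ℝ} (hξ : IsMixture n ξ)
  (hq : IsBlockSystem n t s q) (hs : ∀ j, 1 ≤ j → j ≤ t → 1 ≤ s j)
include hq hs

/-- The values in a profile form a solution of the `ξ'`-equations of each block, and the last
quotients in the blocks are given by `star`. -/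
lemma IsProfile.isBlockChain {av : ℕ → ℕ → ℝ} (h : IsProfile ξ t s q av) {j : ℕ} (h1 : 1 ≤ j)
    (h2 : j ≤ t) : IsBlockChain ξ (s j) (q j) (av j) ∧
      av j (s j - 1) / av j (s j) = star ξ t s q j := by
  have hsj := hs j h1 h2
  have hc : IsBlockChain ξ (s j) (q j) (av j) := ⟨hq.nonneg h1 h2 (Nat.zero_le _),
    fun i hi => hq.step_lt h1 h2 hi, h.pos j h1 h2, fun i hi => (h.step j h1 h2 i hi).rel⟩
  refine ⟨hc, ?_⟩
  unfold star
  split_ifs with hj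
  -- Where `ξ'' a² = 1`, `FBlock` reduces to a power of the last quotient. The last block has this
  -- equality only at its left end, and the sign exponent there is undone by the one in `star`.
  · rw [hc.FBlock_even hsj le_rfl (by simp), h.right_eq j h1 hj, one_mul]
  · rw [hc.FBlock_eq hsj (Nat.zero_le _), h.left_eq j (by have := hq.two_le; omega) h2, one_mul,
      ← zpow_mul, Nat.sub_zero, ← pow_add, Even.neg_one_pow ⟨_, rfl⟩, zpow_one]

lemma IsProfile.blockBounds {av : ℕ → ℕ → ℝ} (h : IsProfile ξ t s q av) :
    BlockBounds ξ t s q := by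
  intro j hj
  obtain ⟨h1, h2⟩ := Finset.mem_Icc.1 hj
  obtain ⟨hc, e⟩ := h.isBlockChain hq hs h1 h2
  have hsj := hs j h1 h2
  rw [← e]
  refine (hc.bounds_iff hsj).2 ⟨fun l hl => ?_, h.slope_lt j h1 h2⟩
  rcases hl.eq_or_lt with rfl | hl
  · have := (h.step j h1 h2 (s j - 1) (by omega)).right_le
    rwa [show s j - 1 + 1 = s j by omega] at this
  · exact (h.step j h1 h2 l hl).left_le

include hξ

/-- `FBlock` depends only on the breakpoints, so it may be evaluated on a chain with any last
quotient, here `1`. -/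
lemma star_pos {j : ℕ} (h1 : 1 ≤ j) (h2 : j ≤ t) : 0 < star ξ t s q j := by
  have hsj := hs j h1 h2
  obtain ⟨a, ha, -⟩ := exists_isBlockChain hξ hsj (hq.nonneg h1 h2 (Nat.zero_le _))
    (fun i hi => hq.step_lt h1 h2 hi) one_pos
  have ps := ha.pos _ le_rfl
  have ps' := ha.pos (s j - 1) (by omega)
  unfold star
  split_ifs with hj
  · rw [ha.FBlock_eq hsj le_rfl]
    have := hξ.deriv₂_pos _ (hq.pos_of_pos h1 h2 le_rfl hsj)
    positivity
  · rw [ha.FBlock_eq hsj (Nat.zero_le _)]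
    have p0 := ha.pos 0 (by omega)
    have := hξ.deriv₂_pos _ (hq.pos_of_one_lt (j := j) (i := 0) (by have := hq.two_le; omega) h2
      (by omega))
    positivity

lemma IsProfile.blockEquations {av : ℕ → ℕ → ℝ} (h : IsProfile ξ t s q av) :
    BlockEquations ξ t s q := by
  refine ⟨fun j hj l hl => ?_, fun j h1 h2 => ?_⟩
  · obtain ⟨h1, h2⟩ := Finset.mem_Icc.1 hj
    obtain ⟨h3, h4⟩ := Finset.mem_Icc.1 hl
    obtain ⟨hc, e⟩ := h.isBlockChain hq hs h1 h2
    obtain ⟨l, rfl⟩ : ∃ l', l = l' + 1 := ⟨l - 1, by omega⟩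
    rw [hBlock, ← e, hc.stepRatio_eq hξ h4, Nat.add_sub_cancel]
    exact (h.step j h1 h2 l h4).hFun_eq
  · obtain ⟨hc, -⟩ := h.isBlockChain hq hs h1.le h2.le
    have hsj := hs j h1.le h2.le
    rw [hc.FBlock_even hsj le_rfl (by simp), h.right_eq j h1.le h2,
      hc.FBlock_eq hsj (Nat.zero_le _), h.left_eq j h1 h2.le, Nat.sub_zero, one_mul, one_mul]

/-- In each block the chain with last quotient `star` is taken. The equation `h = 0` forces `A / B >
1`, so the values decrease; the definition of `star` and the matching conditions say that `FBlock`
equals a power of the last quotient at the gap ends, which means `ξ'' a² = 1`. -/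
lemma exists_isProfile (hE : BlockEquations ξ t s q) (hB : BlockBounds ξ t s q) :
    ∃ av, IsProfile ξ t s q av := by
  have key : ∀ j, ∃ a, 1 ≤ j → j ≤ t → IsBlockChain ξ (s j) (q j) a ∧
      a (s j - 1) / a (s j) = star ξ t s q j := fun j => by
    by_cases hj : 1 ≤ j ∧ j ≤ t
    · obtain ⟨a, ha⟩ := exists_isBlockChain hξ (hs j hj.1 hj.2)
        (hq.nonneg hj.1 hj.2 (Nat.zero_le _)) (fun i hi => hq.step_lt hj.1 hj.2 hi)
        (star_pos hξ hq hs hj.1 hj.2)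
      exact ⟨a, fun _ _ => ha⟩
    · exact ⟨fun _ => 0, fun h1 h2 => absurd ⟨h1, h2⟩ hj⟩
  choose av hav using key
  have bounds := fun j (h1 : 1 ≤ j) (h2 : j ≤ t) => by
    have := hB j (Finset.mem_Icc.2 ⟨h1, h2⟩)
    rw [← (hav j h1 h2).2] at this
    exact ((hav j h1 h2).1.bounds_iff (hs j h1 h2)).1 this
  have cancel : ∀ (j : ℕ) (d y : ℝ), 0 < y → d * y = y → d = 1 := fun j d y hy h => by
    field_simp at h; exact h
  refine ⟨av, fun j h1 h2 => (hav j h1 h2).1.pos, fun j h1 h2 i hi => ?_, fun j h1 h2 => ?_,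
    fun j h1 h2 => ?_, fun j h1 h2 i hi => (bounds j h1 h2).2 i hi⟩
  · obtain ⟨hc, e⟩ := hav j h1 h2
    have h0 := hE.1 j (Finset.mem_Icc.2 ⟨h1, h2⟩) (i + 1) (Finset.mem_Icc.2 ⟨by omega, hi⟩)
    rw [hBlock, ← e, hc.stepRatio_eq hξ hi, Nat.add_sub_cancel] at h0
    have p0 := hc.pos i hi.le
    have p1 := hc.pos (i + 1) hi
    have hz := one_lt_of_hFun_eq_zero hξ (hc.point_nonneg hi.le) (hc.lt i hi)
      (div_pos p0 p1) h0
    exact ⟨hc.point_nonneg hi.le, hc.lt i hi, p1, (one_lt_div p1).1 hz, hc.rel i hi, h0,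
      (bounds j h1 h2).1 i hi.le, (bounds j h1 h2).1 (i + 1) hi⟩
  · obtain ⟨hc, e⟩ := hav j h1 h2.le
    have hp := star_pos hξ hq hs h1 h2.le
    have e' := e
    rw [star, if_pos h2, hc.FBlock_even (hs j h1 h2.le) le_rfl (by simp), e] at e'
    exact cancel j _ _ hp e'.symm
  · obtain ⟨hc, e⟩ := hav j h1.le h2
    have hsj := hs j h1.le h2
    have hp := star_pos hξ hq hs h1.le h2
    have hF := hc.FBlock_eq hsj (Nat.zero_le _)
    rw [e, Nat.sub_zero] at hF
    have hF' : FBlock ξ (s j) (q j) 0 = star ξ t s q j ^ ((-1 : ℤ) ^ s j) := by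
      rcases h2.eq_or_lt with rfl | h2
      · rw [star, if_neg (lt_irrefl _), ← zpow_mul, ← pow_add, Even.neg_one_pow ⟨_, rfl⟩, zpow_one]
      · rw [hE.2 j h1 h2, star, if_pos h2]
    rw [hF'] at hF
    exact cancel j _ _ (zpow_pos hp _) hF.symm

lemma criterion_iff_isProfile :
    (BlockEquations ξ t s q ∧ BlockBounds ξ t s q) ↔ ∃ av, IsProfile ξ t s q av :=
  ⟨fun h => exists_isProfile hξ hq hs h.1 h.2,
    fun ⟨_, h⟩ => ⟨h.blockEquations hξ hq hs, h.blockBounds hq hs⟩⟩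

end criterion

lemma IsProfile.positivityCondition {n t : ℕ} {ξ : ℝ → ℝ} {s : ℕ → ℕ} {q av : ℕ → ℕ → ℝ}
    (hξ : IsMixture n ξ) (hq : IsBlockSystem n t s q) (h : IsProfile ξ t s q av) :
    PositivityCondition ξ t s q := by
  intro j hj l hl y hy hr
  obtain ⟨h1, h2⟩ := Finset.mem_Icc.1 hj
  obtain ⟨h3, h4⟩ := Finset.mem_Icc.1 hl
  obtain ⟨hc, e⟩ := h.isBlockChain hq (fun j h1 h2 => h.one_le hξ hq h1 h2) h1 h2
  obtain ⟨l, rfl⟩ : ∃ l', l = l' + 1 := ⟨l - 1, by omega⟩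
  rw [← e, hc.stepRatio_eq hξ h4] at hr
  rw [Nat.add_sub_cancel] at hr hy ⊢
  exact (h.step j h1 h2 l h4).hFun_nonneg_of_critical hξ (h.not_hasDip hξ hq h1 h2 h4) hy hr

/-! ### The functional in terms of the density -/

/-- The densities of the measures in `measureClass`, extended by zero. -/
structure IsDensity (γ : ℝ → ℝ) : Prop where
  nonneg : ∀ x, 0 ≤ γ x
  eq_zero : ∀ x, x ∉ Set.Ico (0 : ℝ) 1 → γ x = 0
  mono : MonotoneOn γ (Set.Ico 0 1)
  right_cont : ∀ x ∈ Set.Ico (0 : ℝ) 1, ContinuousWithinAt γ (Set.Ici x) x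

/-- The measure `γ(x) dx + Δ δ_1`. -/
def densityMeasure (γ : ℝ → ℝ) (Δ : ℝ) : Measure ℝ :=
  volume.withDensity (fun x => ENNReal.ofReal (γ x)) + ENNReal.ofReal Δ • Measure.dirac (1 : ℝ)

/-- The mass of `(x, 1]`. -/
def tail (γ : ℝ → ℝ) (Δ x : ℝ) : ℝ := Δ + ∫ s in x..1, γ s

/-- Twice the functional, as a real number. -/
def csReal (ξ γ : ℝ → ℝ) (Δ : ℝ) : ℝ :=
  (∫ x in (0 : ℝ)..1, deriv ξ x * γ x) + Δ * deriv ξ 1 + ∫ x in (0 : ℝ)..1, (tail γ Δ x)⁻¹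

/-- The first variation of the functional. -/
def potential (ξ γ : ℝ → ℝ) (Δ x : ℝ) : ℝ :=
  deriv ξ x - ∫ s in (0 : ℝ)..x, ((tail γ Δ s) ^ 2)⁻¹

lemma mem_measureClass_iff {ν : Measure ℝ} :
    ν ∈ measureClass ↔ ∃ γ Δ, IsDensity γ ∧ 0 < Δ ∧ ν = densityMeasure γ Δ := by
  constructor
  · rintro ⟨γ, Δ, h0, hm, hr, hΔ, rfl⟩
    refine ⟨(Set.Ico (0 : ℝ) 1).indicator γ, Δ, ⟨fun x => ?_, fun x hx => ?_, ?_, fun x hx => ?_⟩,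
      hΔ, ?_⟩
    · exact Set.indicator_nonneg (fun x hx => h0 x hx) x
    · exact Set.indicator_of_notMem hx γ
    · intro x hx y hy hxy
      rw [Set.indicator_of_mem hx, Set.indicator_of_mem hy]
      exact hm hx hy hxy
    · refine (hr x hx).congr_of_eventuallyEq ?_ (Set.indicator_of_mem hx γ)
      filter_upwards [Ico_mem_nhdsGE hx.2] with y hy
      exact Set.indicator_of_mem (s := Set.Ico (0 : ℝ) 1) ⟨hx.1.trans hy.1, hy.2⟩ γ
    · rw [densityMeasure, ← withDensity_indicator measurableSet_Ico]
      congr 2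
      funext x
      by_cases hx : x ∈ Set.Ico (0 : ℝ) 1 <;> simp [hx]
  · rintro ⟨γ, Δ, h, hΔ, rfl⟩
    refine ⟨γ, Δ, fun x _ => h.nonneg x, h.mono, h.right_cont, hΔ, ?_⟩
    rw [densityMeasure, ← withDensity_indicator measurableSet_Ico]
    congr 2
    funext x
    by_cases hx : x ∈ Set.Ico (0 : ℝ) 1
    · simp [hx]
    · simp [hx, h.eq_zero x hx]

/-! ### Tail masses -/

section tail

variable {γ γ' : ℝ → ℝ} {Δ Δ' : ℝ}

lemma continuous_tail (hi : Integrable γ) : Continuous (tail γ Δ) := by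
  have h := intervalIntegral.continuous_primitive (fun a b => hi.intervalIntegrable) (1 : ℝ)
  have e : tail γ Δ = fun x => Δ - ∫ s in (1 : ℝ)..x, γ s := by
    funext x; rw [tail, intervalIntegral.integral_symm]; ring
  rw [e]
  exact continuous_const.sub h

lemma IsDensity.le_tail (h : IsDensity γ) (x : ℝ) : Δ ≤ tail γ Δ x := by
  unfold tail
  rcases le_total x 1 with hx | hx
  · have := intervalIntegral.integral_nonneg (μ := volume) hx (fun u _ => h.nonneg u)
    linarith
  · have : ∫ s in x..1, γ s = 0 := by
      rw [intervalIntegral.integral_symm, neg_eq_zero]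
      rw [intervalIntegral.integral_of_le hx]
      refine setIntegral_eq_zero_of_forall_eq_zero fun y hy => h.eq_zero y fun hy' => ?_
      exact absurd hy.1 (not_lt.2 hy'.2.le)
    rw [this]; linarith

lemma tail_sub (hi : Integrable γ) (x y : ℝ) :
    tail γ Δ x - tail γ Δ y = ∫ s in x..y, γ s := by
  rw [tail, tail, ← intervalIntegral.integral_add_adjacent_intervals
    (hi.intervalIntegrable (a := x) (b := y)) (hi.intervalIntegrable (b := 1))]
  ring

lemma tail_one : tail γ Δ 1 = Δ := by simp [tail]

lemma continuous_inv_tail_sq (h : IsDensity γ) (hi : Integrable γ) (hΔ : 0 < Δ) :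
    Continuous (fun x => ((tail γ Δ x) ^ 2)⁻¹) :=
  ((continuous_tail hi).pow 2).inv₀ fun x => by exact (pow_pos (hΔ.trans_le (h.le_tail x)) 2).ne'

lemma continuous_inv_tail (h : IsDensity γ) (hi : Integrable γ) (hΔ : 0 < Δ) :
    Continuous (fun x => (tail γ Δ x)⁻¹) :=
  (continuous_tail hi).inv₀ fun x => (hΔ.trans_le (h.le_tail x)).ne'

lemma IsDensity.aemeasurable (h : IsDensity γ) : AEMeasurable γ := by
  have h1 : AEMeasurable γ (volume.restrict (Set.Ico 0 1)) :=
    aemeasurable_restrict_of_monotoneOn measurableSet_Ico h.mono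
  have e : γ = (Set.Ico (0 : ℝ) 1).indicator γ := by
    funext x
    by_cases hx : x ∈ Set.Ico (0 : ℝ) 1
    · simp [hx]
    · simp [hx, h.eq_zero x hx]
  rw [e]
  exact (aemeasurable_indicator_iff measurableSet_Ico).2 h1

lemma densityMeasure_Ioc (h : IsDensity γ) (hi : Integrable γ) (hΔ : 0 < Δ) {x : ℝ}
    (hx : x < 1) : densityMeasure γ Δ (Set.Ioc x 1) = ENNReal.ofReal (tail γ Δ x) := by
  have h1 : (1 : ℝ) ∈ Set.Ioc x 1 := ⟨hx, le_rfl⟩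
  rw [densityMeasure, Measure.add_apply, Measure.smul_apply, Measure.dirac_apply_of_mem h1,
    withDensity_apply _ measurableSet_Ioc, ← ofReal_integral_eq_lintegral_ofReal hi.integrableOn
      (Filter.Eventually.of_forall h.nonneg), ← intervalIntegral.integral_of_le hx.le, smul_eq_mul,
    mul_one, ← ENNReal.ofReal_add _ hΔ.le, tail, add_comm]
  exact intervalIntegral.integral_nonneg hx.le (fun u _ => h.nonneg u)

end tail

/-! ### Real form of the functional, and integrability of the density -/

section functional

variable {n : ℕ} {ξ γ γ' : ℝ → ℝ} {Δ Δ' : ℝ} (hξ : IsMixture n ξ)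
include hξ

lemma IsMixture.continuous_deriv : Continuous (deriv ξ) :=
  continuous_iff_continuousAt.2 fun x => (hξ.hasDerivAt₁ x).continuousAt

lemma lintegral_deriv_densityMeasure (h : IsDensity γ) :
    ∫⁻ x in Set.Icc (0 : ℝ) 1, ENNReal.ofReal (deriv ξ x) ∂(densityMeasure γ Δ) =
      (∫⁻ x in Set.Ioc (0 : ℝ) 1, ENNReal.ofReal (deriv ξ x * γ x)) +
        ENNReal.ofReal Δ * ENNReal.ofReal (deriv ξ 1) := by
  have hm : Measurable (fun x => ENNReal.ofReal (deriv ξ x)) :=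
    hξ.continuous_deriv.measurable.ennreal_ofReal
  rw [densityMeasure, Measure.restrict_add, Measure.restrict_smul, lintegral_add_measure,
    lintegral_smul_measure, setLIntegral_withDensity_eq_setLIntegral_mul_non_measurable₀' _ _
      h.aemeasurable.ennreal_ofReal.restrict _
      (Filter.Eventually.of_forall fun _ => ENNReal.ofReal_lt_top)]
  congr 1
  · rw [restrict_Ioc_eq_restrict_Icc]
    refine setLIntegral_congr_fun measurableSet_Icc fun x _ => ?_
    rw [Pi.mul_apply, mul_comm, ENNReal.ofReal_mul' (h.nonneg x)]
  · classical
    rw [restrict_dirac, if_pos (by simp), lintegral_dirac' _ hm, smul_eq_mul]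

lemma crisantiSommers_eq (h : IsDensity γ) (hi : Integrable γ) (hΔ : 0 < Δ) :
    crisantiSommers ξ (densityMeasure γ Δ) = 2⁻¹ * ENNReal.ofReal (csReal ξ γ Δ) := by
  have h1 : 0 ≤ deriv ξ 1 := hξ.deriv_nonneg zero_le_one
  have i1 : IntervalIntegrable (fun x => deriv ξ x * γ x) volume 0 1 :=
    hi.intervalIntegrable.continuousOn_mul hξ.continuous_deriv.continuousOn
  have n1 : 0 ≤ ∫ x in (0 : ℝ)..1, deriv ξ x * γ x :=
    intervalIntegral.integral_nonneg zero_le_one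
      fun x hx => mul_nonneg (hξ.deriv_nonneg hx.1) (h.nonneg x)
  have n2 : 0 ≤ ∫ x in (0 : ℝ)..1, (tail γ Δ x)⁻¹ :=
    intervalIntegral.integral_nonneg zero_le_one
      fun x _ => inv_nonneg.2 (hΔ.le.trans (h.le_tail x))
  rw [crisantiSommers, lintegral_deriv_densityMeasure hξ h, csReal,
    ENNReal.ofReal_add (by positivity) n2, ENNReal.ofReal_add n1 (by positivity),
    ENNReal.ofReal_mul hΔ.le]
  congr 3
  · rw [intervalIntegral.integral_of_le zero_le_one, ofReal_integral_eq_lintegral_ofReal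
      ((intervalIntegrable_iff_integrableOn_Ioc_of_le zero_le_one).1 i1)]
    filter_upwards [ae_restrict_mem measurableSet_Ioc] with x hx
    exact mul_nonneg (hξ.deriv_nonneg hx.1.le) (h.nonneg x)
  -- The endpoint `1` is removed first: there `ν((x, 1])` is the mass of the empty set, not `Δ`.
  · rw [intervalIntegral.integral_of_le zero_le_one, ofReal_integral_eq_lintegral_ofReal
      ((intervalIntegrable_iff_integrableOn_Ioc_of_le zero_le_one).1
        ((continuous_inv_tail h hi hΔ).intervalIntegrable _ _))
      (Filter.Eventually.of_forall fun x => inv_nonneg.2 (hΔ.le.trans (h.le_tail x))),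
      restrict_Ioc_eq_restrict_Icc, ← restrict_Ico_eq_restrict_Icc]
    refine setLIntegral_congr_fun measurableSet_Ico fun x hx => ?_
    rw [densityMeasure_Ioc h hi hΔ hx.2, ENNReal.ofReal_inv_of_pos (hΔ.trans_le (h.le_tail x))]

lemma csReal_nonneg (h : IsDensity γ) (hΔ : 0 < Δ) : 0 ≤ csReal ξ γ Δ := by
  have n1 : 0 ≤ ∫ x in (0 : ℝ)..1, deriv ξ x * γ x :=
    intervalIntegral.integral_nonneg zero_le_one
      fun x hx => mul_nonneg (hξ.deriv_nonneg hx.1) (h.nonneg x)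
  have n2 : 0 ≤ ∫ x in (0 : ℝ)..1, (tail γ Δ x)⁻¹ :=
    intervalIntegral.integral_nonneg zero_le_one
      fun x _ => inv_nonneg.2 (hΔ.le.trans (h.le_tail x))
  have h1 : 0 ≤ deriv ξ 1 := hξ.deriv_nonneg zero_le_one
  unfold csReal
  positivity

/-- A density for which the functional is finite is integrable. -/
lemma integrable_of_crisantiSommers_ne_top (h : IsDensity γ)
    (hQ : crisantiSommers ξ (densityMeasure γ Δ) ≠ ⊤) : Integrable γ := by
  have hfin : ∫⁻ x in Set.Ioc (0 : ℝ) 1, ENNReal.ofReal (deriv ξ x * γ x) ≠ ⊤ := by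
    intro htop
    apply hQ
    rw [crisantiSommers, lintegral_deriv_densityMeasure hξ h, htop, top_add, top_add]
    exact ENNReal.mul_top (by simp)
  have hd : 0 < deriv ξ (1 / 2) := by
    have := hξ.deriv_lt le_rfl (show (0 : ℝ) < 1 / 2 by norm_num)
    rwa [hξ.deriv_zero] at this
  have e : γ = (Set.Ico (0 : ℝ) 1).indicator γ := by
    funext x
    by_cases hx : x ∈ Set.Ico (0 : ℝ) 1
    · simp [hx]
    · simp [hx, h.eq_zero x hx]
  rw [e, integrable_indicator_iff measurableSet_Ico]
  -- `ξ'` degenerates at `0`, so the left half is bounded by monotonicity of `γ` and the right half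
  -- by `ξ' ≥ ξ'(1/2)`.
  have hdom : Integrable (fun x => γ (1 / 2) + (deriv ξ (1 / 2))⁻¹ * (deriv ξ x * γ x))
      (volume.restrict (Set.Ico (0 : ℝ) 1)) := by
    refine (integrable_const _).add (Integrable.const_mul ⟨?_, ?_⟩ _)
    · exact (hξ.continuous_deriv.aemeasurable.mul h.aemeasurable).aestronglyMeasurable.restrict
    · rw [hasFiniteIntegral_iff_ofReal]
      · rw [restrict_Ico_eq_restrict_Ioc]; exact hfin.lt_top
      · filter_upwards [ae_restrict_mem measurableSet_Ico] with x hx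
        exact mul_nonneg (hξ.deriv_nonneg hx.1) (h.nonneg x)
  refine hdom.mono' h.aemeasurable.aestronglyMeasurable.restrict ?_
  filter_upwards [ae_restrict_mem measurableSet_Ico] with x hx
  rw [Real.norm_of_nonneg (h.nonneg x)]
  have hg := h.nonneg x
  rcases le_total x (1 / 2) with hx2 | hx2
  · have h1 := h.mono hx ⟨by norm_num, by norm_num⟩ hx2
    have h2 : 0 ≤ (deriv ξ (1 / 2))⁻¹ * (deriv ξ x * γ x) :=
      mul_nonneg (inv_nonneg.2 hd.le) (mul_nonneg (hξ.deriv_nonneg hx.1) hg)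
    linarith
  · have h1 : deriv ξ (1 / 2) ≤ deriv ξ x :=
      hξ.strictMonoOn_deriv.monotoneOn (by norm_num : (0 : ℝ) ≤ 1 / 2) hx.1 hx2
    have h2 : γ x ≤ (deriv ξ (1 / 2))⁻¹ * (deriv ξ x * γ x) := by
      rw [← mul_assoc]
      refine le_mul_of_one_le_left hg ?_
      rw [inv_mul_eq_div, one_le_div hd]; exact h1
    have := h.nonneg (1 / 2)
    linarith

end functional

/-- Fubini on the triangle `x < s`. -/
lemma integral_mul_integral {k c : ℝ → ℝ} (hk : Continuous k) (hc : Integrable c) :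
    ∫ x in (0 : ℝ)..1, k x * ∫ s in x..1, c s =
      ∫ s in (0 : ℝ)..1, (∫ x in (0 : ℝ)..s, k x) * c s := by
  set μ := volume.restrict (Set.Ioc (0 : ℝ) 1) with hμ
  have hk' : Integrable k μ := (hk.integrableOn_Icc).mono_set Set.Ioc_subset_Icc_self
  have hm : MeasurableSet {p : ℝ × ℝ | p.1 < p.2} := measurableSet_lt measurable_fst measurable_snd
  have hint : Integrable (Function.uncurry fun x s => {p : ℝ × ℝ | p.1 < p.2}.indicator
      (fun p => k p.1 * c p.2) (x, s)) (μ.prod μ) :=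
    (hk'.mul_prod (hc.restrict (s := Set.Ioc 0 1))).indicator hm
  have hswap := integral_integral_swap hint
  rw [intervalIntegral.integral_of_le zero_le_one, intervalIntegral.integral_of_le zero_le_one]
  have e1 : ∀ x ∈ Set.Ioc (0 : ℝ) 1, ∫ s, {p : ℝ × ℝ | p.1 < p.2}.indicator
      (fun p => k p.1 * c p.2) (x, s) ∂μ = k x * ∫ s in x..1, c s := fun x hx => by
    rw [intervalIntegral.integral_of_le hx.2, ← integral_const_mul,
      ← integral_indicator measurableSet_Ioc, ← integral_indicator measurableSet_Ioc]
    congr 1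
    funext s
    by_cases h1 : x < s <;> by_cases h2 : s ≤ 1 <;>
      simp [Set.indicator, h1, h2, hx.1.trans]
  have e2 : ∀ s ∈ Set.Ioc (0 : ℝ) 1, ∫ x, {p : ℝ × ℝ | p.1 < p.2}.indicator
      (fun p => k p.1 * c p.2) (x, s) ∂μ = (∫ x in (0 : ℝ)..s, k x) * c s := fun s hs => by
    rw [intervalIntegral.integral_of_le hs.1.le, ← integral_mul_const]
    conv_rhs => rw [integral_Ioc_eq_integral_Ioo]
    rw [← integral_indicator measurableSet_Ioc, ← integral_indicator measurableSet_Ioo]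
    congr 1
    funext x
    by_cases h1 : x < s <;> by_cases h2 : 0 < x <;>
      simp [Set.indicator, h1, h2]
    intro h3; linarith [hs.2]
  rw [← setIntegral_congr_fun measurableSet_Ioc e1, ← setIntegral_congr_fun measurableSet_Ioc e2]
  exact hswap

/-! ### First variation of the functional -/

section variation

variable {n : ℕ} {ξ γ γ' : ℝ → ℝ} {Δ Δ' : ℝ}

lemma hasDerivAt_potential (hξ : IsMixture n ξ) (h : IsDensity γ) (hi : Integrable γ)
    (hΔ : 0 < Δ) (x : ℝ) :
    HasDerivAt (potential ξ γ Δ) (deriv (deriv ξ) x - ((tail γ Δ x) ^ 2)⁻¹) x :=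
  (hξ.hasDerivAt₁ x).sub ((continuous_inv_tail_sq h hi hΔ).integral_hasStrictDerivAt 0 x).hasDerivAt

lemma continuous_potential (hξ : IsMixture n ξ) (h : IsDensity γ) (hi : Integrable γ)
    (hΔ : 0 < Δ) : Continuous (potential ξ γ Δ) :=
  continuous_iff_continuousAt.2 fun x => (hasDerivAt_potential hξ h hi hΔ x).continuousAt

/-- Pointwise `1/b - 1/a = -(b - a)/a² + (b - a)²/(a² b)`, and exchanging the integrals in the
linear part produces the potential. The remainder is exact and nonnegative, so it serves minimality,
uniqueness and necessity alike. -/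
lemma csReal_sub (hξ : IsMixture n ξ) (h : IsDensity γ) (hi : Integrable γ) (hΔ : 0 < Δ)
    (h' : IsDensity γ') (hi' : Integrable γ') (hΔ' : 0 < Δ') :
    csReal ξ γ' Δ' - csReal ξ γ Δ =
      (∫ x in (0 : ℝ)..1, potential ξ γ Δ x * (γ' x - γ x)) + potential ξ γ Δ 1 * (Δ' - Δ) +
        ∫ x in (0 : ℝ)..1, (tail γ' Δ' x - tail γ Δ x) ^ 2 *
          ((tail γ Δ x ^ 2)⁻¹ * (tail γ' Δ' x)⁻¹) := by
  have ca := continuous_tail (Δ := Δ) hi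
  have cb := continuous_tail (Δ := Δ') hi'
  have ci := continuous_inv_tail_sq h hi hΔ
  have ci1 := continuous_inv_tail h hi hΔ
  have ci2 := continuous_inv_tail h' hi' hΔ'
  have hc : Integrable (fun x => γ' x - γ x) := hi'.sub hi
  have ccont : Continuous (fun s => ∫ x in (0 : ℝ)..s, ((tail γ Δ x) ^ 2)⁻¹) :=
    continuous_iff_continuousAt.2 fun x =>
      (ci.integral_hasStrictDerivAt 0 x).hasDerivAt.continuousAt
  have e1 : ∫ x in (0 : ℝ)..1, ((tail γ' Δ' x)⁻¹ - (tail γ Δ x)⁻¹) =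
      (∫ x in (0 : ℝ)..1, (tail γ' Δ' x - tail γ Δ x) ^ 2 *
          ((tail γ Δ x ^ 2)⁻¹ * (tail γ' Δ' x)⁻¹)) -
      ∫ x in (0 : ℝ)..1, ((tail γ Δ x) ^ 2)⁻¹ * (tail γ' Δ' x - tail γ Δ x) := by
    have j1 : IntervalIntegrable (fun x => (tail γ' Δ' x - tail γ Δ x) ^ 2 *
        ((tail γ Δ x ^ 2)⁻¹ * (tail γ' Δ' x)⁻¹)) volume 0 1 :=
      (((cb.sub ca).pow 2).mul (ci.mul ci2)).intervalIntegrable _ _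
    have j2 : IntervalIntegrable (fun x => ((tail γ Δ x) ^ 2)⁻¹ * (tail γ' Δ' x - tail γ Δ x))
        volume 0 1 := (ci.mul (cb.sub ca)).intervalIntegrable _ _
    rw [← intervalIntegral.integral_sub j1 j2]
    refine intervalIntegral.integral_congr fun x _ => ?_
    have pa := hΔ.trans_le (h.le_tail (Δ := Δ) x)
    have pb := hΔ'.trans_le (h'.le_tail (Δ := Δ') x)
    field_simp
    ring
  have e2 : ∫ x in (0 : ℝ)..1, ((tail γ Δ x) ^ 2)⁻¹ * (tail γ' Δ' x - tail γ Δ x) =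
      (∫ x in (0 : ℝ)..1, ((tail γ Δ x) ^ 2)⁻¹) * (Δ' - Δ) +
        ∫ s in (0 : ℝ)..1, (∫ x in (0 : ℝ)..s, ((tail γ Δ x) ^ 2)⁻¹) * (γ' s - γ s) := by
    rw [← integral_mul_integral ci hc, ← intervalIntegral.integral_mul_const,
      ← intervalIntegral.integral_add]
    · refine intervalIntegral.integral_congr fun x _ => ?_
      rw [intervalIntegral.integral_sub hi'.intervalIntegrable hi.intervalIntegrable, tail, tail]
      ring
    · exact (ci.mul continuous_const).intervalIntegrable _ _
    · refine (ci.mul ?_).intervalIntegrable _ _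
      have e : (fun x => ∫ s in x..1, (γ' s - γ s)) = tail (fun x => γ' x - γ x) 0 := by
        funext x
        rw [tail, zero_add]
      rw [e]
      exact continuous_tail hc
  have e3 : ∫ x in (0 : ℝ)..1, potential ξ γ Δ x * (γ' x - γ x) =
      (∫ x in (0 : ℝ)..1, deriv ξ x * γ' x) - (∫ x in (0 : ℝ)..1, deriv ξ x * γ x) -
      ∫ s in (0 : ℝ)..1, (∫ x in (0 : ℝ)..s, ((tail γ Δ x) ^ 2)⁻¹) * (γ' s - γ s) := by
    have j1 : IntervalIntegrable (fun x => deriv ξ x * γ' x) volume 0 1 :=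
      hi'.intervalIntegrable.continuousOn_mul hξ.continuous_deriv.continuousOn
    have j2 : IntervalIntegrable (fun x => deriv ξ x * γ x) volume 0 1 :=
      hi.intervalIntegrable.continuousOn_mul hξ.continuous_deriv.continuousOn
    have j3 : IntervalIntegrable
        (fun s => (∫ x in (0 : ℝ)..s, ((tail γ Δ x) ^ 2)⁻¹) * (γ' s - γ s)) volume 0 1 :=
      hc.intervalIntegrable.continuousOn_mul ccont.continuousOn
    rw [← intervalIntegral.integral_sub j1 j2, ← intervalIntegral.integral_sub (j1.sub j2) j3]
    refine intervalIntegral.integral_congr fun x _ => ?_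
    simp only [potential]
    ring
  have e4 : (∫ x in (0 : ℝ)..1, (tail γ' Δ' x)⁻¹) - ∫ x in (0 : ℝ)..1, (tail γ Δ x)⁻¹ =
      ∫ x in (0 : ℝ)..1, ((tail γ' Δ' x)⁻¹ - (tail γ Δ x)⁻¹) :=
    (intervalIntegral.integral_sub (ci2.intervalIntegrable _ _) (ci1.intervalIntegrable _ _)).symm
  rw [e1, e2] at e4
  rw [e3]
  unfold csReal
  rw [show potential ξ γ Δ 1 = deriv ξ 1 - ∫ x in (0 : ℝ)..1, ((tail γ Δ x) ^ 2)⁻¹ from rfl]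
  linarith

/-- `u` separates the points where `c` is at most some level from those where it is larger. -/
def IsSplit (c : ℝ → ℝ) (u : ℝ) : Prop :=
  ∃ s, 0 ≤ s ∧ (∀ x ∈ Set.Ico (0 : ℝ) 1, x < u → c x ≤ s) ∧
    ∀ x ∈ Set.Ico (0 : ℝ) 1, u < x → s < c x

lemma IsDensity.exists_isSplit {c : ℝ → ℝ} (hc : IsDensity c) {s : ℝ} (hs : 0 ≤ s) :
    ∃ u ∈ Set.Icc (0 : ℝ) 1, (IsSplit c u) ∧ {x | s < c x} =ᵐ[volume] Set.Ioc u 1 := by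
  -- The point `1` is added so that the infimum is the right one when the level is never exceeded.
  set S : Set ℝ := {x | x ∈ Set.Ico (0 : ℝ) 1 ∧ s < c x} ∪ {1} with hS
  have hne : S.Nonempty := ⟨1, Or.inr rfl⟩
  have hbdd : BddBelow S := ⟨0, by
    rintro x (hx | hx)
    · exact hx.1.1
    · rw [hx]; exact zero_le_one⟩
  have h0 : 0 ≤ sInf S := le_csInf hne (by
    rintro x (hx | hx)
    · exact hx.1.1
    · rw [hx]; exact zero_le_one)
  have h1 : sInf S ≤ 1 := csInf_le hbdd (Or.inr rfl)
  have a1 : ∀ x ∈ Set.Ico (0 : ℝ) 1, x < sInf S → c x ≤ s := fun x hx hxu => by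
    by_contra! h
    exact absurd (csInf_le hbdd (Or.inl ⟨hx, h⟩)) (not_le.2 hxu)
  have a2 : ∀ x ∈ Set.Ico (0 : ℝ) 1, sInf S < x → s < c x := fun x hx hxu => by
    obtain ⟨y, hy, hyx⟩ := exists_lt_of_csInf_lt hne hxu
    rcases hy with hy | hy
    · exact hy.2.trans_le (hc.mono hy.1 hx hyx.le)
    · rw [hy] at hyx; exact absurd hyx (not_lt.2 hx.2.le)
  refine ⟨sInf S, ⟨h0, h1⟩, ⟨s, hs, a1, a2⟩, ?_⟩
  have hnull : ({sInf S, 1} : Set ℝ).Finite := Set.toFinite _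
  filter_upwards [hnull.measure_zero volume |> compl_mem_ae_iff.2] with x hx
  simp only [Set.mem_compl_iff, Set.mem_insert_iff, Set.mem_singleton_iff, not_or] at hx
  apply propext
  constructor
  · intro h
    have hx' : x ∈ Set.Ico (0 : ℝ) 1 := by
      by_contra h'
      have h2 : s < c x := h
      rw [hc.eq_zero x h'] at h2; linarith
    refine ⟨lt_of_le_of_ne (csInf_le hbdd (Or.inl ⟨hx', h⟩)) (Ne.symm hx.1), hx'.2.le⟩
  · intro h
    exact a2 x ⟨h0.trans h.1.le, lt_of_le_of_ne h.2 hx.2⟩ h.1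

/-- The layer cake inequality: the integral of `F c` is nonnegative when `F` has nonnegative
integrals over the upper level sets of the monotone function `c`. -/
lemma integral_mul_nonneg {F c : ℝ → ℝ} (hF : Continuous F) (hc : IsDensity c)
    (hi : Integrable c)
    (hg : ∀ u ∈ Set.Icc (0 : ℝ) 1, IsSplit c u → 0 ≤ ∫ x in u..1, F x) :
    0 ≤ ∫ x in (0 : ℝ)..1, F x * c x := by
  set μ := volume.restrict (Set.Ioc (0 : ℝ) 1) with hμ
  have hFi : Integrable F μ := hF.integrableOn_Icc.mono_set Set.Ioc_subset_Icc_self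
  -- The layer cake formula is for positive measures, so it is applied with the positive and the
  -- negative part of `F` as densities.
  have hlay : ∀ G : ℝ → ℝ, Continuous G →
      ∫⁻ x, ENNReal.ofReal (G x * c x) ∂μ =
        ∫⁻ s in Set.Ioi 0, (μ.withDensity fun x => ENNReal.ofReal (G x)) {x | s < c x} := by
    intro G hG
    have hGm : Measurable (fun x => ENNReal.ofReal (G x)) := hG.measurable.ennreal_ofReal
    rw [← lintegral_eq_lintegral_meas_lt _ (Filter.Eventually.of_forall hc.nonneg)
      ((hc.aemeasurable.restrict).mono_ac (withDensity_absolutelyContinuous _ _)),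
      lintegral_withDensity_eq_lintegral_mul₀ hGm.aemeasurable hc.aemeasurable.ennreal_ofReal.restrict]
    refine lintegral_congr fun x => ?_
    rw [Pi.mul_apply, ENNReal.ofReal_mul' (hc.nonneg x)]
  have hle : ∀ s ∈ Set.Ioi (0 : ℝ),
      (μ.withDensity fun x => ENNReal.ofReal (-F x)) {x | s < c x} ≤
        (μ.withDensity fun x => ENNReal.ofReal (F x)) {x | s < c x} := by
    intro s hs
    obtain ⟨u, hu, hsp, hae⟩ := hc.exists_isSplit (le_of_lt hs)
    have hae' : {x | s < c x} =ᵐ[μ] Set.Ioc u 1 := ae_restrict_of_ae hae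
    rw [measure_congr ((withDensity_absolutelyContinuous μ _).ae_le hae'),
      measure_congr ((withDensity_absolutelyContinuous μ _).ae_le hae'),
      withDensity_apply _ measurableSet_Ioc, withDensity_apply _ measurableSet_Ioc]
    have h1 := hg u hu hsp
    have hsub : μ.restrict (Set.Ioc u 1) = volume.restrict (Set.Ioc u 1) := by
      rw [hμ, Measure.restrict_restrict measurableSet_Ioc,
        Set.inter_eq_left.2 (Set.Ioc_subset_Ioc_left hu.1)]
    rw [hsub]
    have hFi' : Integrable F (volume.restrict (Set.Ioc u 1)) :=
      hF.integrableOn_Icc.mono_set Set.Ioc_subset_Icc_self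
    rw [intervalIntegral.integral_of_le hu.2,
      integral_eq_lintegral_pos_part_sub_lintegral_neg_part hFi', sub_nonneg] at h1
    refine (ENNReal.toReal_le_toReal ?_ ?_).1 h1
    · exact (hFi'.neg.lintegral_lt_top).ne
    · exact (hFi'.lintegral_lt_top).ne
  have hFc : IntervalIntegrable (fun x => F x * c x) volume 0 1 :=
    hi.intervalIntegrable.continuousOn_mul hF.continuousOn
  have hFc' : Integrable (fun x => F x * c x) μ :=
    (intervalIntegrable_iff_integrableOn_Ioc_of_le zero_le_one).1 hFc
  rw [intervalIntegral.integral_of_le zero_le_one,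
    integral_eq_lintegral_pos_part_sub_lintegral_neg_part hFc', sub_nonneg]
  refine ENNReal.toReal_mono hFc'.lintegral_lt_top.ne ?_
  rw [hlay F hF]
  have := hlay (fun x => -F x) hF.neg
  simp only [neg_mul] at this
  rw [this]
  exact setLIntegral_mono' measurableSet_Ioi hle

lemma IsDensity.integral_eq_zero_left (h : IsDensity γ) {x : ℝ} (hx : x ≤ 0) :
    ∫ s in x..0, γ s = 0 := by
  rw [intervalIntegral.integral_of_le hx, integral_Ioc_eq_integral_Ioo]
  exact setIntegral_eq_zero_of_forall_eq_zero fun y hy => h.eq_zero y fun hy' =>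
    absurd hy.2 (not_lt.2 hy'.1)

lemma IsDensity.integral_eq_zero_right (h : IsDensity γ) {x : ℝ} (hx : 1 ≤ x) :
    ∫ s in x..1, γ s = 0 := by
  rw [intervalIntegral.integral_symm, neg_eq_zero, intervalIntegral.integral_of_le hx]
  exact setIntegral_eq_zero_of_forall_eq_zero fun y hy => h.eq_zero y fun hy' =>
    absurd hy.1 (not_lt.2 hy'.2.le)

lemma densityMeasure_eq_of_tail_eq (h : IsDensity γ) (hi : Integrable γ) (h' : IsDensity γ')
    (hi' : Integrable γ') (ht : ∀ x ∈ Set.Icc (0 : ℝ) 1, tail γ Δ x = tail γ' Δ' x) :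
    densityMeasure γ Δ = densityMeasure γ' Δ' := by
  have h1 := ht 1 ⟨zero_le_one, le_rfl⟩
  rw [tail_one, tail_one] at h1
  subst h1
  have hall : ∀ x, tail γ Δ x = tail γ' Δ x := fun x => by
    rcases lt_or_ge x 0 with hx | hx
    · have a := tail_sub (Δ := Δ) hi x 0
      have b := tail_sub (Δ := Δ) hi' x 0
      rw [h.integral_eq_zero_left hx.le] at a
      rw [h'.integral_eq_zero_left hx.le] at b
      have := ht 0 ⟨le_rfl, zero_le_one⟩
      linarith
    · rcases le_or_gt x 1 with hx1 | hx1
      · exact ht x ⟨hx, hx1⟩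
      · rw [tail, tail, h.integral_eq_zero_right hx1.le, h'.integral_eq_zero_right hx1.le]
  unfold densityMeasure
  congr 1
  have f1 : IsFiniteMeasure (volume.withDensity fun x => ENNReal.ofReal (γ x)) :=
    isFiniteMeasure_withDensity_ofReal hi.2
  refine Measure.ext_of_Ioc _ _ fun a b hab => ?_
  rw [withDensity_apply _ measurableSet_Ioc, withDensity_apply _ measurableSet_Ioc,
    ← ofReal_integral_eq_lintegral_ofReal hi.integrableOn (Filter.Eventually.of_forall h.nonneg),
    ← ofReal_integral_eq_lintegral_ofReal hi'.integrableOn (Filter.Eventually.of_forall h'.nonneg),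
    ← intervalIntegral.integral_of_le hab.le, ← intervalIntegral.integral_of_le hab.le,
    ← tail_sub (Δ := Δ) hi, ← tail_sub (Δ := Δ) hi', hall, hall]

/-- The first order conditions are sufficient, and they determine the minimizer. -/
theorem isParisiMeasure_of_potential (hξ : IsMixture n ξ) (h : IsDensity γ) (hi : Integrable γ)
    (hΔ : 0 < Δ) (h1 : potential ξ γ Δ 1 = 0)
    (hg : ∀ u ∈ Set.Icc (0 : ℝ) 1, 0 ≤ ∫ x in u..1, potential ξ γ Δ x)
    (hs : ∀ u ∈ Set.Icc (0 : ℝ) 1, IsSplit γ u → ∫ x in u..1, potential ξ γ Δ x = 0) :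
    IsParisiMeasure ξ (densityMeasure γ Δ) ∧
      ∀ ν, IsParisiMeasure ξ ν → ν = densityMeasure γ Δ := by
  have hF := continuous_potential hξ h hi hΔ
  have hmem : densityMeasure γ Δ ∈ measureClass :=
    mem_measureClass_iff.2 ⟨γ, Δ, h, hΔ, rfl⟩
  -- For `γ` itself the relevant tail integrals vanish, so the layer cake inequality also applies to
  -- the negated potential.
  have hzero : ∫ x in (0 : ℝ)..1, potential ξ γ Δ x * γ x ≤ 0 := by
    have := integral_mul_nonneg (F := fun x => -potential ξ γ Δ x) hF.neg h hi fun u hu hsp => by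
      rw [intervalIntegral.integral_neg, hs u hu hsp, neg_zero]
    simp only [neg_mul, intervalIntegral.integral_neg, Left.nonneg_neg_iff] at this
    exact this
  have hrem : ∀ γ' Δ', IsDensity γ' → Integrable γ' → 0 < Δ' →
      ∫ x in (0 : ℝ)..1, (tail γ' Δ' x - tail γ Δ x) ^ 2 *
          ((tail γ Δ x ^ 2)⁻¹ * (tail γ' Δ' x)⁻¹) ≤ csReal ξ γ' Δ' - csReal ξ γ Δ := by
    intro γ' Δ' h' hi' hΔ'
    rw [csReal_sub hξ h hi hΔ h' hi' hΔ', h1, zero_mul, add_zero]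
    have a := integral_mul_nonneg hF h' hi' fun u hu _ => hg u hu
    have e : ∫ x in (0 : ℝ)..1, potential ξ γ Δ x * (γ' x - γ x) =
        (∫ x in (0 : ℝ)..1, potential ξ γ Δ x * γ' x) -
          ∫ x in (0 : ℝ)..1, potential ξ γ Δ x * γ x := by
      rw [← intervalIntegral.integral_sub
        (hi'.intervalIntegrable.continuousOn_mul hF.continuousOn)
        (hi.intervalIntegrable.continuousOn_mul hF.continuousOn)]
      exact intervalIntegral.integral_congr fun x _ => by ring
    rw [e]
    linarith
  have hrem0 : ∀ γ' Δ', IsDensity γ' → 0 < Δ' → ∀ x, 0 ≤ (tail γ' Δ' x - tail γ Δ x) ^ 2 *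
      ((tail γ Δ x ^ 2)⁻¹ * (tail γ' Δ' x)⁻¹) := fun γ' Δ' h' hΔ' x => by
    have := hΔ'.trans_le (h'.le_tail (Δ := Δ') x)
    positivity
  have hQ := crisantiSommers_eq hξ h hi hΔ
  have hmin : ∀ ν' ∈ measureClass,
      crisantiSommers ξ (densityMeasure γ Δ) ≤ crisantiSommers ξ ν' := by
    intro ν' hν'
    obtain ⟨γ', Δ', h', hΔ', rfl⟩ := mem_measureClass_iff.1 hν'
    by_cases htop : crisantiSommers ξ (densityMeasure γ' Δ') = ⊤
    · rw [htop]; exact le_top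
    have hi' := integrable_of_crisantiSommers_ne_top hξ h' htop
    rw [hQ, crisantiSommers_eq hξ h' hi' hΔ']
    gcongr
    have a := hrem γ' Δ' h' hi' hΔ'
    have b := intervalIntegral.integral_nonneg (μ := volume) (zero_le_one (α := ℝ))
      fun u _ => hrem0 γ' Δ' h' hΔ' u
    linarith
  refine ⟨⟨hmem, hmin⟩, fun ν hν => ?_⟩
  obtain ⟨γ', Δ', h', hΔ', rfl⟩ := mem_measureClass_iff.1 hν.1
  have hle := hν.2 _ hmem
  have htop : crisantiSommers ξ (densityMeasure γ' Δ') ≠ ⊤ := by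
    refine (hle.trans_lt ?_).ne
    rw [hQ]
    exact ENNReal.mul_lt_top (by simp) ENNReal.ofReal_lt_top
  have hi' := integrable_of_crisantiSommers_ne_top hξ h' htop
  rw [hQ, crisantiSommers_eq hξ h' hi' hΔ',
    ENNReal.mul_le_mul_iff_right (by simp) (by simp),
    ENNReal.ofReal_le_ofReal_iff (csReal_nonneg hξ h hΔ)] at hle
  have a := hrem γ' Δ' h' hi' hΔ'
  -- For a second minimizer the integral of the remainder is at most zero, while its integrand is
  -- continuous and nonnegative; so the tails agree.
  refine densityMeasure_eq_of_tail_eq h' hi' h hi fun x hx => ?_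
  by_contra hne
  have hpos := intervalIntegral.integral_pos (zero_lt_one (α := ℝ))
    ((((continuous_tail hi').sub (continuous_tail hi)).pow 2).mul
      ((continuous_inv_tail_sq h hi hΔ).mul (continuous_inv_tail h' hi' hΔ'))).continuousOn
    (fun x _ => hrem0 γ' Δ' h' hΔ' x) ⟨x, hx, show 0 < (tail γ' Δ' x - tail γ Δ x) ^ 2 *
      ((tail γ Δ x ^ 2)⁻¹ * (tail γ' Δ' x)⁻¹) by
      have p1 := hΔ.trans_le (h.le_tail (Δ := Δ) x)
      have p2 := hΔ'.trans_le (h'.le_tail (Δ := Δ') x)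
      have p3 : 0 < (tail γ' Δ' x - tail γ Δ x) ^ 2 := by
        exact (sq_nonneg _).lt_of_ne' (pow_ne_zero 2 (sub_ne_zero.2 hne))
      positivity⟩
  exact absurd (hpos.trans_le a) (not_lt.2 (by linarith))

/-! ### Necessity of the first order conditions -/

lemma isDensity_zero : IsDensity (fun _ => 0) :=
  ⟨fun _ => le_rfl, fun _ _ => rfl, fun _ _ _ _ _ => le_rfl, fun _ _ => continuousWithinAt_const⟩

lemma IsDensity.convex (h : IsDensity γ) (h' : IsDensity γ') {η : ℝ} (h0 : 0 ≤ η) (h1 : η ≤ 1) :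
    IsDensity (fun x => γ x + η * (γ' x - γ x)) := by
  have e : ∀ x, γ x + η * (γ' x - γ x) = (1 - η) * γ x + η * γ' x := fun x => by ring
  have h1' : 0 ≤ 1 - η := by linarith
  refine ⟨fun x => ?_, fun x hx => ?_, fun x hx y hy hxy => ?_, fun x hx => ?_⟩
  · rw [e]
    have := h.nonneg x
    have := h'.nonneg x
    positivity
  · rw [h.eq_zero x hx, h'.eq_zero x hx]; simp
  · simp only [e]
    have := h.mono hx hy hxy
    have := h'.mono hx hy hxy
    gcongr
  · exact (h.right_cont x hx).add
      (((h'.right_cont x hx).sub (h.right_cont x hx)).const_smul η)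

/-- The competitor `δ_1` has a finite value. -/
lemma IsParisiMeasure.integrable (hξ : IsMixture n ξ)
    (hP : IsParisiMeasure ξ (densityMeasure γ Δ)) (h : IsDensity γ) : Integrable γ := by
  refine integrable_of_crisantiSommers_ne_top hξ h (Δ := Δ) ?_
  have := hP.2 _ (mem_measureClass_iff.2 ⟨_, 1, isDensity_zero, one_pos, rfl⟩)
  refine (this.trans_lt ?_).ne
  rw [crisantiSommers_eq hξ isDensity_zero (integrable_zero _ _ _) one_pos]
  exact ENNReal.mul_lt_top (by simp) ENNReal.ofReal_lt_top

/-- Along the segment to a competitor the functional changes by at most `η J + η² M`. The bound on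
the remainder is uniform in `η` because all tails stay above `min Δ Δ'`. -/
lemma IsParisiMeasure.variation_nonneg (hξ : IsMixture n ξ)
    (hP : IsParisiMeasure ξ (densityMeasure γ Δ)) (h : IsDensity γ) (hΔ : 0 < Δ)
    (h' : IsDensity γ') (hi' : Integrable γ') (hΔ' : 0 < Δ') :
    0 ≤ (∫ x in (0 : ℝ)..1, potential ξ γ Δ x * (γ' x - γ x)) +
      potential ξ γ Δ 1 * (Δ' - Δ) := by
  have hi := hP.integrable hξ h
  set J := (∫ x in (0 : ℝ)..1, potential ξ γ Δ x * (γ' x - γ x)) +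
      potential ξ γ Δ 1 * (Δ' - Δ) with hJ
  set d := min Δ Δ' with hd
  have hdpos : 0 < d := lt_min hΔ hΔ'
  have ca := continuous_tail (Δ := Δ) hi
  have cb := continuous_tail (Δ := Δ') hi'
  have ci := continuous_inv_tail_sq h hi hΔ
  set M := ∫ x in (0 : ℝ)..1, (tail γ' Δ' x - tail γ Δ x) ^ 2 * ((tail γ Δ x ^ 2)⁻¹ * d⁻¹) with hM
  have hM0 : 0 ≤ M := intervalIntegral.integral_nonneg zero_le_one fun x _ => by positivity
  have key : ∀ η, 0 < η → η ≤ 1 → 0 ≤ J + η * M := by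
    intro η h0 h1
    have hη := h.convex h' h0.le h1
    have hiη : Integrable (fun x => γ x + η * (γ' x - γ x)) :=
      hi.add ((hi'.sub hi).const_mul η)
    have hΔη : 0 < Δ + η * (Δ' - Δ) := by
      have : Δ + η * (Δ' - Δ) = (1 - η) * Δ + η * Δ' := by ring
      rw [this]
      have : 0 ≤ (1 - η) * Δ := mul_nonneg (by linarith) hΔ.le
      positivity
    have htail : ∀ x, tail (fun x => γ x + η * (γ' x - γ x)) (Δ + η * (Δ' - Δ)) x =
        tail γ Δ x + η * (tail γ' Δ' x - tail γ Δ x) := fun x => by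
      have j : IntervalIntegrable (fun s => η * (γ' s - γ s)) volume x 1 :=
        ((hi'.sub hi).const_mul η).intervalIntegrable
      unfold tail
      rw [intervalIntegral.integral_add hi.intervalIntegrable j,
        intervalIntegral.integral_const_mul,
        intervalIntegral.integral_sub hi'.intervalIntegrable hi.intervalIntegrable]
      ring
    have hle := hP.2 _ (mem_measureClass_iff.2 ⟨_, _, hη, hΔη, rfl⟩)
    rw [crisantiSommers_eq hξ h hi hΔ, crisantiSommers_eq hξ hη hiη hΔη,
      ENNReal.mul_le_mul_iff_right (by simp) (by simp),
      ENNReal.ofReal_le_ofReal_iff (csReal_nonneg hξ hη hΔη)] at hle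
    have hsub := csReal_sub hξ h hi hΔ hη hiη hΔη
    have e1 : ∫ x in (0 : ℝ)..1, potential ξ γ Δ x * (γ x + η * (γ' x - γ x) - γ x) =
        η * ∫ x in (0 : ℝ)..1, potential ξ γ Δ x * (γ' x - γ x) := by
      rw [← intervalIntegral.integral_const_mul]
      exact intervalIntegral.integral_congr fun x _ => by ring
    have e2 : ∫ x in (0 : ℝ)..1,
        (tail (fun x => γ x + η * (γ' x - γ x)) (Δ + η * (Δ' - Δ)) x - tail γ Δ x) ^ 2 *
          ((tail γ Δ x ^ 2)⁻¹ *
            (tail (fun x => γ x + η * (γ' x - γ x)) (Δ + η * (Δ' - Δ)) x)⁻¹) ≤ η ^ 2 * M := by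
      rw [hM, ← intervalIntegral.integral_const_mul]
      refine intervalIntegral.integral_mono_on zero_le_one ?_ ?_ fun x _ => ?_
      · exact ((((continuous_tail hiη).sub ca).pow 2).mul
          (ci.mul (continuous_inv_tail hη hiη hΔη))).intervalIntegrable _ _
      · exact (continuous_const.mul (((cb.sub ca).pow 2).mul
          (ci.mul continuous_const))).intervalIntegrable _ _
      · have ha := h.le_tail (Δ := Δ) x
        have hb := h'.le_tail (Δ := Δ') x
        have hdle : d ≤ tail (fun x => γ x + η * (γ' x - γ x)) (Δ + η * (Δ' - Δ)) x := by
          rw [htail]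
          have a1 : d ≤ tail γ Δ x := (min_le_left _ _).trans ha
          have b1 : d ≤ tail γ' Δ' x := (min_le_right _ _).trans hb
          nlinarith
        have hinv := inv_anti₀ hdpos hdle
        have e3 : (tail (fun x => γ x + η * (γ' x - γ x)) (Δ + η * (Δ' - Δ)) x -
            tail γ Δ x) ^ 2 = η ^ 2 * (tail γ' Δ' x - tail γ Δ x) ^ 2 := by rw [htail]; ring
        rw [e3, mul_assoc]
        gcongr
    rw [e1] at hsub
    have h5 : 0 ≤ η * (J + η * M) := by
      rw [hJ]
      nlinarith
    exact nonneg_of_mul_nonneg_right h5 h0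
  by_contra! hneg
  have hη := key (min 1 (-J / (M + 1))) (lt_min one_pos (div_pos (by linarith) (by linarith)))
    (min_le_left _ _)
  have h6 : min 1 (-J / (M + 1)) * M ≤ -J / (M + 1) * M :=
    mul_le_mul_of_nonneg_right (min_le_right _ _) hM0
  have h7 : -J / (M + 1) * M < -J := by
    rw [div_mul_eq_mul_div, div_lt_iff₀ (by linarith)]
    nlinarith
  linarith

/-- Varying `Δ` alone, up to `2 Δ` and down to `Δ / 2`, gives both inequalities. -/
lemma IsParisiMeasure.potential_one (hξ : IsMixture n ξ)
    (hP : IsParisiMeasure ξ (densityMeasure γ Δ)) (h : IsDensity γ) (hΔ : 0 < Δ) :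
    potential ξ γ Δ 1 = 0 := by
  have hi := hP.integrable hξ h
  have a := hP.variation_nonneg hξ h hΔ h hi (Δ' := 2 * Δ) (by linarith)
  have b := hP.variation_nonneg hξ h hΔ h hi (Δ' := Δ / 2) (by linarith)
  simp only [sub_self, mul_zero, intervalIntegral.integral_zero, zero_add] at a b
  have a' : 0 ≤ potential ξ γ Δ 1 := nonneg_of_mul_nonneg_left a (by linarith)
  nlinarith

lemma integral_mul_indicator_Ico {F : ℝ → ℝ} {u : ℝ} (hu : u ∈ Set.Icc (0 : ℝ) 1) :
    ∫ x in (0 : ℝ)..1, F x * (Set.Ico u 1).indicator 1 x = ∫ x in u..1, F x := by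
  rw [intervalIntegral.integral_of_le zero_le_one, intervalIntegral.integral_of_le hu.2,
    ← integral_Ico_eq_integral_Ioc, ← integral_Ico_eq_integral_Ioc,
    ← integral_indicator measurableSet_Ico, ← integral_indicator measurableSet_Ico]
  congr 1
  funext x
  by_cases hx : x ∈ Set.Ico u 1
  · rw [Set.indicator_of_mem hx, Set.indicator_of_mem (s := Set.Ico (0 : ℝ) 1)
      ⟨hu.1.trans hx.1, hx.2⟩, Set.indicator_of_mem hx, Pi.one_apply, mul_one]
  · rw [Set.indicator_of_notMem hx]
    simp [Set.indicator, hx]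

/-- The competitor adds the indicator of `[u, 1)` to the density. -/
lemma IsParisiMeasure.integral_potential_nonneg (hξ : IsMixture n ξ)
    (hP : IsParisiMeasure ξ (densityMeasure γ Δ)) (h : IsDensity γ) (hΔ : 0 < Δ) {u : ℝ}
    (hu : u ∈ Set.Icc (0 : ℝ) 1) : 0 ≤ ∫ x in u..1, potential ξ γ Δ x := by
  have hi := hP.integrable hξ h
  have hI : Integrable ((Set.Ico u 1).indicator (1 : ℝ → ℝ)) :=
    (integrable_indicator_iff measurableSet_Ico).2 (integrableOn_const (by simp))
  have hmono : Monotone ((Set.Ici u).indicator (1 : ℝ → ℝ)) := fun x y hxy => by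
    by_cases hx : u ≤ x
    · simp [hx, hx.trans hxy]
    · rw [Set.indicator_of_notMem (by simpa using hx)]
      exact Set.indicator_nonneg (fun _ _ => zero_le_one) _
  have heq : ∀ x ∈ Set.Ico (0 : ℝ) 1,
      (Set.Ico u 1).indicator (1 : ℝ → ℝ) x = (Set.Ici u).indicator (1 : ℝ → ℝ) x := fun x hx => by
    by_cases hxu : u ≤ x <;> simp [Set.indicator, hxu, hx.2]
  have hd : IsDensity (fun x => γ x + (Set.Ico u 1).indicator (1 : ℝ → ℝ) x) := by
    refine ⟨fun x => add_nonneg (h.nonneg x) (Set.indicator_nonneg (fun _ _ => zero_le_one) x),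
      fun x hx => ?_, fun x hx y hy hxy => ?_, fun x hx => (h.right_cont x hx).add ?_⟩
    · rw [h.eq_zero x hx, Set.indicator_of_notMem, add_zero]
      exact fun hx' => hx ⟨hu.1.trans hx'.1, hx'.2⟩
    · simp only [heq x hx, heq y hy]
      exact add_le_add (h.mono hx hy hxy) (hmono hxy)
    · by_cases hxu : u ≤ x
      · refine (continuousWithinAt_const (b := (1 : ℝ))).congr_of_eventuallyEq ?_
          (by simp [hxu, hx.2])
        filter_upwards [Ico_mem_nhdsGE hx.2] with y hy
        rw [Set.indicator_of_mem (s := Set.Ico u 1) ⟨hxu.trans hy.1, hy.2⟩, Pi.one_apply]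
      · push Not at hxu
        refine (continuousWithinAt_const (b := (0 : ℝ))).congr_of_eventuallyEq ?_
          (by simp [hxu])
        filter_upwards [Ico_mem_nhdsGE hxu] with y hy
        exact Set.indicator_of_notMem (fun hy' => absurd hy.2 (not_lt.2 hy'.1)) _
  have := hP.variation_nonneg hξ h hΔ hd (hi.add hI) hΔ
  simpa [integral_mul_indicator_Ico hu] using this

/-- The integrated potential vanishes somewhere between two points with different densities. -/
lemma IsParisiMeasure.exists_integral_potential_eq_zero (hξ : IsMixture n ξ)
    (hP : IsParisiMeasure ξ (densityMeasure γ Δ)) (h : IsDensity γ) (hΔ : 0 < Δ) {x y α : ℝ}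
    (hx : 0 ≤ x) (hxy : x ≤ y) (hy : y < 1) (hα : 0 ≤ α)
    (hαx : ∀ z ∈ Set.Ico (0 : ℝ) 1, z < x → γ z ≤ α) (hαy : α < γ y) :
    ∃ ζ ∈ Set.Icc x y, ∫ z in ζ..1, potential ξ γ Δ z = 0 := by
  by_contra! hne
  have hi := hP.integrable hξ h
  have hF := continuous_potential hξ h hi hΔ
  have hyI : y ∈ Set.Ico (0 : ℝ) 1 := ⟨hx.trans hxy, hy⟩
  have hgc : Continuous (fun u => ∫ z in u..1, potential ξ γ Δ z) := by
    have : (fun u => ∫ z in u..1, potential ξ γ Δ z) =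
        fun u => -∫ z in (1 : ℝ)..u, potential ξ γ Δ z := by
      funext u; rw [intervalIntegral.integral_symm]
    rw [this]
    exact (intervalIntegral.continuous_primitive
      (fun a b => hF.intervalIntegrable a b) (1 : ℝ)).neg
  obtain ⟨w, hw, hwmin⟩ := isCompact_Icc.exists_isMinOn (Set.nonempty_Icc.2 hxy) hgc.continuousOn
  set ε := ∫ z in w..1, potential ξ γ Δ z with hε
  have hεpos : 0 < ε := lt_of_le_of_ne
    (hP.integral_potential_nonneg hξ h hΔ ⟨hx.trans hw.1, hw.2.trans hy.le⟩) (hne w hw).symm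
  set β := γ y with hβ
  -- `f ∘ γ` is the layer of `γ` between the heights `α` and `β`. As `f` and `r - f r` are both
  -- monotone, removing this layer leaves an admissible density.
  set f : ℝ → ℝ := fun r => max 0 (min r β - α) with hf
  have hfm : Monotone f := fun r r' hr => max_le_max le_rfl
    (sub_le_sub_right (min_le_min hr le_rfl) _)
  have hfc : Continuous f := by fun_prop
  have hf0 : ∀ r, r ≤ α → f r = 0 := fun r hr => by
    simp only [hf]
    exact max_eq_left (by linarith [min_le_left r β])
  have hfle : ∀ r, f r ≤ β - α := fun r => max_le (by linarith) (by linarith [min_le_right r β])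
  have hfself : ∀ r, 0 ≤ r → f r ≤ r := fun r hr => max_le hr (by linarith [min_le_left r β])
  have hfsub : Monotone fun r => r - f r := fun r r' hr => by
    have h1 := le_max_left 0 (min r β - α)
    have h2 := le_max_right 0 (min r β - α)
    have h3 : min r' β ≤ min r β + (r' - r) := by
      rw [← min_add_add_right]
      exact min_le_min (by linarith) (by linarith)
    have h4 : f r' ≤ f r + (r' - r) := max_le (by simp only [hf]; linarith)
      (by simp only [hf]; linarith)
    simp only
    linarith
  have hfy : f β = β - α := by simp only [hf, min_self]; exact max_eq_right (by linarith)
  have hd1 : IsDensity (fun z => f (γ z)) := by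
    refine ⟨fun z => le_max_left _ _, fun z hz => ?_, fun a ha b hb hab => hfm (h.mono ha hb hab),
      fun z hz => hfc.continuousAt.comp_continuousWithinAt (h.right_cont z hz)⟩
    simp only [h.eq_zero z hz]
    exact hf0 0 hα
  have hi1 : Integrable (fun z => f (γ z)) := by
    refine hi.mono' (hfc.measurable.comp_aemeasurable h.aemeasurable).aestronglyMeasurable
      (Filter.Eventually.of_forall fun z => ?_)
    rw [Real.norm_of_nonneg (le_max_left _ _)]
    exact hfself _ (h.nonneg z)
  have hd2 : IsDensity (fun z => γ z - f (γ z)) := by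
    refine ⟨fun z => sub_nonneg.2 (hfself _ (h.nonneg z)), fun z hz => ?_,
      fun a ha b hb hab => hfsub (h.mono ha hb hab),
      fun z hz => (h.right_cont z hz).sub (hd1.right_cont z hz)⟩
    simp only [h.eq_zero z hz]
    rw [hf0 0 hα, sub_zero]
  have hJ := hP.variation_nonneg hξ h hΔ hd2 (hi.sub hi1) hΔ
  simp only [sub_self, mul_zero, add_zero, sub_sub_cancel_left, mul_neg,
    intervalIntegral.integral_neg] at hJ
  -- The layer splits only at points of `[x, y]` or at `1`. On `[x, y]` the integrated potential is
  -- at least `ε`, so the layer has positive first variation and removing it would lower the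
  -- functional.
  have hL := integral_mul_nonneg (F := fun z => potential ξ γ Δ z - ε) (hF.sub continuous_const)
    hd1 hi1 (by
      rintro u hu ⟨r, hr0, hr1, hr2⟩
      rw [intervalIntegral.integral_sub (hF.intervalIntegrable _ _)
        (continuous_const.intervalIntegrable _ _), intervalIntegral.integral_const, smul_eq_mul]
      rcases hu.2.eq_or_lt with rfl | hu1
      · simp
      have hux : x ≤ u := by
        by_contra! hlt
        have hm : (u + x) / 2 ∈ Set.Ico (0 : ℝ) 1 := ⟨by linarith [hu.1], by linarith⟩
        have : r < f (γ ((u + x) / 2)) := hr2 _ hm (by linarith)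
        rw [hf0 _ (hαx _ hm (by linarith))] at this
        linarith
      have huy : u ≤ y := by
        by_contra! hlt
        have hm : (u + 1) / 2 ∈ Set.Ico (0 : ℝ) 1 := ⟨by linarith [hu.1], by linarith⟩
        have a : r < f (γ ((u + 1) / 2)) := hr2 _ hm (by linarith)
        have b : f (γ y) ≤ r := hr1 y hyI hlt
        rw [← hβ, hfy] at b
        linarith [hfle (γ ((u + 1) / 2))]
      have : ε ≤ ∫ z in u..1, potential ξ γ Δ z := hwmin ⟨hux, huy⟩
      nlinarith [hu.1])
  have e : ∫ z in (0 : ℝ)..1, (potential ξ γ Δ z - ε) * f (γ z) =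
      (∫ z in (0 : ℝ)..1, potential ξ γ Δ z * f (γ z)) - ε * ∫ z in (0 : ℝ)..1, f (γ z) := by
    rw [← intervalIntegral.integral_const_mul, ← intervalIntegral.integral_sub
      (hi1.intervalIntegrable.continuousOn_mul hF.continuousOn)
      (hi1.const_mul ε).intervalIntegrable]
    exact intervalIntegral.integral_congr fun x _ => by ring
  have hpos : 0 < ∫ z in (0 : ℝ)..1, f (γ z) := by
    have a : (∫ z in (0 : ℝ)..y, f (γ z)) + ∫ z in y..1, f (γ z) = ∫ z in (0 : ℝ)..1, f (γ z) :=
      intervalIntegral.integral_add_adjacent_intervals hi1.intervalIntegrable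
        hi1.intervalIntegrable
    have b : 0 ≤ ∫ z in (0 : ℝ)..y, f (γ z) :=
      intervalIntegral.integral_nonneg hyI.1 fun _ _ => le_max_left _ _
    have c : ∫ z in y..1, (β - α) ≤ ∫ z in y..1, f (γ z) := by
      refine intervalIntegral.integral_mono_on_of_le_Ioo hy.le
        (continuous_const.intervalIntegrable _ _) hi1.intervalIntegrable fun z hz => ?_
      rw [← hfy]
      exact hfm (h.mono hyI ⟨hyI.1.trans hz.1.le, hz.2⟩ hz.1.le)
    rw [intervalIntegral.integral_const, smul_eq_mul] at c
    have d : 0 < (1 - y) * (β - α) := mul_pos (by linarith) (by linarith)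
    linarith
  rw [e] at hL
  nlinarith

end variation

/-! ### The density of the `k`-FRSB form -/

namespace IsBlockSystem

variable {k t : ℕ} {s : ℕ → ℕ} {q : ℕ → ℕ → ℝ} (hq : IsBlockSystem k t s q)
include hq

lemma lt_of_lt {j j' i i' : ℕ} (h1 : 1 ≤ j) (h : j < j') (h2 : j' ≤ t) (hi : i ≤ s j)
    (hi' : i' ≤ s j') : q j i < q j' i' :=
  (hq.block_le h1 (by omega) hi le_rfl).trans_lt ((hq.lt_of_block_lt h1 h h2).trans_le
    (hq.block_le (by omega) h2 (Nat.zero_le _) hi'))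

end IsBlockSystem

section density

variable {k t : ℕ} {s : ℕ → ℕ} {q : ℕ → ℕ → ℝ} {m : ℕ → ℝ} {ω : ℝ → ℝ}
  {I : ℝ → ℝ → Set ℝ}

/-- The density of a `k`-FRSB measure, with the intervals `I a b` between breakpoints. -/
def cellDensity (I : ℝ → ℝ → Set ℝ) (t : ℕ) (s : ℕ → ℕ) (q : ℕ → ℕ → ℝ) (m : ℕ → ℝ) (ω : ℝ → ℝ)
    (x : ℝ) : ℝ :=
  (∑ j ∈ Finset.Icc 1 t, ∑ i ∈ Finset.Icc 1 (s j),
      (I (q j (i - 1)) (q j i)).indicator (fun _ => m (blockEnd s (j - 1) + i)) x) +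
    ∑ j ∈ Finset.Icc 1 (t - 1), (I (q j (s j)) (q (j + 1) 0)).indicator ω x

/-- No other cell contains `x`. The family `I` is left abstract so that closed cells (the given
form) and half-open cells (the right-continuous version) are treated together. -/
lemma cellDensity_step (hq : IsBlockSystem k t s q) {j i : ℕ} (h1 : 1 ≤ j) (h2 : j ≤ t)
    (hi : i < s j) {x : ℝ} (hx : x ∈ I (q j i) (q j (i + 1)))
    (hl : ∀ a b, b ≤ q j i → x ∉ I a b) (hr : ∀ a b, q j (i + 1) ≤ a → x ∉ I a b) :
    cellDensity I t s q m ω x = m (blockEnd s (j - 1) + (i + 1)) := by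
  have hgap : ∑ j ∈ Finset.Icc 1 (t - 1), (I (q j (s j)) (q (j + 1) 0)).indicator ω x = 0 := by
    refine Finset.sum_eq_zero fun j' hj' => Set.indicator_of_notMem (fun h => ?_) _
    obtain ⟨h3, h4⟩ := Finset.mem_Icc.1 hj'
    rcases lt_or_ge j' j with hlt | hge
    · have a : q (j' + 1) 0 ≤ q j i := by
        rcases (Nat.succ_le_of_lt hlt).eq_or_lt with e | hlt'
        · rw [show j' + 1 = j from e]; exact hq.block_le h1 h2 (Nat.zero_le _) hi.le
        · exact (hq.lt_of_lt (by omega) hlt' h2 (Nat.zero_le _) hi.le).le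
      exact hl _ _ a h
    · have a : q j (i + 1) ≤ q j' (s j') := by
        rcases hge.eq_or_lt with rfl | hlt'
        · exact hq.block_le h1 h2 hi le_rfl
        · exact (hq.lt_of_lt h1 hlt' (by omega) hi le_rfl).le
      exact hr _ _ a h
  unfold cellDensity
  rw [hgap, add_zero, Finset.sum_eq_single j, Finset.sum_eq_single (i + 1)]
  · simp only [Nat.add_sub_cancel]
    rw [Set.indicator_of_mem hx]
  · intro i' hi' hne
    obtain ⟨h3, h4⟩ := Finset.mem_Icc.1 hi'
    refine Set.indicator_of_notMem (fun h => ?_) _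
    rcases lt_or_gt_of_ne hne with hlt | hlt
    · exact hl _ _ (hq.block_le h1 h2 (Nat.le_of_lt_succ hlt) hi.le) h
    · exact hr _ _ (hq.block_le h1 h2 (Nat.le_sub_one_of_lt hlt) (by omega)) h
  · exact fun h => absurd (Finset.mem_Icc.2 ⟨by omega, hi⟩) h
  · intro j' hj' hne
    obtain ⟨h3, h4⟩ := Finset.mem_Icc.1 hj'
    refine Finset.sum_eq_zero fun i' hi' => Set.indicator_of_notMem (fun h => ?_) _
    obtain ⟨h5, h6⟩ := Finset.mem_Icc.1 hi'
    rcases lt_or_gt_of_ne hne with hlt | hlt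
    · exact hl _ _ (hq.lt_of_lt h3 hlt h2 h6 hi.le).le h
    · exact hr _ _ (hq.lt_of_lt (i' := i' - 1) h1 hlt h4 (Nat.succ_le_of_lt hi) (by omega)).le h
  · exact fun h => absurd (Finset.mem_Icc.2 ⟨h1, h2⟩) h

lemma cellDensity_gap (hq : IsBlockSystem k t s q) {j : ℕ} (h1 : 1 ≤ j) (h2 : j < t) {x : ℝ}
    (hx : x ∈ I (q j (s j)) (q (j + 1) 0))
    (hl : ∀ a b, b ≤ q j (s j) → x ∉ I a b) (hr : ∀ a b, q (j + 1) 0 ≤ a → x ∉ I a b) :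
    cellDensity I t s q m ω x = ω x := by
  have hstep : ∑ j ∈ Finset.Icc 1 t, ∑ i ∈ Finset.Icc 1 (s j), (I (q j (i - 1))
      (q j i)).indicator (fun _ => m (blockEnd s (j - 1) + i)) x = 0 := by
    refine Finset.sum_eq_zero fun j' hj' => Finset.sum_eq_zero fun i' hi' =>
      Set.indicator_of_notMem (fun h => ?_) _
    obtain ⟨h3, h4⟩ := Finset.mem_Icc.1 hj'
    obtain ⟨h5, h6⟩ := Finset.mem_Icc.1 hi'
    rcases le_or_gt j' j with hle | hlt
    · have a : q j' i' ≤ q j (s j) := by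
        rcases hle.eq_or_lt with rfl | hlt'
        · exact hq.block_le h1 h2.le h6 le_rfl
        · exact (hq.lt_of_lt h3 hlt' h2.le h6 le_rfl).le
      exact hl _ _ a h
    · have a : q (j + 1) 0 ≤ q j' (i' - 1) := by
        rcases (Nat.succ_le_of_lt hlt).eq_or_lt with e | hlt'
        · rw [show j + 1 = j' from e]; exact hq.block_le h3 h4 (Nat.zero_le _) (by omega)
        · exact (hq.lt_of_lt (by omega) hlt' h4 (Nat.zero_le _) (by omega)).le
      exact hr _ _ a h
  unfold cellDensity
  rw [hstep, zero_add, Finset.sum_eq_single j]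
  · exact Set.indicator_of_mem hx _
  · intro j' hj' hne
    obtain ⟨h3, h4⟩ := Finset.mem_Icc.1 hj'
    refine Set.indicator_of_notMem (fun h => ?_) _
    rcases lt_or_gt_of_ne hne with hlt | hlt
    · have a : q (j' + 1) 0 ≤ q j (s j) := by
        rcases (Nat.succ_le_of_lt hlt).eq_or_lt with e | hlt'
        · rw [show j' + 1 = j from e]; exact hq.block_le h1 h2.le (Nat.zero_le _) le_rfl
        · exact (hq.lt_of_lt (by omega) hlt' h2.le (Nat.zero_le _) le_rfl).le
      exact hl _ _ a h
    · have a : q (j + 1) 0 ≤ q j' (s j') := by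
        rcases (Nat.succ_le_of_lt hlt).eq_or_lt with e | hlt'
        · rw [show j + 1 = j' from e]; exact hq.block_le (by omega) (by omega) (Nat.zero_le _) le_rfl
        · exact (hq.lt_of_lt (by omega) hlt' (by omega) (Nat.zero_le _) le_rfl).le
      exact hr _ _ a h
  · exact fun h => absurd (Finset.mem_Icc.2 ⟨h1, by omega⟩) h

lemma frsbDensity_step (hq : IsBlockSystem k t s q) {j i : ℕ} (h1 : 1 ≤ j) (h2 : j ≤ t)
    (hi : i < s j) {x : ℝ} (hx : x ∈ Set.Ioo (q j i) (q j (i + 1))) :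
    frsbDensity t s q m ω x = m (blockEnd s (j - 1) + (i + 1)) :=
  cellDensity_step (I := Set.Icc) hq h1 h2 hi (Set.Ioo_subset_Icc_self hx)
    (fun _ _ hb h => absurd (hx.1.trans_le h.2) (not_lt.2 hb))
    (fun _ _ ha h => absurd (h.1.trans_lt hx.2) (not_lt.2 ha))

lemma frsbDensity_gap (hq : IsBlockSystem k t s q) {j : ℕ} (h1 : 1 ≤ j) (h2 : j < t) {x : ℝ}
    (hx : x ∈ Set.Ioo (q j (s j)) (q (j + 1) 0)) : frsbDensity t s q m ω x = ω x :=
  cellDensity_gap (I := Set.Icc) hq h1 h2 (Set.Ioo_subset_Icc_self hx)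
    (fun _ _ hb h => absurd (hx.1.trans_le h.2) (not_lt.2 hb))
    (fun _ _ ha h => absurd (h.1.trans_lt hx.2) (not_lt.2 ha))

end density

/-! ### Pointwise values of a monotone density known only through its measure -/

section identify

variable {γ D : ℝ → ℝ} {Δ Δ' : ℝ}

lemma setLIntegral_eq_of_measure_eq (hν : densityMeasure γ Δ =
    volume.withDensity (fun x => ENNReal.ofReal (D x)) + ENNReal.ofReal Δ' • Measure.dirac (1 : ℝ))
    {x y : ℝ} (hy : y ≤ 1) : ∫⁻ z in Set.Ioo x y, ENNReal.ofReal (γ z) =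
      ∫⁻ z in Set.Ioo x y, ENNReal.ofReal (D z) := by
  have h1 : (1 : ℝ) ∉ Set.Ioo x y := fun h => absurd h.2 (not_lt.2 hy)
  have := congrArg (fun μ : Measure ℝ => μ (Set.Ioo x y)) hν
  simpa [densityMeasure, withDensity_apply _ measurableSet_Ioo,
    Measure.dirac_apply' _ measurableSet_Ioo, h1] using this

/-- By monotonicity `γ x` is at most the average of `γ` over `(x, y)`, which equals that of the
positive part of `D`. -/
lemma IsDensity.le_of_measure_eq (h : IsDensity γ) (hν : densityMeasure γ Δ =
    volume.withDensity (fun x => ENNReal.ofReal (D x)) + ENNReal.ofReal Δ' • Measure.dirac (1 : ℝ))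
    {x y K : ℝ} (hx : 0 ≤ x) (hxy : x < y) (hy : y ≤ 1) (hK : 0 ≤ K)
    (hD : ∀ z ∈ Set.Ioo x y, D z ≤ K) : γ x ≤ K := by
  have hv : volume (Set.Ioo x y) ≠ 0 := by simp [hxy]
  have a : ENNReal.ofReal (γ x) * volume (Set.Ioo x y) ≤
      ∫⁻ z in Set.Ioo x y, ENNReal.ofReal (γ z) := by
    rw [← setLIntegral_const]
    exact setLIntegral_mono' measurableSet_Ioo fun z hz => ENNReal.ofReal_le_ofReal
      (h.mono ⟨hx, hxy.trans_le hy⟩ ⟨hx.trans hz.1.le, hz.2.trans_le hy⟩ hz.1.le)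
  have b : ∫⁻ z in Set.Ioo x y, ENNReal.ofReal (D z) ≤
      ENNReal.ofReal K * volume (Set.Ioo x y) := by
    rw [← setLIntegral_const]
    exact setLIntegral_mono' measurableSet_Ioo fun z hz => ENNReal.ofReal_le_ofReal (hD z hz)
  rw [setLIntegral_eq_of_measure_eq hν hy] at a
  have c := a.trans b
  rw [ENNReal.mul_le_mul_iff_left hv (by simp)] at c
  exact (ENNReal.ofReal_le_ofReal_iff hK).1 c

lemma IsDensity.ge_of_measure_eq (h : IsDensity γ) (hν : densityMeasure γ Δ =
    volume.withDensity (fun x => ENNReal.ofReal (D x)) + ENNReal.ofReal Δ' • Measure.dirac (1 : ℝ))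
    {x y K : ℝ} (hx : 0 ≤ x) (hxy : x < y) (hy : y < 1)
    (hD : ∀ z ∈ Set.Ioo x y, K ≤ D z) : K ≤ γ y := by
  have hv : volume (Set.Ioo x y) ≠ 0 := by simp [hxy]
  have a : ∫⁻ z in Set.Ioo x y, ENNReal.ofReal (γ z) ≤
      ENNReal.ofReal (γ y) * volume (Set.Ioo x y) := by
    rw [← setLIntegral_const]
    exact setLIntegral_mono' measurableSet_Ioo fun z hz => ENNReal.ofReal_le_ofReal
      (h.mono ⟨hx.trans hz.1.le, hz.2.trans hy⟩ ⟨hx.trans hxy.le, hy⟩ hz.2.le)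
  have b : ENNReal.ofReal K * volume (Set.Ioo x y) ≤
      ∫⁻ z in Set.Ioo x y, ENNReal.ofReal (D z) := by
    rw [← setLIntegral_const]
    exact setLIntegral_mono' measurableSet_Ioo fun z hz => ENNReal.ofReal_le_ofReal (hD z hz)
  rw [setLIntegral_eq_of_measure_eq hν hy.le] at a
  have c := b.trans a
  rw [ENNReal.mul_le_mul_iff_left hv (by simp)] at c
  exact (ENNReal.ofReal_le_ofReal_iff (h.nonneg y)).1 c

end identify

/-! ### The potential on a step -/

lemma eq_of_hasDerivAt_eq {f g f' : ℝ → ℝ} {a b : ℝ}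
    (hf : ∀ w ∈ Set.Icc a b, HasDerivAt f (f' w) w)
    (hg : ∀ w ∈ Set.Icc a b, HasDerivAt g (f' w) w) (h : f a = g a) {y : ℝ}
    (hy : y ∈ Set.Icc a b) : f y = g y := by
  rcases hy.1.eq_or_lt with rfl | hay
  · exact h
  have hd : ∀ w ∈ Set.Icc a b, HasDerivAt (fun w => f w - g w) 0 w := fun w hw =>
    ((hf w hw).sub (hg w hw)).congr_deriv (sub_self _)
  obtain ⟨c, hc, e⟩ := exists_hasDerivAt_eq_slope (fun w => f w - g w) (fun _ => 0) hay
    (fun w hw => (hd w ⟨hw.1, hw.2.trans hy.2⟩).continuousAt.continuousWithinAt)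
    (fun w hw => hd w ⟨hw.1.le, hw.2.le.trans hy.2⟩)
  have := (div_eq_zero_iff.1 e.symm).resolve_right (by linarith)
  linarith

section step

variable {n : ℕ} {ξ γ : ℝ → ℝ} {Δ x x' A B : ℝ}

lemma potential_eq_stepF (hξ : IsMixture n ξ) (h : IsDensity γ) (hi : Integrable γ)
    (hΔ : 0 < Δ) (hx : x < x') (hB : 0 < B) (hA : B < A)
    (ht : ∀ y ∈ Set.Icc x x', tail γ Δ y = line x x' A B y) (h0 : potential ξ γ Δ x = 0)
    {y : ℝ} (hy : y ∈ Set.Icc x x') : potential ξ γ Δ y = stepF ξ x x' A B y :=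
  eq_of_hasDerivAt_eq
    (fun w hw => by
      have := hasDerivAt_potential hξ h hi hΔ w
      rwa [ht w hw, ← one_div] at this)
    (fun w hw => hasDerivAt_stepF hξ hx hB hA hw.2) (by rw [h0]; simp [stepF]) hy

lemma integral_potential_eq_stepG (hξ : IsMixture n ξ) (h : IsDensity γ) (hi : Integrable γ)
    (hΔ : 0 < Δ) (hx : x < x') (hB : 0 < B) (hA : B < A)
    (ht : ∀ y ∈ Set.Icc x x', tail γ Δ y = line x x' A B y) (h0 : potential ξ γ Δ x = 0)
    {y : ℝ} (hy : y ∈ Set.Icc x x') :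
    ∫ z in x..y, potential ξ γ Δ z = stepG ξ x x' A B y := by
  have hF := continuous_potential hξ h hi hΔ
  refine eq_of_hasDerivAt_eq (f := fun y => ∫ z in x..y, potential ξ γ Δ z)
    (fun w _ => (hF.integral_hasStrictDerivAt x w).hasDerivAt)
    (fun w hw => ?_) ?_ hy
  · rw [potential_eq_stepF hξ h hi hΔ hx hB hA ht h0 hw]
    exact hasDerivAt_stepG hξ hx hB hA hw.2
  · simp [stepG, line_left hx, (hB.trans hA).ne']

end step

/-! ### From the minimizer to the profile -/

section necessity

variable {n : ℕ} {ξ γ : ℝ → ℝ} {Δ : ℝ}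

lemma hasDerivAt_integral_potential (hξ : IsMixture n ξ) (h : IsDensity γ) (hi : Integrable γ)
    (hΔ : 0 < Δ) (x : ℝ) :
    HasDerivAt (fun u => ∫ z in u..1, potential ξ γ Δ z) (-potential ξ γ Δ x) x := by
  have hF := continuous_potential hξ h hi hΔ
  have e : (fun u => ∫ z in u..1, potential ξ γ Δ z) =
      fun u => -∫ z in (1 : ℝ)..u, potential ξ γ Δ z := by
    funext u; rw [intervalIntegral.integral_symm]
  rw [e]
  exact (hF.integral_hasStrictDerivAt 1 x).hasDerivAt.neg

lemma continuous_integral_potential (hξ : IsMixture n ξ) (h : IsDensity γ) (hi : Integrable γ)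
    (hΔ : 0 < Δ) : Continuous (fun u => ∫ z in u..1, potential ξ γ Δ z) :=
  continuous_iff_continuousAt.2 fun x => (hasDerivAt_integral_potential hξ h hi hΔ x).continuousAt

/-- The density exceeds `α` immediately to the right of `x`, so the integrated potential has zeros
in every `[x, y]`, and they accumulate at `x`. -/
lemma IsParisiMeasure.integral_potential_eq_zero (hξ : IsMixture n ξ)
    (hP : IsParisiMeasure ξ (densityMeasure γ Δ)) (h : IsDensity γ) (hΔ : 0 < Δ) {x b α : ℝ}
    (hx : 0 ≤ x) (hxb : x < b) (hb : b ≤ 1) (hα : 0 ≤ α)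
    (hαx : ∀ z ∈ Set.Ico (0 : ℝ) 1, z < x → γ z ≤ α) (hαy : ∀ y ∈ Set.Ioo x b, α < γ y) :
    ∫ z in x..1, potential ξ γ Δ z = 0 := by
  have hi := hP.integrable hξ h
  have hc := continuous_integral_potential hξ h hi hΔ
  by_contra hne
  obtain ⟨ε, hε, hball⟩ := Metric.eventually_nhds_iff.1 (hc.continuousAt.eventually_ne hne)
  set y := min (x + ε / 2) ((x + b) / 2) with hy
  have y1 : x < y := lt_min (by linarith) (by linarith)
  have y2 : y < b := (min_le_right _ _).trans_lt (by linarith)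
  have y3 : y ≤ x + ε / 2 := min_le_left _ _
  obtain ⟨ζ, hζ, e⟩ := hP.exists_integral_potential_eq_zero hξ h hΔ hx y1.le
    (y2.trans_le hb) hα hαx (hαy y ⟨y1, y2⟩)
  refine hball ?_ e
  rw [Real.dist_eq, abs_of_nonneg (by linarith [hζ.1])]
  linarith [hζ.2]

/-- The integrated potential is nonnegative, so an interior zero is a minimum; the two ends have
reasons of their own. -/
lemma IsParisiMeasure.potential_eq_zero (hξ : IsMixture n ξ)
    (hP : IsParisiMeasure ξ (densityMeasure γ Δ)) (h : IsDensity γ) (hΔ : 0 < Δ) {x : ℝ}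
    (hx : x ∈ Set.Icc (0 : ℝ) 1) (h0 : ∫ z in x..1, potential ξ γ Δ z = 0) :
    potential ξ γ Δ x = 0 := by
  have hi := hP.integrable hξ h
  rcases hx.1.eq_or_lt with rfl | hx0
  · simp [potential, hξ.deriv_zero]
  rcases hx.2.eq_or_lt with rfl | hx1
  · exact hP.potential_one hξ h hΔ
  have hmin : IsLocalMin (fun u => ∫ z in u..1, potential ξ γ Δ z) x := by
    filter_upwards [Icc_mem_nhds hx0 hx1] with y hy
    rw [h0]
    exact hP.integral_potential_nonneg hξ h hΔ hy
  have := hmin.hasDerivAt_eq_zero (hasDerivAt_integral_potential hξ h hi hΔ x)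
  linarith

/-- Otherwise the potential would increase through `0` at `x`, hence be negative just before, and
the integrated potential would be negative there. Only the left side of `x` is used, so `x = 1` is
covered. -/
lemma IsParisiMeasure.deriv₂_mul_tail_sq_le (hξ : IsMixture n ξ)
    (hP : IsParisiMeasure ξ (densityMeasure γ Δ)) (h : IsDensity γ) (hΔ : 0 < Δ) {x : ℝ}
    (hx : x ∈ Set.Icc (0 : ℝ) 1) (h0 : ∫ z in x..1, potential ξ γ Δ z = 0) :
    deriv (deriv ξ) x * tail γ Δ x ^ 2 ≤ 1 := by
  have hi := hP.integrable hξ h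
  have ht := hΔ.trans_le (h.le_tail (Δ := Δ) x)
  rcases hx.1.eq_or_lt with rfl | hx0
  · rw [hξ.deriv₂_zero, zero_mul]; exact zero_le_one
  by_contra! hlt
  have hpos : 0 < deriv (deriv ξ) x - ((tail γ Δ x) ^ 2)⁻¹ := by
    rw [sub_pos, inv_lt_iff_one_lt_mul₀ (by positivity)]
    exact hlt
  have hF0 := hP.potential_eq_zero hξ h hΔ hx h0
  have hev := (hasDerivAt_iff_tendsto_slope.1 (hasDerivAt_potential hξ h hi hΔ x)).eventually
    (lt_mem_nhds hpos)
  have hev' : ∀ᶠ y in nhdsWithin x (Set.Iio x), potential ξ γ Δ y < 0 := by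
    have := hev.filter_mono (nhdsWithin_mono x fun y (hy : y < x) => hy.ne)
    filter_upwards [this, self_mem_nhdsWithin] with y hy hyx
    rw [slope_def_field, hF0, sub_zero] at hy
    have hyx' : y - x < 0 := by simpa using hyx
    by_contra! hn
    exact absurd hy (not_lt.2 (div_nonpos_of_nonneg_of_nonpos hn hyx'.le))
  obtain ⟨l, hl, hl'⟩ := (mem_nhdsLT_iff_exists_Ioo_subset).1 hev'
  have hm : max l 0 < x := max_lt hl hx0
  obtain ⟨c, hc, e⟩ := exists_hasDerivAt_eq_slope (fun u => ∫ z in u..1, potential ξ γ Δ z)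
    (fun x => -potential ξ γ Δ x) hm
    (continuous_integral_potential hξ h hi hΔ).continuousOn
    (fun w _ => hasDerivAt_integral_potential hξ h hi hΔ w)
  have a : potential ξ γ Δ c < 0 := hl' ⟨(le_max_left _ _).trans_lt hc.1, hc.2⟩
  have b := hP.integral_potential_nonneg hξ h hΔ (u := max l 0) ⟨le_max_right _ _, hm.le.trans hx.2⟩
  rw [h0, zero_sub] at e
  have : -(∫ z in (max l 0)..1, potential ξ γ Δ z) / (x - max l 0) ≤ 0 :=
    div_nonpos_of_nonpos_of_nonneg (by linarith) (by linarith)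
  linarith

/-- The Parisi measure is a profile: necessity of the local optimality conditions. -/
theorem IsParisiMeasure.exists_isProfile {k t : ℕ} {s : ℕ → ℕ} {q : ℕ → ℕ → ℝ} {ν : Measure ℝ}
    (hξ : IsMixture n ξ) (hP : IsParisiMeasure ξ ν) (hν : HasFRSBForm k t s q ν) :
    ∃ av, IsProfile ξ t s q av := by
  obtain ⟨γ, Δ, h, hΔ, rfl⟩ := mem_measureClass_iff.1 hP.1
  obtain ⟨hq, m, ω, Δ', hm0, hm, hω, hω0, -, hν⟩ := hν
  have hi := hP.integrable hξ h
  have ht2 := hq.two_le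
  have hpos : ∀ x, 0 < tail γ Δ x := fun x => hΔ.trans_le (h.le_tail x)
  have hidx : ∀ j, 1 ≤ j → j ≤ t → ∀ i, i < s j →
      blockEnd s (j - 1) + (i + 1) ∈ Set.Icc 1 k := by
    intro j h1 h2 i hij
    obtain ⟨j, rfl⟩ : ∃ j', j = j' + 1 := ⟨j - 1, by omega⟩
    have e := blockEnd_succ s j
    have e' := hq.sum_eq
    have : blockEnd s (j + 1) ≤ blockEnd s t :=
      Finset.sum_le_sum_of_subset (Finset.Icc_subset_Icc_right h2)
    simp only [Nat.add_sub_cancel, Set.mem_Icc]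
    omega
  have hstep : ∀ j, 1 ≤ j → j ≤ t → ∀ i, i < s j → ∀ x ∈ Set.Ioo (q j i) (q j (i + 1)),
      γ x = m (blockEnd s (j - 1) + (i + 1)) := by
    intro j h1 h2 i hij x hx
    have hmpos := hm0 _ (Finset.mem_Icc.2 (hidx j h1 h2 i hij))
    have hx0 := hq.nonneg h1 h2 hij.le
    have hx1 := hq.le_one h1 h2 (Nat.succ_le_of_lt hij)
    refine le_antisymm (h.le_of_measure_eq hν (hx0.trans hx.1.le) hx.2 hx1 hmpos.le fun z hz => ?_)
      (h.ge_of_measure_eq hν hx0 hx.1 (hx.2.trans_le hx1) fun z hz => ?_)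
    · rw [frsbDensity_step hq h1 h2 hij ⟨hx.1.trans hz.1, hz.2⟩]
    · rw [frsbDensity_step hq h1 h2 hij ⟨hz.1, hz.2.trans hx.2⟩]
  -- `γ` and `ω` are compared only through integrals, so strictness comes from two intermediate
  -- points.
  have hgap : ∀ j, 1 ≤ j → j < t → StrictMonoOn γ (Set.Ioo (q j (s j)) (q (j + 1) 0)) := by
    intro j h1 h2 x hx y hy hxy
    have hx0 := hq.nonneg h1 h2.le le_rfl
    have hx1 := hq.le_one (by omega) (Nat.succ_le_of_lt h2) (Nat.zero_le _)
    have hmem : ∀ z ∈ Set.Ioo (q j (s j)) (q (j + 1) 0), z ∈ gapSet t s q :=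
      fun z hz => ⟨j, h1, h2, hz.1.le, hz.2.le⟩
    set c := x + (y - x) / 3 with hc
    set d := x + (y - x) * 2 / 3 with hd
    have c1 : x < c := by linarith
    have c2 : c < d := by linarith
    have c3 : d < y := by linarith
    have hcm : c ∈ Set.Ioo (q j (s j)) (q (j + 1) 0) := ⟨by linarith [hx.1], by linarith [hy.2]⟩
    have hdm : d ∈ Set.Ioo (q j (s j)) (q (j + 1) 0) := ⟨by linarith [hx.1], by linarith [hy.2]⟩
    have a : γ x ≤ ω c := h.le_of_measure_eq hν (hx0.trans hx.1.le) c1 (hcm.2.le.trans hx1)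
      (hω0 _ (hmem c hcm)) fun z hz => by
        have hz' : z ∈ Set.Ioo (q j (s j)) (q (j + 1) 0) :=
          ⟨hx.1.trans hz.1, hz.2.trans hcm.2⟩
        rw [frsbDensity_gap hq h1 h2 hz']
        exact hω.monotoneOn (hmem z hz') (hmem c hcm) hz.2.le
    have b : ω d ≤ γ y := h.ge_of_measure_eq hν (hx0.trans hdm.1.le) c3 (hy.2.trans_le hx1)
      fun z hz => by
        have hz' : z ∈ Set.Ioo (q j (s j)) (q (j + 1) 0) :=
          ⟨hdm.1.trans hz.1, hz.2.trans hy.2⟩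
        rw [frsbDensity_gap hq h1 h2 hz']
        exact hω.monotoneOn (hmem d hdm) (hmem z hz') hz.1.le
    exact a.trans_lt ((hω (hmem c hcm) (hmem d hdm) c2).trans_le b)
  have hc := continuous_integral_potential hξ h hi hΔ
  -- Strict growth makes every point of the open gap a point of increase; continuity adds its ends.
  have hgap0 : ∀ j, 1 ≤ j → j < t → ∀ x ∈ Set.Icc (q j (s j)) (q (j + 1) 0),
      ∫ z in x..1, potential ξ γ Δ z = 0 := by
    intro j h1 h2 x hx
    have hx0 := hq.nonneg h1 h2.le le_rfl
    have hx1 := hq.le_one (by omega) (Nat.succ_le_of_lt h2) (Nat.zero_le _)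
    have hlt := hq.gap_lt h1 h2
    rw [← closure_Ioo hlt.ne] at hx
    refine closure_minimal (fun x hx => ?_) (isClosed_eq hc continuous_const) hx
    have hxI : x ∈ Set.Ico (0 : ℝ) 1 := ⟨hx0.trans hx.1.le, hx.2.trans_le hx1⟩
    exact hP.integral_potential_eq_zero hξ h hΔ hxI.1 hx.2 hx1 (h.nonneg x)
      (fun z hz hzx => h.mono hz hxI hzx.le)
      (fun y hy => hgap j h1 h2 hx ⟨hx.1.trans hy.1, hy.2⟩ hy.1)
  -- Inside a block the density jumps from one level to the next; at `0` it rises above `α = 0`; all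
  -- other breakpoints bound a gap or equal `1`.
  have hzero : ∀ j, 1 ≤ j → j ≤ t → ∀ i, i ≤ s j →
      ∫ z in (q j i)..1, potential ξ γ Δ z = 0 := by
    intro j h1 h2 i hij
    rcases hij.eq_or_lt with rfl | hij
    · rcases h2.eq_or_lt with rfl | h2
      · rw [hq.q_one, intervalIntegral.integral_same]
      · exact hgap0 j h1 h2 _ ⟨le_rfl, (hq.gap_lt h1 h2).le⟩
    rcases Nat.eq_zero_or_pos i with rfl | hi0
    · rcases h1.eq_or_lt with rfl | h1
      · refine hP.integral_potential_eq_zero hξ h hΔ (hq.nonneg le_rfl h2 (Nat.zero_le _))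
          (hq.step_lt le_rfl h2 hij) (hq.le_one le_rfl h2 hij) le_rfl
          (fun z hz hzx => ?_) (fun y hy => ?_)
        · rw [hq.q_zero] at hzx
          exact absurd hz.1 (not_le.2 hzx)
        · rw [hstep 1 le_rfl h2 0 hij y hy]
          exact hm0 _ (Finset.mem_Icc.2 (hidx 1 le_rfl h2 0 hij))
      · obtain ⟨j, rfl⟩ : ∃ j', j = j' + 1 := ⟨j - 1, by omega⟩
        exact hgap0 j (by omega) h2 _ ⟨(hq.gap_lt (by omega) h2).le, le_rfl⟩
    · obtain ⟨i, rfl⟩ : ∃ i', i = i' + 1 := ⟨i - 1, by omega⟩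
      have hi' : i < s j := by omega
      refine hP.integral_potential_eq_zero hξ h hΔ (hq.nonneg h1 h2 hij.le)
          (hq.step_lt h1 h2 hij) (hq.le_one h1 h2 hij)
          (hm0 _ (Finset.mem_Icc.2 (hidx j h1 h2 i hi'))).le
          (fun z hz hzx => ?_) (fun y hy => ?_)
      · have hlt := hq.step_lt h1 h2 hi'
        set w := (max z (q j i) + q j (i + 1)) / 2 with hw
        have w1 : max z (q j i) < q j (i + 1) := max_lt hzx hlt
        have w2 : w ∈ Set.Ioo (q j i) (q j (i + 1)) :=
          ⟨by linarith [le_max_right z (q j i)], by linarith⟩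
        rw [← hstep j h1 h2 i hi' w w2]
        exact h.mono hz ⟨(hq.nonneg h1 h2 hi'.le).trans w2.1.le,
          w2.2.trans_le (hq.le_one h1 h2 hij.le)⟩ (by linarith [le_max_left z (q j i)])
      · rw [hstep j h1 h2 (i + 1) hij y hy]
        exact hm (hidx j h1 h2 i hi') (hidx j h1 h2 (i + 1) hij) (by omega)
  have hI : ∀ j, 1 ≤ j → j ≤ t → ∀ i, i ≤ s j → q j i ∈ Set.Icc (0 : ℝ) 1 :=
    fun j h1 h2 i hij => ⟨hq.nonneg h1 h2 hij, hq.le_one h1 h2 hij⟩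
  have hpot : ∀ j, 1 ≤ j → j ≤ t → ∀ i, i ≤ s j → potential ξ γ Δ (q j i) = 0 :=
    fun j h1 h2 i hij => hP.potential_eq_zero hξ h hΔ (hI j h1 h2 i hij) (hzero j h1 h2 i hij)
  have hgapd : ∀ j, 1 ≤ j → j < t → ∀ x ∈ Set.Icc (q j (s j)) (q (j + 1) 0),
      deriv (deriv ξ) x * tail γ Δ x ^ 2 = 1 := by
    intro j h1 h2 x hx
    have hx0 := hq.nonneg h1 h2.le le_rfl
    have hx1 := hq.le_one (by omega) (Nat.succ_le_of_lt h2) (Nat.zero_le _)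
    have hlt := hq.gap_lt h1 h2
    have h2c : Continuous (deriv (deriv ξ)) :=
      continuous_iff_continuousAt.2 fun x => (hξ.hasDerivAt₂ x).continuousAt
    rw [← closure_Ioo hlt.ne] at hx
    refine closure_minimal (fun x hx => ?_)
      (isClosed_eq (h2c.mul ((continuous_tail hi).pow 2)) continuous_const) hx
    have hd0 : HasDerivAt (potential ξ γ Δ) 0 x :=
      (hasDerivAt_const x (0 : ℝ)).congr_of_eventuallyEq (by
        filter_upwards [Ioo_mem_nhds hx.1 hx.2] with y hy
        exact hP.potential_eq_zero hξ h hΔ ⟨hx0.trans hy.1.le, hy.2.le.trans hx1⟩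
          (hgap0 j h1 h2 y ⟨hy.1.le, hy.2.le⟩))
    have e := (hasDerivAt_potential hξ h hi hΔ x).unique hd0
    have := hpos x
    change deriv (deriv ξ) x * tail γ Δ x ^ 2 = 1
    rw [sub_eq_zero.1 e]
    exact inv_mul_cancel₀ (by positivity)
  have htail : ∀ j, 1 ≤ j → j ≤ t → ∀ i, i < s j → ∀ x ∈ Set.Icc (q j i) (q j (i + 1)),
      tail γ Δ x = tail γ Δ (q j (i + 1)) +
        m (blockEnd s (j - 1) + (i + 1)) * (q j (i + 1) - x) := by
    intro j h1 h2 i hij x hx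
    have e : ∫ z in x..q j (i + 1), γ z =
        ∫ z in x..q j (i + 1), m (blockEnd s (j - 1) + (i + 1)) := by
      rw [intervalIntegral.integral_of_le hx.2, intervalIntegral.integral_of_le hx.2,
        integral_Ioc_eq_integral_Ioo, integral_Ioc_eq_integral_Ioo]
      exact setIntegral_congr_fun measurableSet_Ioo fun z hz =>
        hstep j h1 h2 i hij z ⟨hx.1.trans_lt hz.1, hz.2⟩
    have e' := tail_sub (Δ := Δ) hi x (q j (i + 1))
    rw [e, intervalIntegral.integral_const, smul_eq_mul] at e'
    linarith
  have hslope : ∀ j, 1 ≤ j → j ≤ t → ∀ i, i < s j →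
      (tail γ Δ (q j i) - tail γ Δ (q j (i + 1))) / (q j (i + 1) - q j i) =
        m (blockEnd s (j - 1) + (i + 1)) := by
    intro j h1 h2 i hij
    have hlt := hq.step_lt h1 h2 hij
    rw [div_eq_iff (by linarith), htail j h1 h2 i hij (q j i) ⟨le_rfl, hlt.le⟩]
    ring
  refine ⟨fun j i => tail γ Δ (q j i), fun j _ _ i _ => hpos _, fun j h1 h2 i hij => ?_,
    fun j h1 h2 => hgapd j h1 h2 _ ⟨le_rfl, (hq.gap_lt h1 h2).le⟩, fun j h1 h2 => ?_,
    fun j h1 h2 i hij => ?_⟩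
  · have hlt := hq.step_lt h1 h2 hij
    have hmpos := hm0 _ (Finset.mem_Icc.2 (hidx j h1 h2 i hij))
    have hB := hpos (q j (i + 1))
    have hA : tail γ Δ (q j (i + 1)) < tail γ Δ (q j i) := by
      rw [htail j h1 h2 i hij (q j i) ⟨le_rfl, hlt.le⟩]
      have := mul_pos hmpos (sub_pos.2 hlt)
      linarith
    have hl : ∀ y ∈ Set.Icc (q j i) (q j (i + 1)), tail γ Δ y =
        line (q j i) (q j (i + 1)) (tail γ Δ (q j i)) (tail γ Δ (q j (i + 1))) y := by
      intro y hy
      rw [htail j h1 h2 i hij y hy, line, hslope j h1 h2 i hij]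
    have h0 := hpot j h1 h2 i hij.le
    have hr : q j (i + 1) ∈ Set.Icc (q j i) (q j (i + 1)) := ⟨hlt.le, le_rfl⟩
    have eF := potential_eq_stepF hξ h hi hΔ hlt hB hA hl h0 hr
    have eG := integral_potential_eq_stepG hξ h hi hΔ hlt hB hA hl h0 hr
    have hF := continuous_potential hξ h hi hΔ
    have hsub := intervalIntegral.integral_add_adjacent_intervals (μ := volume)
      (hF.intervalIntegrable (q j i) (q j (i + 1))) (hF.intervalIntegrable (q j (i + 1)) 1)
    rw [hzero j h1 h2 i hij.le, hzero j h1 h2 (i + 1) hij, add_zero, eG] at hsub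
    rw [hpot j h1 h2 (i + 1) hij, stepF, line_right] at eF
    have rel : (deriv ξ (q j (i + 1)) - deriv ξ (q j i)) *
        (tail γ Δ (q j i) * tail γ Δ (q j (i + 1))) = q j (i + 1) - q j i := by
      have := hB.trans hA
      rw [← eq_div_iff (by positivity)]
      linarith
    exact ⟨hq.nonneg h1 h2 hij.le, hlt, hB, hA, rel,
      (hFun_eq_stepG hlt hB hA rel).trans hsub,
      hP.deriv₂_mul_tail_sq_le hξ h hΔ (hI j h1 h2 i hij.le) (hzero j h1 h2 i hij.le),
      hP.deriv₂_mul_tail_sq_le hξ h hΔ (hI j h1 h2 (i + 1) hij) (hzero j h1 h2 (i + 1) hij)⟩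
  · obtain ⟨j, rfl⟩ : ∃ j', j = j' + 1 := ⟨j - 1, by omega⟩
    exact hgapd j (by omega) h2 _ ⟨(hq.gap_lt (by omega) h2).le, le_rfl⟩
  · rw [hslope j h1 h2 i (by omega), hslope j h1 h2 (i + 1) hij]
    exact hm (hidx j h1 h2 i (by omega)) (hidx j h1 h2 (i + 1) hij) (by omega)

end necessity

/-! ### Numbering the steps -/

lemma blockEnd_mono (s : ℕ → ℕ) {j j' : ℕ} (h : j ≤ j') : blockEnd s j ≤ blockEnd s j' :=
  Finset.sum_le_sum_of_subset (Finset.Icc_subset_Icc_right h)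

lemma exists_levels (s : ℕ → ℕ) (f : ℕ → ℕ → ℝ) (t : ℕ) :
    ∃ m : ℕ → ℝ, ∀ j, 1 ≤ j → j ≤ t → ∀ i, i < s j →
      m (blockEnd s (j - 1) + (i + 1)) = f j i := by
  induction t with
  | zero => exact ⟨0, fun j h1 h2 => by omega⟩
  | succ t ih =>
    obtain ⟨m, hm⟩ := ih
    refine ⟨fun l => if l ≤ blockEnd s t then m l else f (t + 1) (l - blockEnd s t - 1),
      fun j h1 h2 i hi => ?_⟩
    rcases h2.eq_or_lt with rfl | h2
    · simp only [Nat.add_sub_cancel]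
      rw [if_neg (by omega)]
      congr 1
      omega
    · have : blockEnd s (j - 1) + (i + 1) ≤ blockEnd s t := by
        refine le_trans ?_ (blockEnd_mono s (Nat.le_of_lt_succ h2))
        obtain ⟨j, rfl⟩ : ∃ j', j = j' + 1 := ⟨j - 1, by omega⟩
        rw [blockEnd_succ, Nat.add_sub_cancel]
        omega
      simp only [if_pos this]
      exact hm j h1 (by omega) i hi

lemma exists_index (s : ℕ → ℕ) (t : ℕ) {l : ℕ} (h1 : 1 ≤ l) (h2 : l ≤ blockEnd s t) :
    ∃ j i, 1 ≤ j ∧ j ≤ t ∧ i < s j ∧ l = blockEnd s (j - 1) + (i + 1) := by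
  induction t with
  | zero => rw [blockEnd_zero] at h2; omega
  | succ t ih =>
    rw [blockEnd_succ] at h2
    rcases le_or_gt l (blockEnd s t) with h | h
    · obtain ⟨j, i, a, b, c, d⟩ := ih h
      exact ⟨j, i, a, by omega, c, d⟩
    · exact ⟨t + 1, l - blockEnd s t - 1, by omega, le_rfl, by omega, by
        rw [Nat.add_sub_cancel]; omega⟩

/-! ### The right-continuous density -/

section cells

variable {k t : ℕ} {s : ℕ → ℕ} {q : ℕ → ℕ → ℝ} {m : ℕ → ℝ} {ω : ℝ → ℝ}

lemma cellDensity_Ico_step (hq : IsBlockSystem k t s q) {j i : ℕ} (h1 : 1 ≤ j) (h2 : j ≤ t)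
    (hi : i < s j) {x : ℝ} (hx : x ∈ Set.Ico (q j i) (q j (i + 1))) :
    cellDensity Set.Ico t s q m ω x = m (blockEnd s (j - 1) + (i + 1)) :=
  cellDensity_step hq h1 h2 hi hx
    (fun _ _ hb h => absurd (hx.1.trans_lt h.2) (not_lt.2 hb))
    (fun _ _ ha h => absurd (h.1.trans_lt hx.2) (not_lt.2 ha))

lemma cellDensity_Ico_gap (hq : IsBlockSystem k t s q) {j : ℕ} (h1 : 1 ≤ j) (h2 : j < t) {x : ℝ}
    (hx : x ∈ Set.Ico (q j (s j)) (q (j + 1) 0)) : cellDensity Set.Ico t s q m ω x = ω x :=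
  cellDensity_gap hq h1 h2 hx
    (fun _ _ hb h => absurd (hx.1.trans_lt h.2) (not_lt.2 hb))
    (fun _ _ ha h => absurd (h.1.trans_lt hx.2) (not_lt.2 ha))

lemma cellDensity_Ico_eq_zero (hq : IsBlockSystem k t s q) {x : ℝ} (hx : x ∉ Set.Ico (0 : ℝ) 1) :
    cellDensity Set.Ico t s q m ω x = 0 := by
  unfold cellDensity
  rw [Finset.sum_eq_zero, Finset.sum_eq_zero, add_zero]
  · intro j hj
    obtain ⟨h1, h2⟩ := Finset.mem_Icc.1 hj
    refine Set.indicator_of_notMem (fun h => hx ⟨?_, ?_⟩) _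
    · exact (hq.nonneg h1 (by omega) le_rfl).trans h.1
    · exact h.2.trans_le (hq.le_one (by omega) (by omega) (Nat.zero_le _))
  · intro j hj
    obtain ⟨h1, h2⟩ := Finset.mem_Icc.1 hj
    refine Finset.sum_eq_zero fun i hi => ?_
    obtain ⟨h3, h4⟩ := Finset.mem_Icc.1 hi
    refine Set.indicator_of_notMem (fun h => hx ⟨?_, ?_⟩) _
    · exact (hq.nonneg h1 h2 (by omega)).trans h.1
    · exact h.2.trans_le (hq.le_one h1 h2 h4)

/-- The closed and the half-open cells differ only at the countably many breakpoints. -/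
lemma frsbDensity_ae_eq : frsbDensity t s q m ω =ᵐ[volume] cellDensity Set.Ico t s q m ω := by
  have hc : (Set.range fun p : ℕ × ℕ => q p.1 p.2).Countable := Set.countable_range _
  filter_upwards [compl_mem_ae_iff.2 (hc.measure_zero volume)] with x hx
  have hI : ∀ a j i, x ∈ Set.Icc a (q j i) ↔ x ∈ Set.Ico a (q j i) := fun a j i =>
    ⟨fun h => ⟨h.1, lt_of_le_of_ne h.2 fun e => hx ⟨(j, i), e.symm⟩⟩, fun h => ⟨h.1, h.2.le⟩⟩
  classical
  simp only [frsbDensity, cellDensity, Set.indicator_apply, hI]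

lemma IsBlockSystem.exists_cell (hq : IsBlockSystem k t s q) {x : ℝ} (hx : x ∈ Set.Ico (0 : ℝ) 1) :
    (∃ j i, 1 ≤ j ∧ j ≤ t ∧ i < s j ∧ x ∈ Set.Ico (q j i) (q j (i + 1))) ∨
      ∃ j, 1 ≤ j ∧ j < t ∧ x ∈ Set.Ico (q j (s j)) (q (j + 1) 0) := by
  have ht := hq.two_le
  refine blockSweep (t := t) (s := s) (P := fun j i => x < q j i →
    (∃ j i, 1 ≤ j ∧ j ≤ t ∧ i < s j ∧ x ∈ Set.Ico (q j i) (q j (i + 1))) ∨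
      ∃ j, 1 ≤ j ∧ j < t ∧ x ∈ Set.Ico (q j (s j)) (q (j + 1) 0))
    (fun h => ?_) (fun j h1 h2 i hi ih h => ?_) (fun j h1 h2 ih h => ?_) t (by omega) le_rfl (s t)
    le_rfl (by rw [hq.q_one]; exact hx.2)
  · rw [hq.q_zero] at h
    exact absurd hx.1 (not_le.2 h)
  · rcases lt_or_ge x (q j i) with h' | h'
    · exact ih h'
    · exact Or.inl ⟨j, i, h1, h2, hi, h', h⟩
  · rcases lt_or_ge x (q j (s j)) with h' | h'
    · exact ih h'
    · exact Or.inr ⟨j, h1, h2, h', h⟩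

lemma monotoneOn_Ico_extend {g : ℝ → ℝ} {b c V : ℝ} (h1 : MonotoneOn g (Set.Ico 0 b))
    (hV : ∀ x ∈ Set.Ico 0 b, g x ≤ V) (h2 : MonotoneOn g (Set.Ico b c)) (hb : V ≤ g b) :
    MonotoneOn g (Set.Ico 0 c) := by
  intro x hx y hy hxy
  rcases lt_or_ge y b with hyb | hyb
  · exact h1 ⟨hx.1, hxy.trans_lt hyb⟩ ⟨hy.1, hyb⟩ hxy
  rcases lt_or_ge x b with hxb | hxb
  · exact (hV x ⟨hx.1, hxb⟩).trans (hb.trans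
      (h2 ⟨le_rfl, hyb.trans_lt hy.2⟩ ⟨hyb, hy.2⟩ hyb))
  · exact h2 ⟨hxb, hx.2⟩ ⟨hyb, hy.2⟩ hxy

lemma isDensity_cellDensity (hq : IsBlockSystem k t s q) (hs : ∀ j, 1 ≤ j → j ≤ t → 1 ≤ s j)
    (hm0 : ∀ j, 1 ≤ j → j ≤ t → ∀ i, i < s j → 0 ≤ m (blockEnd s (j - 1) + (i + 1)))
    (hm : ∀ j, 1 ≤ j → j ≤ t → ∀ i, i + 1 < s j →
      m (blockEnd s (j - 1) + (i + 1)) ≤ m (blockEnd s (j - 1) + (i + 2)))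
    (hω : ∀ j, 1 ≤ j → j < t → MonotoneOn ω (Set.Icc (q j (s j)) (q (j + 1) 0)))
    (hωc : ∀ j, 1 ≤ j → j < t → ContinuousOn ω (Set.Icc (q j (s j)) (q (j + 1) 0)))
    (hω0 : ∀ j, 1 ≤ j → j < t → ∀ x ∈ Set.Icc (q j (s j)) (q (j + 1) 0), 0 ≤ ω x)
    (hr : ∀ j, 1 ≤ j → j < t → m (blockEnd s (j - 1) + s j) ≤ ω (q j (s j)))
    (hl : ∀ j, 1 < j → j ≤ t → ω (q j 0) ≤ m (blockEnd s (j - 1) + 1)) :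
    IsDensity (cellDensity Set.Ico t s q m ω) := by
  have ht := hq.two_le
  -- The second clause bounds the density before a breakpoint by the value of the piece that ends
  -- there. It is vacuous at `q 1 0 = 0`.
  have hmono : ∀ j, 1 ≤ j → j ≤ t → ∀ i, i ≤ s j →
      MonotoneOn (cellDensity Set.Ico t s q m ω) (Set.Ico 0 (q j i)) ∧
      ∀ x ∈ Set.Ico 0 (q j i), cellDensity Set.Ico t s q m ω x ≤
        if i = 0 then ω (q j 0) else m (blockEnd s (j - 1) + i) := by
    refine blockSweep ?_ (fun j h1 h2 i hi ih => ?_) (fun j h1 h2 ih => ?_)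
    · rw [hq.q_zero, Set.Ico_self]
      exact ⟨fun x hx => absurd hx (Set.notMem_empty x),
        fun x hx => absurd hx (Set.notMem_empty x)⟩
    · have hlt := hq.step_lt h1 h2 hi
      have hcell : ∀ x ∈ Set.Ico (q j i) (q j (i + 1)), cellDensity Set.Ico t s q m ω x =
          m (blockEnd s (j - 1) + (i + 1)) := fun x hx => cellDensity_Ico_step hq h1 h2 hi hx
      rw [if_neg (by omega)]
      have hV : ∀ x ∈ Set.Ico 0 (q j i), cellDensity Set.Ico t s q m ω x ≤
          m (blockEnd s (j - 1) + (i + 1)) := by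
        intro x hx
        refine (ih.2 x hx).trans ?_
        split_ifs with hi0
        · subst hi0
          rcases h1.eq_or_lt with rfl | h1
          · rw [hq.q_zero] at hx
            exact absurd hx.1 (not_le.2 hx.2)
          · exact hl j h1 h2
        · obtain ⟨i, rfl⟩ : ∃ i', i = i' + 1 := ⟨i - 1, by omega⟩
          exact hm j h1 h2 i hi
      refine ⟨monotoneOn_Ico_extend ih.1 hV (fun x hx y hy _ => ?_) ?_, fun x hx => ?_⟩
      · rw [hcell x hx, hcell y hy]
      · rw [hcell _ ⟨le_rfl, hlt⟩]
      · rcases lt_or_ge x (q j i) with h' | h'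
        · exact hV x ⟨hx.1, h'⟩
        · exact (hcell x ⟨h', hx.2⟩).le
    · have hlt := hq.gap_lt h1 h2
      have hcell : ∀ x ∈ Set.Ico (q j (s j)) (q (j + 1) 0), cellDensity Set.Ico t s q m ω x =
          ω x := fun x hx => cellDensity_Ico_gap hq h1 h2 hx
      rw [if_pos rfl]
      have hsj := hs j h1 h2.le
      rw [if_neg (by omega)] at ih
      have hV : ∀ x ∈ Set.Ico 0 (q j (s j)), cellDensity Set.Ico t s q m ω x ≤
          ω (q j (s j)) := fun x hx => (ih.2 x hx).trans (hr j h1 h2)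
      have hωj := hω j h1 h2
      refine ⟨monotoneOn_Ico_extend ih.1 hV (fun x hx y hy hxy => ?_) ?_, fun x hx => ?_⟩
      · rw [hcell x hx, hcell y hy]
        exact hωj ⟨hx.1, hx.2.le⟩ ⟨hy.1, hy.2.le⟩ hxy
      · rw [hcell _ ⟨le_rfl, hlt⟩]
      · rcases lt_or_ge x (q j (s j)) with h' | h'
        · exact (hV x ⟨hx.1, h'⟩).trans (hωj ⟨le_rfl, hlt.le⟩ ⟨hlt.le, le_rfl⟩ hlt.le)
        · rw [hcell x ⟨h', hx.2⟩]
          exact hωj ⟨h', hx.2.le⟩ ⟨hlt.le, le_rfl⟩ hx.2.le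
  refine ⟨fun x => ?_, fun x hx => cellDensity_Ico_eq_zero hq hx, ?_, fun x hx => ?_⟩
  · by_cases hx : x ∈ Set.Ico (0 : ℝ) 1
    · rcases hq.exists_cell hx with ⟨j, i, h1, h2, hi, hx⟩ | ⟨j, h1, h2, hx⟩
      · rw [cellDensity_Ico_step hq h1 h2 hi hx]
        exact hm0 j h1 h2 i hi
      · rw [cellDensity_Ico_gap hq h1 h2 hx]
        exact hω0 j h1 h2 x ⟨hx.1, hx.2.le⟩
    · rw [cellDensity_Ico_eq_zero hq hx]
  · have := (hmono t (by omega) le_rfl (s t) le_rfl).1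
    rwa [hq.q_one] at this
  · rcases hq.exists_cell hx with ⟨j, i, h1, h2, hi, hx⟩ | ⟨j, h1, h2, hx⟩
    · refine (continuousWithinAt_const (b := m (blockEnd s (j - 1) + (i + 1)))).congr_of_eventuallyEq
        ?_ (cellDensity_Ico_step hq h1 h2 hi hx)
      filter_upwards [Ico_mem_nhdsGE hx.2] with y hy
      exact cellDensity_Ico_step hq h1 h2 hi ⟨hx.1.trans hy.1, hy.2⟩
    · have hcont : ContinuousWithinAt ω (Set.Ico x (q (j + 1) 0)) x :=
        (hωc j h1 h2 x ⟨hx.1, hx.2.le⟩).mono fun y hy => ⟨hx.1.trans hy.1, hy.2.le⟩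
      refine (hcont.mono_of_mem_nhdsWithin (Ico_mem_nhdsGE hx.2)).congr_of_eventuallyEq
        ?_ (cellDensity_Ico_gap hq h1 h2 hx)
      filter_upwards [Ico_mem_nhdsGE hx.2] with y hy
      exact cellDensity_Ico_gap hq h1 h2 ⟨hx.1.trans hy.1, hy.2⟩

end cells

/-! ### The density between the blocks -/

/-- The density `- ((ξ'')^{-1/2})'` between the blocks. -/
def gapDensity (ξ : ℝ → ℝ) (x : ℝ) : ℝ :=
  deriv (deriv (deriv ξ)) x * deriv (deriv ξ) x ^ (-(3 / 2) : ℝ) / 2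

section gap

variable {n : ℕ} {ξ : ℝ → ℝ} (hξ : IsMixture n ξ)

lemma rpow_of_mul_sq_eq_one {u a : ℝ} (ha : 0 < a) (h : u * a ^ 2 = 1) :
    u ^ (-(1 / 2) : ℝ) = a ∧ u ^ (-(3 / 2) : ℝ) = a ^ 3 := by
  have e : u = a ^ (-2 : ℝ) := by
    rw [Real.rpow_neg ha.le, Real.rpow_two]
    exact eq_inv_of_mul_eq_one_left h
  rw [e, ← Real.rpow_mul ha.le, ← Real.rpow_mul ha.le, ← Real.rpow_natCast]
  norm_num

lemma rpow_neg_half_sq {u : ℝ} (hu : 0 < u) : (u ^ (-(1 / 2) : ℝ)) ^ 2 = u⁻¹ := by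
  rw [← Real.rpow_natCast, ← Real.rpow_mul hu.le]
  norm_num
  rw [Real.rpow_neg_one]

include hξ

lemma hasDerivAt_rpow_neg_half {x : ℝ} (hx : 0 < x) :
    HasDerivAt (fun u => deriv (deriv ξ) u ^ (-(1 / 2) : ℝ)) (-gapDensity ξ x) x := by
  have hu := hξ.deriv₂_pos x hx
  refine ((hξ.hasDerivAt₂ x).rpow_const (Or.inl hu.ne')).congr_deriv ?_
  rw [gapDensity, show (-(1 / 2) - 1 : ℝ) = -(3 / 2) by norm_num]
  ring

lemma hasDerivAt_gapDensity {x : ℝ} (hx : 0 < x) :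
    HasDerivAt (gapDensity ξ)
      (slopeSign ξ x * deriv (deriv ξ) x ^ (-(5 / 2) : ℝ) / 4) x := by
  have hu := hξ.deriv₂_pos x hx
  refine (((hξ.hasDerivAt₃ x).mul
    ((hξ.hasDerivAt₂ x).rpow_const (p := -(3 / 2)) (Or.inl hu.ne'))).div_const 2).congr_deriv ?_
  have e : deriv (deriv ξ) x ^ (-(3 / 2) : ℝ) =
      deriv (deriv ξ) x ^ (-(5 / 2) : ℝ) * deriv (deriv ξ) x := by
    rw [← Real.rpow_add_one hu.ne']
    norm_num
  rw [e, show (-(3 / 2) - 1 : ℝ) = -(5 / 2) by norm_num, slopeSign]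
  ring

lemma gapDensity_nonneg {x : ℝ} (hx : 0 < x) : 0 ≤ gapDensity ξ x := by
  have := hξ.deriv₂_pos x hx
  have := hξ.deriv₃_pos x hx
  unfold gapDensity
  positivity

/-- Monotonicity is the sign of `slopeSign`. Were the density constant on a subinterval,
`(ξ'')^{-1/2}` would be affine there, contrary to `not_line`. -/
lemma strictMonoOn_gapDensity {a b : ℝ} (ha : 0 < a)
    (hs : ∀ x ∈ Set.Icc a b, 0 ≤ slopeSign ξ x) : StrictMonoOn (gapDensity ξ) (Set.Icc a b) := by
  have hmono : MonotoneOn (gapDensity ξ) (Set.Icc a b) := by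
    refine monotoneOn_of_deriv_nonneg (convex_Icc a b)
      (fun x hx => (hasDerivAt_gapDensity hξ (ha.trans_le hx.1)).continuousAt.continuousWithinAt)
      (fun x hx => ?_) fun x hx => ?_
    all_goals rw [interior_Icc] at hx
    · exact (hasDerivAt_gapDensity hξ (ha.trans hx.1)).differentiableAt.differentiableWithinAt
    · rw [(hasDerivAt_gapDensity hξ (ha.trans hx.1)).deriv]
      have := hs x ⟨hx.1.le, hx.2.le⟩
      have := hξ.deriv₂_pos x (ha.trans hx.1)
      positivity
  intro x hx y hy hxy
  refine lt_of_le_of_ne (hmono hx hy hxy.le) fun e => ?_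
  have hconst : ∀ z ∈ Set.Icc x y, gapDensity ξ z = gapDensity ξ x := fun z hz =>
    le_antisymm ((hmono ⟨hx.1.trans hz.1, hz.2.trans hy.2⟩ hy hz.2).trans e.ge)
      (hmono hx ⟨hx.1.trans hz.1, hz.2.trans hy.2⟩ hz.1)
  have hx0 := ha.trans_le hx.1
  refine hξ.not_line (deriv (deriv ξ) x ^ (-(1 / 2) : ℝ) + gapDensity ξ x * x) (gapDensity ξ x)
    x y hxy fun z hz => ?_
  have hz0 := hx0.trans hz.1
  have hd : ∀ w ∈ Set.Icc x y, HasDerivAt (fun w => deriv (deriv ξ) x ^ (-(1 / 2) : ℝ) +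
      gapDensity ξ x * x - gapDensity ξ x * w) (-gapDensity ξ w) w := fun w hw => by
    rw [hconst w hw]
    exact (((hasDerivAt_id w).const_mul (gapDensity ξ x)).const_sub _).congr_deriv (by simp)
  have := eq_of_hasDerivAt_eq
    (fun w hw => hasDerivAt_rpow_neg_half hξ (hx0.trans_le hw.1)) hd (by ring) ⟨hz.1.le, hz.2.le⟩
  rw [← this, rpow_neg_half_sq (hξ.deriv₂_pos z hz0)]
  exact mul_inv_cancel₀ (hξ.deriv₂_pos z hz0).ne'

lemma IsProfile.concavityCondition {t : ℕ} {s : ℕ → ℕ} {q av : ℕ → ℕ → ℝ}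
    (hq : IsBlockSystem n t s q) (h : IsProfile ξ t s q av) : ConcavityCondition ξ t s q := by
  rintro x ⟨j, h1, h2, hx⟩
  have hx0 : 0 < x := (hq.pos_of_pos h1 h2.le le_rfl (h.one_le hξ hq h1 h2.le)).trans_le hx.1
  have e : deriv (fun u => deriv (deriv ξ) u ^ (-(1 / 2) : ℝ)) =ᶠ[nhds x]
      fun u => -gapDensity ξ u := by
    filter_upwards [lt_mem_nhds hx0] with u hu
    exact (hasDerivAt_rpow_neg_half hξ hu).deriv
  rw [e.deriv_eq, (hasDerivAt_gapDensity hξ hx0).fun_neg.deriv]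
  have := h.slopeSign_nonneg hξ hq h1 h2 hx
  have := hξ.deriv₂_pos x hx0
  rw [neg_nonpos]
  positivity

end gap

/-! ### From the profile to the minimizer -/

namespace IsProfile

variable {n t : ℕ} {ξ : ℝ → ℝ} {s : ℕ → ℕ} {q av : ℕ → ℕ → ℝ} (hξ : IsMixture n ξ)
  (hq : IsBlockSystem n t s q) (h : IsProfile ξ t s q av)
include h

lemma gapDensity_right {j : ℕ} (h1 : 1 ≤ j) (h2 : j < t) :
    gapDensity ξ (q j (s j)) = deriv (deriv (deriv ξ)) (q j (s j)) * av j (s j) ^ 3 / 2 := by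
  rw [gapDensity, (rpow_of_mul_sq_eq_one (h.pos j h1 h2.le (s j) le_rfl) (h.right_eq j h1 h2)).2]

lemma gapDensity_left {j : ℕ} (h1 : 1 < j) (h2 : j ≤ t) :
    gapDensity ξ (q j 0) = deriv (deriv (deriv ξ)) (q j 0) * av j 0 ^ 3 / 2 := by
  rw [gapDensity, (rpow_of_mul_sq_eq_one (h.pos j h1.le h2 0 (Nat.zero_le _))
    (h.left_eq j h1 h2)).2]

include hξ hq

lemma strictMonoOn_gap {j : ℕ} (h1 : 1 ≤ j) (h2 : j < t) :
    StrictMonoOn (gapDensity ξ) (Set.Icc (q j (s j)) (q (j + 1) 0)) :=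
  strictMonoOn_gapDensity hξ (hq.pos_of_pos h1 h2.le le_rfl (h.one_le hξ hq h1 h2.le))
    fun _ hx => h.slopeSign_nonneg hξ hq h1 h2 hx

lemma gap_pos {j : ℕ} (h1 : 1 ≤ j) (h2 : j < t) {x : ℝ}
    (hx : x ∈ Set.Icc (q j (s j)) (q (j + 1) 0)) : 0 < x :=
  (hq.pos_of_pos h1 h2.le le_rfl (h.one_le hξ hq h1 h2.le)).trans_le hx.1

/-- A profile comes from a unique minimizer, which has the corresponding form. -/
theorem exists_isParisiMeasure :
    ∃ ν, IsParisiMeasure ξ ν ∧ (∀ ν', IsParisiMeasure ξ ν' → ν' = ν) ∧ HasFRSBForm n t s q ν := by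
  have ht := hq.two_le
  have hs : ∀ j, 1 ≤ j → j ≤ t → 1 ≤ s j := fun j h1 h2 => h.one_le hξ hq h1 h2
  obtain ⟨m, hm⟩ := exists_levels s
    (fun j i => (av j i - av j (i + 1)) / (q j (i + 1) - q j i)) t
  have hmpos : ∀ j, 1 ≤ j → j ≤ t → ∀ i, i < s j → 0 < m (blockEnd s (j - 1) + (i + 1)) :=
    fun j h1 h2 i hi => by
      rw [hm j h1 h2 i hi]
      exact (h.step j h1 h2 i hi).slope_pos
  have hmlt : ∀ j, 1 ≤ j → j ≤ t → ∀ i, i + 1 < s j →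
      m (blockEnd s (j - 1) + (i + 1)) < m (blockEnd s (j - 1) + (i + 2)) :=
    fun j h1 h2 i hi => by
      rw [hm j h1 h2 i (by omega), hm j h1 h2 (i + 1) hi]
      exact h.slope_lt j h1 h2 i hi
  have hright : ∀ j, 1 ≤ j → j < t → m (blockEnd s (j - 1) + s j) ≤ gapDensity ξ (q j (s j)) := by
    intro j h1 h2
    obtain ⟨i, hi⟩ : ∃ i, s j = i + 1 := ⟨s j - 1, by have := hs j h1 h2.le; omega⟩
    have hr := h.right_eq j h1 h2
    have hg := h.gapDensity_right h1 h2
    rw [hi] at hr hg ⊢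
    rw [hg, hm j h1 h2.le i (by omega)]
    exact (h.step j h1 h2.le i (by omega)).slope_le_of_right_eq hξ
      (h.not_hasDip hξ hq h1 h2.le (by omega)) hr
  have hleft : ∀ j, 1 < j → j ≤ t → gapDensity ξ (q j 0) < m (blockEnd s (j - 1) + 1) := by
    intro j h1 h2
    have := hm j h1.le h2 0 (hs j h1.le h2)
    rw [zero_add] at this
    rw [this, h.gapDensity_left h1 h2]
    exact h.lt_slope hξ hq h1 h2
  have hωmono := fun j h1 h2 => h.strictMonoOn_gap hξ hq (j := j) h1 h2
  have hωc : ∀ j, 1 ≤ j → j < t →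
      ContinuousOn (gapDensity ξ) (Set.Icc (q j (s j)) (q (j + 1) 0)) := fun j h1 h2 x hx =>
    (hasDerivAt_gapDensity hξ (h.gap_pos hξ hq h1 h2 hx)).continuousAt.continuousWithinAt
  have hω0 : ∀ j, 1 ≤ j → j < t → ∀ x ∈ Set.Icc (q j (s j)) (q (j + 1) 0), 0 ≤ gapDensity ξ x :=
    fun j h1 h2 x hx => gapDensity_nonneg hξ (h.gap_pos hξ hq h1 h2 hx)
  set γ := cellDensity Set.Ico t s q m (gapDensity ξ) with hγ
  set Δ := av t (s t) with hΔ'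
  have hΔ : 0 < Δ := h.pos t (by omega) le_rfl (s t) le_rfl
  have hd : IsDensity γ := isDensity_cellDensity hq hs
    (fun j h1 h2 i hi => (hmpos j h1 h2 i hi).le) (fun j h1 h2 i hi => (hmlt j h1 h2 i hi).le)
    (fun j h1 h2 => (hωmono j h1 h2).monotoneOn) hωc hω0 hright
    (fun j h1 h2 => (hleft j h1 h2).le)
  have hγstep : ∀ j, 1 ≤ j → j ≤ t → ∀ i, i < s j → ∀ x ∈ Set.Ico (q j i) (q j (i + 1)),
      γ x = m (blockEnd s (j - 1) + (i + 1)) :=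
    fun j h1 h2 i hi x hx => cellDensity_Ico_step hq h1 h2 hi hx
  have hγgap : ∀ j, 1 ≤ j → j < t → ∀ x ∈ Set.Ico (q j (s j)) (q (j + 1) 0),
      γ x = gapDensity ξ x := fun j h1 h2 x hx => cellDensity_Ico_gap hq h1 h2 hx
  -- The last block has a step, so the monotone density is bounded by its last level.
  have hi : Integrable γ := by
    have hst := hs t (by omega) le_rfl
    obtain ⟨i, hi⟩ : ∃ i, s t = i + 1 := ⟨s t - 1, by omega⟩
    have hlt := hq.step_lt (j := t) (i := i) (by omega) le_rfl (by omega)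
    have hq1 : q t (i + 1) = 1 := by rw [← hi, hq.q_one]
    have hq0 := hq.nonneg (j := t) (i := i) (by omega) le_rfl (by omega)
    have hbound : ∀ x ∈ Set.Ico (0 : ℝ) 1, γ x ≤ m (blockEnd s (t - 1) + (i + 1)) := by
      intro x hx
      have hy : max x (q t i) ∈ Set.Ico (q t i) (q t (i + 1)) :=
        ⟨le_max_right _ _, max_lt (hx.2.trans_eq hq1.symm) hlt⟩
      rw [← hγstep t (by omega) le_rfl i (by omega) _ hy]
      exact hd.mono hx ⟨hq0.trans hy.1, hy.2.trans_eq hq1⟩ (le_max_left _ _)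
    have hI : IntegrableOn γ (Set.Ico 0 1) := by
      refine Measure.integrableOn_of_bounded (M := m (blockEnd s (t - 1) + (i + 1))) (by simp)
        hd.aemeasurable.aestronglyMeasurable ?_
      filter_upwards [ae_restrict_mem measurableSet_Ico] with x hx
      rw [Real.norm_of_nonneg (hd.nonneg x)]
      exact hbound x hx
    exact (integrableOn_iff_integrable_of_support_subset fun x hx => by
      by_contra hx'
      exact hx (hd.eq_zero x hx')).1 hI
  have htailstep : ∀ j, 1 ≤ j → j ≤ t → ∀ i, i < s j → tail γ Δ (q j (i + 1)) = av j (i + 1) →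
      ∀ x ∈ Set.Icc (q j i) (q j (i + 1)), tail γ Δ x =
        line (q j i) (q j (i + 1)) (av j i) (av j (i + 1)) x := by
    intro j h1 h2 i hij hr x hx
    have e : ∫ z in x..q j (i + 1), γ z =
        ∫ z in x..q j (i + 1), m (blockEnd s (j - 1) + (i + 1)) := by
      rw [intervalIntegral.integral_of_le hx.2, intervalIntegral.integral_of_le hx.2,
        integral_Ioc_eq_integral_Ioo, integral_Ioc_eq_integral_Ioo]
      exact setIntegral_congr_fun measurableSet_Ioo fun z hz =>
        hγstep j h1 h2 i hij z ⟨hx.1.trans hz.1.le, hz.2⟩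
    have e' := tail_sub (Δ := Δ) hi x (q j (i + 1))
    rw [e, intervalIntegral.integral_const, smul_eq_mul, hr, hm j h1 h2 i hij] at e'
    rw [line]
    linarith
  have htailgap : ∀ j, 1 ≤ j → j < t → tail γ Δ (q (j + 1) 0) = av (j + 1) 0 →
      ∀ x ∈ Set.Icc (q j (s j)) (q (j + 1) 0),
        tail γ Δ x = deriv (deriv ξ) x ^ (-(1 / 2) : ℝ) := by
    intro j h1 h2 hr x hx
    have e : ∫ z in x..q (j + 1) 0, γ z = ∫ z in x..q (j + 1) 0, gapDensity ξ z := by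
      rw [intervalIntegral.integral_of_le hx.2, intervalIntegral.integral_of_le hx.2,
        integral_Ioc_eq_integral_Ioo, integral_Ioc_eq_integral_Ioo]
      exact setIntegral_congr_fun measurableSet_Ioo fun z hz =>
        hγgap j h1 h2 z ⟨hx.1.trans hz.1.le, hz.2⟩
    have hsub : Set.uIcc x (q (j + 1) 0) ⊆ Set.Icc (q j (s j)) (q (j + 1) 0) := by
      rw [Set.uIcc_of_le hx.2]
      exact Set.Icc_subset_Icc_left hx.1
    have e2 := intervalIntegral.integral_eq_sub_of_hasDerivAt
      (f := fun z => -deriv (deriv ξ) z ^ (-(1 / 2) : ℝ)) (f' := gapDensity ξ)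
      (a := x) (b := q (j + 1) 0)
      (fun z hz => ((hasDerivAt_rpow_neg_half hξ
        (h.gap_pos hξ hq h1 h2 (hsub hz))).fun_neg).congr_deriv (neg_neg _))
      ((hωc j h1 h2).mono hsub).intervalIntegrable
    have e' := tail_sub (Δ := Δ) hi x (q (j + 1) 0)
    rw [e, e2, hr, (rpow_of_mul_sq_eq_one (h.pos (j + 1) (by omega) h2 0 (Nat.zero_le _))
      (h.left_eq (j + 1) (by omega) h2)).1] at e'
    linarith
  -- Tails are computed downward from `1`, where the tail is `Δ`; the potential is computed upward
  -- from `0`, where it vanishes.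
  have htail : ∀ j, 1 ≤ j → j ≤ t → ∀ i, i ≤ s j → tail γ Δ (q j i) = av j i := by
    refine blockSweep_down ?_ (fun j h1 h2 i hij ih => ?_) (fun j h1 h2 ih => ?_)
    · rw [hq.q_one, tail_one]
    · have hlt := hq.step_lt h1 h2 hij
      rw [htailstep j h1 h2 i hij ih _ ⟨le_rfl, hlt.le⟩, line_left hlt]
    · rw [htailgap j h1 h2 ih _ ⟨le_rfl, (hq.gap_lt h1 h2).le⟩,
        (rpow_of_mul_sq_eq_one (h.pos j h1 h2.le (s j) le_rfl) (h.right_eq j h1 h2)).1]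
  have hline : ∀ j, 1 ≤ j → j ≤ t → ∀ i, i < s j →
      ∀ x ∈ Set.Icc (q j i) (q j (i + 1)), tail γ Δ x =
        line (q j i) (q j (i + 1)) (av j i) (av j (i + 1)) x := fun j h1 h2 i hij =>
    htailstep j h1 h2 i hij (htail j h1 h2 (i + 1) hij)
  have hpotgap : ∀ j, 1 ≤ j → j < t → potential ξ γ Δ (q j (s j)) = 0 →
      ∀ x ∈ Set.Icc (q j (s j)) (q (j + 1) 0), potential ξ γ Δ x = 0 := by
    intro j h1 h2 h0 x hx
    refine eq_of_hasDerivAt_eq (f' := fun _ => 0) (fun w hw => ?_)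
      (fun w _ => hasDerivAt_const w (0 : ℝ)) h0 hx
    have := hasDerivAt_potential hξ hd hi hΔ w
    rwa [htailgap j h1 h2 (htail (j + 1) (by omega) h2 0 (Nat.zero_le _)) w hw,
      rpow_neg_half_sq (hξ.deriv₂_pos w (h.gap_pos hξ hq h1 h2 hw)), inv_inv, sub_self] at this
  have hpot : ∀ j, 1 ≤ j → j ≤ t → ∀ i, i ≤ s j → potential ξ γ Δ (q j i) = 0 := by
    refine blockSweep ?_ (fun j h1 h2 i hij ih => ?_) (fun j h1 h2 ih => ?_)
    · simp [hq.q_zero, potential, hξ.deriv_zero]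
    · have hst := h.step j h1 h2 i hij
      rw [potential_eq_stepF hξ hd hi hΔ hst.lt hst.pos hst.anti (hline j h1 h2 i hij) ih
        ⟨hst.lt.le, le_rfl⟩, hst.stepF_right]
    · exact hpotgap j h1 h2 ih _ ⟨(hq.gap_lt h1 h2).le, le_rfl⟩
  have hF := continuous_potential hξ hd hi hΔ
  have hadd : ∀ x y, ∫ z in x..1, potential ξ γ Δ z =
      (∫ z in x..y, potential ξ γ Δ z) + ∫ z in y..1, potential ξ γ Δ z := fun x y =>
    (intervalIntegral.integral_add_adjacent_intervals (hF.intervalIntegrable _ _)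
      (hF.intervalIntegrable _ _)).symm
  have hintstep : ∀ j, 1 ≤ j → j ≤ t → ∀ i, i < s j → ∀ x ∈ Set.Icc (q j i) (q j (i + 1)),
      ∫ z in (q j i)..x, potential ξ γ Δ z =
        stepG ξ (q j i) (q j (i + 1)) (av j i) (av j (i + 1)) x := by
    intro j h1 h2 i hij x hx
    have hst := h.step j h1 h2 i hij
    exact integral_potential_eq_stepG hξ hd hi hΔ hst.lt hst.pos hst.anti (hline j h1 h2 i hij)
      (hpot j h1 h2 i hij.le) hx
  have hintgap : ∀ j, 1 ≤ j → j < t → ∀ x ∈ Set.Icc (q j (s j)) (q (j + 1) 0),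
      ∫ z in x..q (j + 1) 0, potential ξ γ Δ z = 0 := by
    intro j h1 h2 x hx
    rw [intervalIntegral.integral_congr (g := fun _ => 0), intervalIntegral.integral_zero]
    intro z hz
    rw [Set.uIcc_of_le hx.2] at hz
    exact hpotgap j h1 h2 (hpot j h1 h2.le (s j) le_rfl) z ⟨hx.1.trans hz.1, hz.2⟩
  have hzero : ∀ j, 1 ≤ j → j ≤ t → ∀ i, i ≤ s j →
      ∫ z in (q j i)..1, potential ξ γ Δ z = 0 := by
    refine blockSweep_down ?_ (fun j h1 h2 i hij ih => ?_) (fun j h1 h2 ih => ?_)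
    · rw [hq.q_one, intervalIntegral.integral_same]
    · have hst := h.step j h1 h2 i hij
      rw [hadd _ (q j (i + 1)), ih, hintstep j h1 h2 i hij _ ⟨hst.lt.le, le_rfl⟩,
        hst.stepG_right, add_zero]
    · rw [hadd _ (q (j + 1) 0), ih, hintgap j h1 h2 _ ⟨le_rfl, (hq.gap_lt h1 h2).le⟩, add_zero]
  have hgap0 : ∀ j, 1 ≤ j → j < t → ∀ x ∈ Set.Icc (q j (s j)) (q (j + 1) 0),
      ∫ z in x..1, potential ξ γ Δ z = 0 := fun j h1 h2 x hx => by
    rw [hadd _ (q (j + 1) 0), hintgap j h1 h2 x hx,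
      hzero (j + 1) (by omega) h2 0 (Nat.zero_le _), add_zero]
  obtain ⟨hmin, huniq⟩ := isParisiMeasure_of_potential hξ hd hi hΔ
    (by rw [← hq.q_one]; exact hpot t (by omega) le_rfl (s t) le_rfl)
    -- Inside a step the integral from `u` to `1` is `- stepG`, nonnegative because there is no dip.
    (fun u hu => by
      rcases hu.2.eq_or_lt with rfl | hu1
      · rw [intervalIntegral.integral_same]
      rcases hq.exists_cell ⟨hu.1, hu1⟩ with ⟨j, i, h1, h2, hij, hx⟩ | ⟨j, h1, h2, hx⟩
      · have hst := h.step j h1 h2 i hij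
        have e := hadd (q j i) u
        rw [hzero j h1 h2 i hij.le, hintstep j h1 h2 i hij u ⟨hx.1, hx.2.le⟩] at e
        have := hst.stepG_nonpos hξ (h.not_hasDip hξ hq h1 h2 hij) ⟨hx.1, hx.2.le⟩
        linarith
      · exact (hgap0 j h1 h2 u ⟨hx.1, hx.2.le⟩).ge)
    (fun u hu hsp => by
      rcases hu.2.eq_or_lt with rfl | hu1
      · rw [intervalIntegral.integral_same]
      rcases hq.exists_cell ⟨hu.1, hu1⟩ with ⟨j, i, h1, h2, hij, hx⟩ | ⟨j, h1, h2, hx⟩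
      · rcases hx.1.eq_or_lt with rfl | hlt
        · exact hzero j h1 h2 i hij.le
        -- The density is constant on the step, so an interior point cannot split it.
        · obtain ⟨r, -, hr1, hr2⟩ := hsp
          have hq0 := hq.nonneg h1 h2 hij.le
          have hq1 := hq.le_one h1 h2 (Nat.succ_le_of_lt hij)
          have a := hr1 (q j i) ⟨hq0, hlt.trans hu1⟩ hlt
          have hy : (u + q j (i + 1)) / 2 ∈ Set.Ico (q j i) (q j (i + 1)) :=
            ⟨by linarith [hx.2], by linarith [hx.2]⟩
          have b := hr2 ((u + q j (i + 1)) / 2) ⟨hq0.trans hy.1, hy.2.trans_le hq1⟩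
            (by linarith [hx.2])
          rw [hγstep j h1 h2 i hij _ ⟨le_rfl, hlt.trans hx.2⟩] at a
          rw [hγstep j h1 h2 i hij _ hy] at b
          linarith
      · exact hgap0 j h1 h2 u ⟨hx.1, hx.2.le⟩)
  have hindex : ∀ l, 1 ≤ l → l ≤ n →
      ∃ j i, 1 ≤ j ∧ j ≤ t ∧ i < s j ∧ l = blockEnd s (j - 1) + (i + 1) :=
    fun l h1 h2 => exists_index s t h1 (h2.trans_eq hq.sum_eq.symm)
  refine ⟨densityMeasure γ Δ, hmin, huniq, hq, m, gapDensity ξ, Δ, fun l hl => ?_, ?_, ?_, ?_, hΔ,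
    ?_⟩
  · obtain ⟨a, b⟩ := Finset.mem_Icc.1 hl
    obtain ⟨j, i, h1, h2, h3, rfl⟩ := hindex l a b
    exact hmpos j h1 h2 i h3
  · refine strictMonoOn_of_lt_add_one Set.ordConnected_Icc fun l _ hl hl' => ?_
    obtain ⟨j, i, h1, h2, h3, rfl⟩ := hindex l hl.1 hl.2
    rcases (Nat.succ_le_of_lt h3).lt_or_eq with h4 | h4
    · exact hmlt j h1 h2 i h4
    · have e : blockEnd s j = blockEnd s (j - 1) + s j := by
        obtain ⟨j, rfl⟩ : ∃ j', j = j' + 1 := ⟨j - 1, by omega⟩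
        rw [Nat.add_sub_cancel, blockEnd_succ]
      have hjt : j < t := by
        refine lt_of_le_of_ne h2 fun hjt => ?_
        have := hq.sum_eq
        have := hl'.2
        subst hjt
        omega
      -- Across a gap: last level of the block, at most the density at the left end of the gap, less
      -- than that at its right end, less than the next level.
      have a := hright j h1 hjt
      have b := (hωmono j h1 hjt) ⟨le_rfl, (hq.gap_lt h1 hjt).le⟩
        ⟨(hq.gap_lt h1 hjt).le, le_rfl⟩ (hq.gap_lt h1 hjt)
      have c := hleft (j + 1) (by omega) hjt
      rw [Nat.add_sub_cancel] at c
      rw [show blockEnd s (j - 1) + (i + 1) = blockEnd s (j - 1) + s j by omega, ← e]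
      rw [← e] at a
      exact a.trans_lt (b.trans c)
  · rintro x ⟨j, h1, h2, hx⟩ y ⟨j', h1', h2', hy⟩ hxy
    have hlt' := hq.gap_lt h1' h2'
    have hlt := hq.gap_lt h1 h2
    rcases lt_trichotomy j j' with hj | rfl | hj
    · have a : gapDensity ξ x ≤ gapDensity ξ (q (j + 1) 0) :=
        (hωmono j h1 h2).monotoneOn hx ⟨hlt.le, le_rfl⟩ hx.2
      have b := hleft (j + 1) (by omega) h2
      have hs1 := hs (j + 1) (by omega) h2
      have hst := hq.step_lt (j := j + 1) (i := 0) (by omega) h2 hs1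
      have e1 := hγstep (j + 1) (by omega) h2 0 hs1 (q (j + 1) 0) ⟨le_rfl, hst⟩
      have e2 := hγgap j' h1' h2' (q j' (s j')) ⟨le_rfl, hlt'⟩
      have hle : q (j + 1) 0 ≤ q j' (s j') := by
        rcases (Nat.succ_le_of_lt hj).eq_or_lt with e | hj'
        · rw [show j + 1 = j' from e]
          exact hq.block_le h1' h2'.le (Nat.zero_le _) le_rfl
        · exact (hq.lt_of_lt (by omega) hj' h2'.le (Nat.zero_le _) le_rfl).le
      have hq1 := hq.le_one (j := j' + 1) (by omega) h2' (Nat.zero_le _)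
      have c := hd.mono (a := q (j + 1) 0) (b := q j' (s j'))
        ⟨hq.nonneg (by omega) h2 (Nat.zero_le _), (hle.trans_lt hlt').trans_le hq1⟩
        ⟨hq.nonneg h1' h2'.le le_rfl, hlt'.trans_le hq1⟩ hle
      rw [e1, e2, zero_add] at c
      exact (a.trans_lt b).trans_le (c.trans
        ((hωmono j' h1' h2').monotoneOn ⟨le_rfl, hlt'.le⟩ hy hy.1))
    · exact hωmono j h1 h2 hx hy hxy
    · have hle : q (j' + 1) 0 ≤ q j (s j) := by
        rcases (Nat.succ_le_of_lt hj).eq_or_lt with e | hj'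
        · rw [show j' + 1 = j from e]
          exact hq.block_le h1 h2.le (Nat.zero_le _) le_rfl
        · exact (hq.lt_of_lt (by omega) hj' h2.le (Nat.zero_le _) le_rfl).le
      linarith [hx.1, hy.2]
  · rintro x ⟨j, h1, h2, hx⟩
    exact hω0 j h1 h2 x hx
  · rw [densityMeasure]
    congr 1
    refine withDensity_congr_ae ?_
    filter_upwards [frsbDensity_ae_eq (t := t) (s := s) (q := q) (m := m) (ω := gapDensity ξ)]
      with x hx
    rw [hx]

end IsProfile

end SphericalSpinGlass

end

theorem theorem11 (n : ℕ) (hn : 2 ≤ n) (p : Fin n → ℕ) (hp : StrictMono p)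
    (hp2 : ∀ i, 2 < p i) (lam : Fin n → ℝ) (hlam : ∀ i, 0 ≤ lam i) (hsum : ∑ i, lam i = 1) :
    -- the Parisi measure is `n`-FRSB iff some block system satisfies (1) and (2)
    (∀ ν : MeasureTheory.Measure ℝ,
      SphericalSpinGlass.IsParisiMeasure (SphericalSpinGlass.mixture p lam) ν →
      (SphericalSpinGlass.IsFRSB n ν ↔
        ∃ (t : ℕ) (s : ℕ → ℕ) (q : ℕ → ℕ → ℝ),
          SphericalSpinGlass.IsBlockSystem n t s q ∧
          (∀ j ∈ Finset.Icc 1 t, 1 ≤ s j) ∧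
          SphericalSpinGlass.BlockEquations (SphericalSpinGlass.mixture p lam) t s q ∧
          SphericalSpinGlass.BlockBounds (SphericalSpinGlass.mixture p lam) t s q)) ∧
    -- with the same breakpoints on both sides; moreover (1) and (2) imply (3) and (4)
    (∀ (t : ℕ) (s : ℕ → ℕ) (q : ℕ → ℕ → ℝ),
      SphericalSpinGlass.IsBlockSystem n t s q →
      (∀ j ∈ Finset.Icc 1 t, 1 ≤ s j) →
      ((∃ ν : MeasureTheory.Measure ℝ,
          SphericalSpinGlass.IsParisiMeasure (SphericalSpinGlass.mixture p lam) ν ∧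
          SphericalSpinGlass.HasFRSBForm n t s q ν) ↔
        (SphericalSpinGlass.BlockEquations (SphericalSpinGlass.mixture p lam) t s q ∧
          SphericalSpinGlass.BlockBounds (SphericalSpinGlass.mixture p lam) t s q)) ∧
      (SphericalSpinGlass.BlockEquations (SphericalSpinGlass.mixture p lam) t s q →
        SphericalSpinGlass.BlockBounds (SphericalSpinGlass.mixture p lam) t s q →
        SphericalSpinGlass.PositivityCondition (SphericalSpinGlass.mixture p lam) t s q ∧
        SphericalSpinGlass.ConcavityCondition (SphericalSpinGlass.mixture p lam) t s q)) := by
  have hξ := SphericalSpinGlass.isMixture_mixture hp hp2 hlam hsum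
  have hcrit : ∀ t s q, SphericalSpinGlass.IsBlockSystem n t s q →
      (∀ j ∈ Finset.Icc 1 t, 1 ≤ s j) →
      ((SphericalSpinGlass.BlockEquations (SphericalSpinGlass.mixture p lam) t s q ∧
        SphericalSpinGlass.BlockBounds (SphericalSpinGlass.mixture p lam) t s q) ↔
      ∃ av, SphericalSpinGlass.IsProfile (SphericalSpinGlass.mixture p lam) t s q av) :=
    fun t s q hq hs => SphericalSpinGlass.criterion_iff_isProfile hξ hq
      fun j h1 h2 => hs j (Finset.mem_Icc.2 ⟨h1, h2⟩)
  refine ⟨fun ν hν => ⟨?_, ?_⟩, fun t s q hq hs => ⟨⟨?_, fun h => ?_⟩, fun h1 h2 => ?_⟩⟩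
  · rintro ⟨t, s, q, hform⟩
    have hq := hform.1
    obtain ⟨av, hav⟩ := hν.exists_isProfile hξ hform
    -- The FRSB form allows an empty first or last block; the count of descents rules both out for
    -- `n` steps.
    have hs : ∀ j ∈ Finset.Icc 1 t, 1 ≤ s j := fun j hj =>
      hav.one_le hξ hq (Finset.mem_Icc.1 hj).1 (Finset.mem_Icc.1 hj).2
    exact ⟨t, s, q, hq, hs, (hcrit t s q hq hs).2 ⟨av, hav⟩⟩
  · rintro ⟨t, s, q, hq, hs, h⟩
    obtain ⟨av, hav⟩ := (hcrit t s q hq hs).1 h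
    obtain ⟨ν', -, huniq, hform⟩ := hav.exists_isParisiMeasure hξ hq
    -- Uniqueness transfers the form from the constructed minimizer to `ν`.
    rw [← huniq ν hν] at hform
    exact ⟨t, s, q, hform⟩
  · rintro ⟨ν, hν, hform⟩
    exact (hcrit t s q hq hs).2 (hν.exists_isProfile hξ hform)
  · obtain ⟨av, hav⟩ := (hcrit t s q hq hs).1 h
    obtain ⟨ν, hν, -, hform⟩ := hav.exists_isParisiMeasure hξ hq
    exact ⟨ν, hν, hform⟩
  · obtain ⟨av, hav⟩ := (hcrit t s q hq hs).1 ⟨h1, h2⟩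
    exact ⟨hav.positivityCondition hξ hq, hav.concavityCondition hξ hq⟩
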